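/- **Setting.** Let $\mathcal G\rightrightarrows M$ be a Lie groupoid ($M$ a Hausdorff manifold, $\mathcal G$ not necessarily Hausdorff) with source $s$, target $t$, units $x\mapsto 1_x$ and multiplication $m$, where $gh$ is defined if $s(g)=t(h)$. Its Lie algebroid is $A=\ker(dt)|_M$, with anchor $\rho=ds$ and with the bracket of left-invariant vector fields; $\xi^L$ is the left-invariant vector field of a section $\xi$. Let $\mathfrak k\subset A$ be a bundle of ideals of $\mathcal G$: a smooth vector subbundle contained in $\ker\rho$ and invariant under the conjugation action $\mathrm{Ad}_g:\ker\rho|_{s(g)}\to\ker\rho|_{t(g)}$ of $\mathcal G$. Put $K_g=dL_g(\mathfrak k_{s(g)})\subset T_g\mathcal G$. Let $E$ be a multiplicative Ehresmann connection for $\mathfrak k$: a smooth distribution with $T\mathcal G=E\oplus K$ which is a wide Lie subgroupoid of the tangent groupoid $T\mathcal G\rightrightarrows TM$. Let $h:T\mathcal G\to E$ be the projection along $K$, and let $\alpha\in\Omega^1(\mathcal G,s^*\mathfrak k)$ be the connection 1-form, $dL_g\,\alpha(v)=v-h(v)$ for $v\in T_g\mathcal G$. Let $\nabla$ be the linear connection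 on $\mathfrak k$ induced by $E$: for $v\in T_xM$ and a local section $\xi$ of $\mathfrak k$, $$\nabla_v\xi=\alpha\big([Y,\xi^L]_{1_x}\big)$$ for any local section $Y$ of $E$ near $1_x$ with $Y_{1_x}$ the image of $v$ under the differential of the unit map. Let $d^\nabla$ be the exterior derivative on $\mathfrak k$-valued forms $\Omega^\bullet(\mathcal G,\mathfrak k)=\Omega^\bullet(\mathcal G,s^*\mathfrak k)$ defined by the pull-back connection $s^*\nabla$ and the Koszul formula, and let $$(D\omega)(X_0,\dots,X_n)=(d^\nabla\omega)(hX_0,\dots,hX_n).$$ For $\beta\in\Omega^p(\mathcal G,\mathfrak k)$, $\gamma\in\Omega^q(\mathcal G,\mathfrak k)$ put $$[\beta,\gamma]_{\mathfrak k}(X_1,\dots,X_{p+q})=\sum_{\sigma\in S_{p+q}}(-1)^{|\sigma|}\big[\beta(X_{\sigma(1)},\dots,X_{\sigma(p)}),\gamma(X_{\sigma(p+1)},\dots,X_{\sigma(p+q)})\big]_{\mathfrak k}.$$ A form $\omega\in\Omega^n(\mathcal G,\mathfrak k)$ is multiplicative if $\mathrm{Ad}_{g_2^{-1}}\circ(\mathrm{pr}_1^*\omega)-m^*\omega+\mathrm{pr}_2^*\omega=0$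 at every composable pair $(g_1,g_2)$. **Proposition.** 0. If $p:\mathcal P\to M$ is a bundle of Lie groups and $i:\mathcal P\to\mathcal G$ a Lie groupoid morphism over $\mathrm{id}_M$ whose differential maps the Lie algebra bundle of $\mathcal P$ isomorphically onto $\mathfrak k$, then $\nabla$ is the connection induced from $\mathcal P$: for $X\in\mathfrak X(M)$ with horizontal lift $\widetilde X$ to $\mathcal P$ (that is, $di(\widetilde X)\in E$ and $dp(\widetilde X)=X\circ p$) and a section $\xi$ of the Lie algebra bundle of $\mathcal P$, one has $di\big([\widetilde X,\xi^L]_{1_x}\big)=\nabla_{X_x}(di\,\xi)$. 1. $\Omega:=D\alpha$ is a smooth $\mathfrak k$-valued 2-form on $\mathcal G$ (the curvature of $E$), and it is multiplicative. 2. For horizontal (local) vector fields $X,Y\in\Gamma(E)$: $\;dL_g\cdot\Omega(X,Y)_g=\big(h([X,Y])-[X,Y]\big)_g$. 3. In particular, if $\mathfrak k$ is induced by a surjective submersive Lie groupoid morphism $\Phi:\mathcal G\to\mathcal H$ over $\mathrm{id}_M$ (that is, $\mathfrak k_x=\ker d_{1_x}\Phi$), and $\widetilde U,\widetilde V$ are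 the horizontal lifts of (local) vector fields $U,V$ on $\mathcal H$, then $dL_g\cdot\Omega(\widetilde U,\widetilde V)_g=\big(\widetilde{[U,V]}-[\widetilde U,\widetilde V]\big)_g$. 4. Structure equation: $\Omega=d^\nabla\alpha+\tfrac12[\alpha,\alpha]_{\mathfrak k}$. 5. Bianchi identity: $D\Omega=0$. -/

import Mathlib

open scoped Manifold ContDiff Topology
open Set Filter

noncomputable section

/-! ### Lie groupoids -/

section Groupoid

variable (EG : Type*) [NormedAddCommGroup EG] [NormedSpace ℝ EG]
  (G : Type*) [TopologicalSpace G] [ChartedSpace EG G]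
  (EM : Type*) [NormedAddCommGroup EM] [NormedSpace ℝ EM]
  (M : Type*) [TopologicalSpace M] [ChartedSpace EM M]

/-- A Lie groupoid with manifold of arrows `G` (not necessarily Hausdorff) and manifold of
objects `M`. The product `mul g h` is meaningful when `s g = t h`; the values of `mul` on
non-composable pairs are irrelevant. The set of composable pairs is an embedded submanifold of
`G × G`, and `ContMDiffOn` on it says that the multiplication is smooth on this submanifold. -/
structure LieGroupoid where
  s : G → M
  t : G → M
  one : M → G
  inv : G → G
  mul : G → G → G
  s_one : ∀ x, s (one x) = x
  t_one : ∀ x, t (one x) = x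
  s_mul : ∀ g h, s g = t h → s (mul g h) = s h
  t_mul : ∀ g h, s g = t h → t (mul g h) = t g
  mul_assoc : ∀ g h k, s g = t h → s h = t k → mul (mul g h) k = mul g (mul h k)
  one_mul : ∀ g, mul (one (t g)) g = g
  mul_one : ∀ g, mul g (one (s g)) = g
  s_inv : ∀ g, s (inv g) = t g
  t_inv : ∀ g, t (inv g) = s g
  inv_mul : ∀ g, mul (inv g) g = one (s g)
  mul_inv : ∀ g, mul g (inv g) = one (t g)
  submersion_s : Manifold.IsSubmersion 𝓘(ℝ, EG) 𝓘(ℝ, EM) ∞ s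
  submersion_t : Manifold.IsSubmersion 𝓘(ℝ, EG) 𝓘(ℝ, EM) ∞ t
  smooth_one : ContMDiff 𝓘(ℝ, EM) 𝓘(ℝ, EG) ∞ one
  smooth_inv : ContMDiff 𝓘(ℝ, EG) 𝓘(ℝ, EG) ∞ inv
  smooth_mul : ContMDiffOn (𝓘(ℝ, EG).prod 𝓘(ℝ, EG)) 𝓘(ℝ, EG) ∞
    (fun p : G × G => mul p.1 p.2) {p : G × G | s p.1 = t p.2}

end Groupoid

section Tangent

variable {EG : Type*} [NormedAddCommGroup EG] [NormedSpace ℝ EG]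
  {G : Type*} [TopologicalSpace G] [ChartedSpace EG G]

/-- Transport of tangent vectors along an equality of base points. -/
def tcast {g h : G} (e : g = h) : TangentSpace 𝓘(ℝ, EG) g →ₗ[ℝ] TangentSpace 𝓘(ℝ, EG) h :=
  e ▸ LinearMap.id

variable (EG) in
/-- `X` is a smooth vector field on a neighbourhood of `g`. -/
def SmoothNear [IsManifold 𝓘(ℝ, EG) ∞ G] (X : ∀ g : G, TangentSpace 𝓘(ℝ, EG) g) (g : G) : Prop :=
  ∀ᶠ g' in 𝓝 g, ContMDiffAt 𝓘(ℝ, EG) (𝓘(ℝ, EG).tangent) ∞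
    (fun a => (⟨a, X a⟩ : TangentBundle 𝓘(ℝ, EG) G)) g'

end Tangent

namespace LieGroupoid

section Basic

variable {EG : Type*} [NormedAddCommGroup EG] [NormedSpace ℝ EG]
  {G : Type*} [TopologicalSpace G] [ChartedSpace EG G]
  {EM : Type*} [NormedAddCommGroup EM] [NormedSpace ℝ EM]
  {M : Type*} [TopologicalSpace M] [ChartedSpace EM M]
  (𝒢 : LieGroupoid EG G EM M)

/-- The differential of the source map at `g`. -/
def ds (g : G) : TangentSpace 𝓘(ℝ, EG) g →L[ℝ] TangentSpace 𝓘(ℝ, EM) (𝒢.s g) :=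
  mfderiv 𝓘(ℝ, EG) 𝓘(ℝ, EM) 𝒢.s g

/-- The differential of the target map at `g`. -/
def dt (g : G) : TangentSpace 𝓘(ℝ, EG) g →L[ℝ] TangentSpace 𝓘(ℝ, EM) (𝒢.t g) :=
  mfderiv 𝓘(ℝ, EG) 𝓘(ℝ, EM) 𝒢.t g

/-- The differential of the unit map at `x`. -/
def done (x : M) : TangentSpace 𝓘(ℝ, EM) x →L[ℝ] TangentSpace 𝓘(ℝ, EG) (𝒢.one x) :=
  mfderiv 𝓘(ℝ, EM) 𝓘(ℝ, EG) 𝒢.one x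

/-- The differential of the inversion at `g`. -/
def dinv (g : G) : TangentSpace 𝓘(ℝ, EG) g →L[ℝ] TangentSpace 𝓘(ℝ, EG) (𝒢.inv g) :=
  mfderiv 𝓘(ℝ, EG) 𝓘(ℝ, EG) 𝒢.inv g

/-- The differential of the multiplication at a composable pair `(g, h)`. The tangent space of the
manifold of composable pairs at `(g, h)` consists of the pairs `(v, w)` with `ds v = dt w`; on such
pairs the derivative within the set of composable pairs is uniquely determined, and only its values
on such pairs are used below. -/
def dmul (g h : G) : (TangentSpace 𝓘(ℝ, EG) g × TangentSpace 𝓘(ℝ, EG) h) →ₗ[ℝ]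
    TangentSpace 𝓘(ℝ, EG) (𝒢.mul g h) :=
  (mfderivWithin (𝓘(ℝ, EG).prod 𝓘(ℝ, EG)) 𝓘(ℝ, EG) (fun p : G × G => 𝒢.mul p.1 p.2)
    {p : G × G | 𝒢.s p.1 = 𝒢.t p.2} (g, h)).toLinearMap

/-- The pair of tangent vectors `(v, w)` at `(g, h)` is composable in the tangent groupoid. -/
def TComposable {g h : G} (e : 𝒢.s g = 𝒢.t h) (v : TangentSpace 𝓘(ℝ, EG) g)
    (w : TangentSpace 𝓘(ℝ, EG) h) : Prop :=
  tcast (EG := EM) e (𝒢.ds g v) = 𝒢.dt h w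

/-- Left translation `dL_g` at `h` (used on vectors tangent to the `t`-fibre through `h`, for
`s g = t h`). -/
def dL (g h : G) : TangentSpace 𝓘(ℝ, EG) h →ₗ[ℝ] TangentSpace 𝓘(ℝ, EG) (𝒢.mul g h) :=
  𝒢.dmul g h ∘ₗ LinearMap.inr ℝ (TangentSpace 𝓘(ℝ, EG) g) (TangentSpace 𝓘(ℝ, EG) h)

/-- Right translation `dR_h` at `g` (used on vectors tangent to the `s`-fibre through `g`, for
`s g = t h`). -/
def dR (g h : G) : TangentSpace 𝓘(ℝ, EG) g →ₗ[ℝ] TangentSpace 𝓘(ℝ, EG) (𝒢.mul g h) :=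
  𝒢.dmul g h ∘ₗ LinearMap.inl ℝ (TangentSpace 𝓘(ℝ, EG) g) (TangentSpace 𝓘(ℝ, EG) h)

/-- Left translation by `g` from the unit at `s g`: the map `dL_g : A_{s g} → T_g G`. -/
def dLunit (g : G) : TangentSpace 𝓘(ℝ, EG) (𝒢.one (𝒢.s g)) →ₗ[ℝ] TangentSpace 𝓘(ℝ, EG) g :=
  tcast (𝒢.mul_one g) ∘ₗ 𝒢.dL g (𝒢.one (𝒢.s g))

/-- Left translation by the inverse of `g`, from `T_g G` to the tangent space at the unit at
`s g`. -/
def dLinv (g : G) : TangentSpace 𝓘(ℝ, EG) g →ₗ[ℝ] TangentSpace 𝓘(ℝ, EG) (𝒢.one (𝒢.s g)) :=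
  tcast (𝒢.inv_mul g) ∘ₗ 𝒢.dL (𝒢.inv g) g

/-- The conjugation action `Ad_g`, on `ker ρ` at `s g`: the differential at the unit
of `k ↦ g k g⁻¹`. -/
def Ad (g : G) : TangentSpace 𝓘(ℝ, EG) (𝒢.one (𝒢.s g)) →ₗ[ℝ]
    TangentSpace 𝓘(ℝ, EG) (𝒢.one (𝒢.t g)) :=
  tcast (𝒢.mul_inv g) ∘ₗ 𝒢.dR g (𝒢.inv g) ∘ₗ 𝒢.dLunit g

/-- Vector fields along the units: sections of the restriction of `TG` to `M`. -/
abbrev UnitSection : Type _ := ∀ x : M, TangentSpace 𝓘(ℝ, EG) (𝒢.one x)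

/-- `ξ` is a smooth section on a neighbourhood of `x`. -/
def SmoothSectionNear [IsManifold 𝓘(ℝ, EG) ∞ G] (ξ : 𝒢.UnitSection) (x : M) : Prop :=
  ∀ᶠ y in 𝓝 x, ContMDiffAt 𝓘(ℝ, EM) (𝓘(ℝ, EG).tangent) ∞
    (fun z => (⟨𝒢.one z, ξ z⟩ : TangentBundle 𝓘(ℝ, EG) G)) y

/-- The left-invariant vector field `ξ^L` of a section `ξ` (of `A = ker dt` along the units). -/
def leftInv (ξ : 𝒢.UnitSection) : ∀ g : G, TangentSpace 𝓘(ℝ, EG) g :=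
  fun g => 𝒢.dLunit g (ξ (𝒢.s g))

/-- A morphism of Lie groupoids over the identity of `M`. -/
structure IsMorphism {EH : Type*} [NormedAddCommGroup EH] [NormedSpace ℝ EH]
    {H : Type*} [TopologicalSpace H] [ChartedSpace EH H]
    (ℋ : LieGroupoid EH H EM M) (Φ : G → H) : Prop where
  smooth : ContMDiff 𝓘(ℝ, EG) 𝓘(ℝ, EH) ∞ Φ
  map_s : ∀ g, ℋ.s (Φ g) = 𝒢.s g
  map_t : ∀ g, ℋ.t (Φ g) = 𝒢.t g
  map_one : ∀ x, Φ (𝒢.one x) = ℋ.one x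
  map_mul : ∀ g h, 𝒢.s g = 𝒢.t h → Φ (𝒢.mul g h) = ℋ.mul (Φ g) (Φ h)

variable [IsManifold 𝓘(ℝ, EG) ∞ G]

/-- A bundle of ideals of the Lie groupoid: a smooth vector subbundle `k` of the Lie algebroid
`A = ker dt` (restricted to the units), contained in the kernel of the anchor `ρ = ds`, and
invariant under conjugation. -/
structure BundleOfIdeals where
  fiber : ∀ x : M, Submodule ℝ (TangentSpace 𝓘(ℝ, EG) (𝒢.one x))
  exists_frame : ∀ x₀ : M, ∃ (r : ℕ) (e : Fin r → 𝒢.UnitSection),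
    (∀ i, 𝒢.SmoothSectionNear (e i) x₀) ∧
    ∀ᶠ x in 𝓝 x₀, LinearIndependent ℝ (fun i => e i x) ∧
      Submodule.span ℝ (range fun i => e i x) = fiber x
  dt_eq_zero : ∀ x, ∀ a ∈ fiber x, 𝒢.dt (𝒢.one x) a = 0
  ds_eq_zero : ∀ x, ∀ a ∈ fiber x, 𝒢.ds (𝒢.one x) a = 0
  Ad_mem : ∀ g, ∀ a ∈ fiber (𝒢.s g), 𝒢.Ad g a ∈ fiber (𝒢.t g)

/-- Families, over `g` in `G`, of alternating `n`-forms on `T_g G` with values in the tangent space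
at the unit at `s g`. -/
abbrev FormFamily (n : ℕ) : Type _ :=
  ∀ g : G, (TangentSpace 𝓘(ℝ, EG) g) [⋀^Fin n]→ₗ[ℝ] TangentSpace 𝓘(ℝ, EG) (𝒢.one (𝒢.s g))

/-- A multiplicative form: for composable arrows `g₁, g₂` and composable tangent vectors `v i` at
`g₁` and `w i` at `g₂`, one has `g₂⁻¹ · θ(v) - θ(dm(v, w)) + θ(w) = 0`. -/
def IsMultiplicative {n : ℕ} (θ : 𝒢.FormFamily n) : Prop :=
  ∀ (g₁ g₂ : G) (e : 𝒢.s g₁ = 𝒢.t g₂)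
    (v : Fin n → TangentSpace 𝓘(ℝ, EG) g₁) (w : Fin n → TangentSpace 𝓘(ℝ, EG) g₂),
    (∀ i, 𝒢.TComposable e (v i) (w i)) →
    tcast (congrArg 𝒢.one (𝒢.t_inv g₂))
        (𝒢.Ad (𝒢.inv g₂) (tcast (congrArg 𝒢.one (e.trans (𝒢.s_inv g₂).symm)) (θ g₁ v)))
      - tcast (congrArg 𝒢.one (𝒢.s_mul g₁ g₂ e))
          (θ (𝒢.mul g₁ g₂) (fun i => 𝒢.dmul g₁ g₂ (v i, w i)))
      + θ g₂ w = 0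

end Basic

section Connection

variable {EG : Type*} [NormedAddCommGroup EG] [NormedSpace ℝ EG]
  {G : Type*} [TopologicalSpace G] [ChartedSpace EG G]
  {EM : Type*} [NormedAddCommGroup EM] [NormedSpace ℝ EM]
  {M : Type*} [TopologicalSpace M] [ChartedSpace EM M]
  [IsManifold 𝓘(ℝ, EG) ∞ G]
  {𝒢 : LieGroupoid EG G EM M} (𝔨 : 𝒢.BundleOfIdeals)

namespace BundleOfIdeals

/-- The distribution `K_g = dL_g (k_{s g})` on `G`. -/
def K (g : G) : Submodule ℝ (TangentSpace 𝓘(ℝ, EG) g) :=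
  (𝔨.fiber (𝒢.s g)).map (𝒢.dLunit g)

/-- `ξ` is a smooth section of `k` on a neighbourhood of `x`. -/
def IsLocalSection (ξ : 𝒢.UnitSection) (x : M) : Prop :=
  𝒢.SmoothSectionNear ξ x ∧ ∀ᶠ y in 𝓝 x, ξ y ∈ 𝔨.fiber y

open scoped Classical in
/-- The Lie bracket on the fibre `k_x`: `[a, b] = [ξ^L, η^L]` at the unit at `x`, for any smooth local
sections `ξ, η` of `k` with `ξ x = a`, `η x = b` (since `k` lies in the kernel of the anchor, the
choice does not matter). -/
def bracket (x : M) (a b : TangentSpace 𝓘(ℝ, EG) (𝒢.one x)) :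
    TangentSpace 𝓘(ℝ, EG) (𝒢.one x) :=
  if h : (∃ ξ, 𝔨.IsLocalSection ξ x ∧ ξ x = a) ∧ (∃ η, 𝔨.IsLocalSection η x ∧ η x = b) then
    VectorField.mlieBracket 𝓘(ℝ, EG) (𝒢.leftInv h.1.choose) (𝒢.leftInv h.2.choose) (𝒢.one x)
  else 0

/-- `θ` is a smooth differential form on `G` with values in (the pull-back along `s` of) `k`. -/
structure IsForm {n : ℕ} (θ : 𝒢.FormFamily n) : Prop where
  mem : ∀ g v, θ g v ∈ 𝔨.fiber (𝒢.s g)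
  smooth : ∀ (g : G) (X : Fin n → ∀ g : G, TangentSpace 𝓘(ℝ, EG) g),
    (∀ i, SmoothNear EG (X i) g) →
    ContMDiffAt 𝓘(ℝ, EG) (𝓘(ℝ, EG).tangent) ∞
      (fun a => (⟨𝒢.one (𝒢.s a), θ a (fun i => X i a)⟩ : TangentBundle 𝓘(ℝ, EG) G)) g

/-- The bracket of `k`-valued forms of degree `p` and `q`, evaluated on `p + q` tangent vectors. -/
def wedgeBracket {p q : ℕ} (β : 𝒢.FormFamily p) (γ : 𝒢.FormFamily q) (g : G)
    (v : Fin (p + q) → TangentSpace 𝓘(ℝ, EG) g) : TangentSpace 𝓘(ℝ, EG) (𝒢.one (𝒢.s g)) :=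
  ∑ σ : Equiv.Perm (Fin (p + q)), (Equiv.Perm.sign σ : ℤ) •
    𝔨.bracket (𝒢.s g) (β g fun i => v (σ (Fin.castAdd q i))) (γ g fun j => v (σ (Fin.natAdd p j)))

end BundleOfIdeals

/-- A multiplicative Ehresmann connection for the bundle of ideals `k`: a smooth distribution `E`
with `TG = E ⊕ K` which is a wide subgroupoid of the tangent groupoid `TG` over `TM`. -/
structure EhresmannConnection where
  E : ∀ g : G, Submodule ℝ (TangentSpace 𝓘(ℝ, EG) g)
  exists_frame : ∀ g₀ : G, ∃ (r : ℕ) (X : Fin r → ∀ g : G, TangentSpace 𝓘(ℝ, EG) g),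
    (∀ i, SmoothNear EG (X i) g₀) ∧
    ∀ᶠ g in 𝓝 g₀, LinearIndependent ℝ (fun i => X i g) ∧
      Submodule.span ℝ (range fun i => X i g) = E g
  isCompl : ∀ g, IsCompl (E g) (𝔨.K g)
  one_mem : ∀ x v, 𝒢.done x v ∈ E (𝒢.one x)
  inv_mem : ∀ g, ∀ v ∈ E g, 𝒢.dinv g v ∈ E (𝒢.inv g)
  mul_mem : ∀ (g h : G) (e : 𝒢.s g = 𝒢.t h), ∀ v ∈ E g, ∀ w ∈ E h,
    𝒢.TComposable e v w → 𝒢.dmul g h (v, w) ∈ E (𝒢.mul g h)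

namespace EhresmannConnection

variable {𝔨} (𝓔 : EhresmannConnection 𝔨)

/-- The horizontal projection `h : TG → E` along `K`. -/
def hor (g : G) : TangentSpace 𝓘(ℝ, EG) g →ₗ[ℝ] TangentSpace 𝓘(ℝ, EG) g :=
  (𝓔.E g).projection (𝔨.K g) (𝓔.isCompl g)

/-- `X` is a smooth horizontal vector field on a neighbourhood of `g`. -/
def HorizontalNear (X : ∀ g : G, TangentSpace 𝓘(ℝ, EG) g) (g : G) : Prop :=
  SmoothNear EG X g ∧ ∀ᶠ a in 𝓝 g, X a ∈ 𝓔.E a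

/-- The connection 1-form as a linear map: `dL_g (α v) = v - h v`. -/
def alphaLin (g : G) : TangentSpace 𝓘(ℝ, EG) g →ₗ[ℝ] TangentSpace 𝓘(ℝ, EG) (𝒢.one (𝒢.s g)) :=
  𝒢.dLinv g ∘ₗ (LinearMap.id - 𝓔.hor g)

/-- The connection 1-form `α` of `E`. -/
def alpha : 𝒢.FormFamily 1 := fun g =>
  AlternatingMap.ofSubsingleton ℝ (TangentSpace 𝓘(ℝ, EG) g)
    (TangentSpace 𝓘(ℝ, EG) (𝒢.one (𝒢.s g))) (0 : Fin 1) (𝓔.alphaLin g)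

open scoped Classical in
/-- The linear connection `∇` on `k` induced by `E`: for `v` in `T_x M` and a section `ξ` of `k`,
`∇_v ξ` is the vertical part of `[Y, ξ^L]` at the unit at `x`, where `Y` is any smooth local
horizontal vector field with `Y = v` at the unit at `x` (the choice does not matter). -/
def nabla (ξ : 𝒢.UnitSection) (x : M) (v : TangentSpace 𝓘(ℝ, EM) x) :
    TangentSpace 𝓘(ℝ, EG) (𝒢.one x) :=
  if h : ∃ Y, 𝓔.HorizontalNear Y (𝒢.one x) ∧ Y (𝒢.one x) = 𝒢.done x v then
    tcast (congrArg 𝒢.one (𝒢.s_one x)) (𝓔.alphaLin (𝒢.one x)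
      (VectorField.mlieBracket 𝓘(ℝ, EG) h.choose (𝒢.leftInv ξ) (𝒢.one x)))
  else 0

variable (𝔨) in
/-- A way to write a section `σ` of `s^* k` near `g` as `∑ i, f i • s^* (e i)` with smooth functions
`f i` on `G` and smooth local sections `e i` of `k`. -/
structure PullbackDecomposition (σ : ∀ a : G, TangentSpace 𝓘(ℝ, EG) (𝒢.one (𝒢.s a))) (g : G) where
  n : ℕ
  f : Fin n → G → ℝ
  e : Fin n → 𝒢.UnitSection
  smooth_f : ∀ i, ContMDiffAt 𝓘(ℝ, EG) 𝓘(ℝ, ℝ) ∞ (f i) g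
  section_e : ∀ i, 𝔨.IsLocalSection (e i) (𝒢.s g)
  eq : ∀ᶠ a in 𝓝 g, σ a = ∑ i, f i a • e i (𝒢.s a)

open scoped Classical in
/-- The pull-back connection `∇^s = s^* ∇` on `s^* k`: it is determined by
`∇^s_v (f • s^* e) = (df v) • e + f • ∇_{ds v} e` (the choice of the decomposition does not
matter). -/
def nablaS (σ : ∀ a : G, TangentSpace 𝓘(ℝ, EG) (𝒢.one (𝒢.s a))) (g : G)
    (v : TangentSpace 𝓘(ℝ, EG) g) : TangentSpace 𝓘(ℝ, EG) (𝒢.one (𝒢.s g)) :=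
  if h : Nonempty (PullbackDecomposition 𝔨 σ g) then
    let d := Classical.choice h
    ∑ i, ((show ℝ from mfderiv 𝓘(ℝ, EG) 𝓘(ℝ, ℝ) (d.f i) g v) • d.e i (𝒢.s g)
      + d.f i g • 𝓔.nabla (d.e i) (𝒢.s g) (𝒢.ds g v))
  else 0

variable (𝒢) in
/-- The bracket terms `∑_{i < j} (-1)^{i+j} θ([X_i, X_j], X_0, …)` (with `X_i`, `X_j` omitted) of the
Koszul formula; the indices `(i, j)` with `i ≤ j` stand for `(i, j + 1)`, whence the sign. -/
def bracketTerms : ∀ {n : ℕ}, 𝒢.FormFamily n → (Fin (n + 1) → ∀ g : G, TangentSpace 𝓘(ℝ, EG) g) →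
    ∀ g : G, TangentSpace 𝓘(ℝ, EG) (𝒢.one (𝒢.s g))
  | 0, _, _, _ => 0
  | n + 1, θ, X, g => - ∑ i : Fin (n + 1), ∑ j ∈ Finset.Ici i, (-1 : ℝ) ^ (i + j : ℕ) •
      θ g (Matrix.vecCons (VectorField.mlieBracket 𝓘(ℝ, EG) (X i.castSucc) (X j.succ) g)
        (j.removeNth (i.castSucc.removeNth fun l => X l g)))

/-- `d^∇ θ` evaluated on smooth local vector fields `X_0, …, X_n`, by the Koszul formula. -/
def dNabla {n : ℕ} (θ : 𝒢.FormFamily n) (X : Fin (n + 1) → ∀ g : G, TangentSpace 𝓘(ℝ, EG) g)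
    (g : G) : TangentSpace 𝓘(ℝ, EG) (𝒢.one (𝒢.s g)) :=
  ∑ i : Fin (n + 1), (-1 : ℝ) ^ (i : ℕ) •
      𝓔.nablaS (fun a => θ a (i.removeNth fun l => X l a)) g (X i g)
    + bracketTerms 𝒢 θ X g

/-- `η = D θ`, where `D` is the exterior covariant derivative
`(D θ)(X_0, …, X_n) = (d^∇ θ)(h X_0, …, h X_n)`. -/
def IsD {n : ℕ} (θ : 𝒢.FormFamily n) (η : 𝒢.FormFamily (n + 1)) : Prop :=
  ∀ (g : G) (X : Fin (n + 1) → ∀ g : G, TangentSpace 𝓘(ℝ, EG) g),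
    (∀ i, SmoothNear EG (X i) g) →
    η g (fun i => X i g) = 𝓔.dNabla θ (fun i a => 𝓔.hor a (X i a)) g

end EhresmannConnection

end Connection

end LieGroupoid

end

/-!
Each tangent space of a manifold is, by definition, a copy of the model space, so forms, fields and
brackets are handled as functions with values in the model space (`mder`, `SmoothAlong`, `lieBr`,
`LieGroupoid.Ds`, `LieGroupoid.Dm`, `LieGroupoid.lT`, …). This turns the identifications of tangent
spaces at propositionally equal points into identities (`tcast_eq`).

A local frame of `𝔨` decomposes the connection form `α` into components `αᵢ`, which are smooth
real-valued one-forms on `G` (`LocalFrame.form`), and the proof computes with their exterior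
derivatives `dαᵢ` (`extD`), which obey the Koszul formula and are natural under pull-backs
(`extD_apply`, `extD_pullback`). Since `E` is a subgroupoid of the tangent groupoid, `α` is
multiplicative (`EhresmannConnection.al_Dm`). Pulling this back along a two-parameter family of
composable pairs and differentiating shows that `dαᵢ` is multiplicative on composable pairs with
horizontal first entries (`extD_mul`).

With a unit as second factor, multiplicativity determines `dαᵢ` at `g`, as soon as one of the
arguments is vertical, by its values at the unit of `s g` (`extD_lT`, `extD_lT_lT`). These values
are familiar: `dαᵢ (d1 v, ξ)` is the zeroth order term of `-∇ᵥ ξ` (`coef_nabla`, and `coef_nablaS`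
for the pull-back connection), and `dαᵢ (a, b)` is minus the `i`-th component of the bracket
`[a, b]` of `𝔨` (`coef_bracket`). The last statement needs that `K` is closed under brackets at the
units (`lieBr_leftInv_mem`), which holds because a vertical plane at a unit is tangent to a surface
of products of a curve with curves in the fibres of `t` (`extD_vertical`).

The curvature `Ω` has components `dαᵢ (h v, h w)` (`curv`). By the Koszul formula it is minus the
vertical part of the bracket of horizontal fields (`curv_eq`); in particular it does not depend on
the frame, and the case of a submersion follows because horizontal lifts are smooth and brackets of
related fields are related (`curv_horizontal_lift`). It is multiplicative by `extD_mul`, because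
`h` is multiplicative (`curv_Dm`). Expanding `dαᵢ (v, w)` along `v = h v + K`-part, and inserting
the values at the units, gives the structure equation (`extD_expand`, `structure_equation`). The
same expansion computes the covariant derivative of `Ω` in terms of iterated brackets (`nabS_curv`), and
the Bianchi identity becomes the Jacobi identity (`dNab_curvForm`). Finally, `∇` is the connection
induced from a bundle of Lie groups that integrates `𝔨` because the `αᵢ` may be pulled back to this
bundle (`mder_lieBr_eq_nabla`).
-/

noncomputable section

set_option linter.unusedSectionVars false

/-! ### Smooth vector fields along maps -/

/-- The manifold derivative as a linear map between the model spaces: each tangent space is, by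
definition, a copy of the model space. -/
def mder {E : Type*} [NormedAddCommGroup E] [NormedSpace ℝ E]
    {H : Type*} [TopologicalSpace H] (I : ModelWithCorners ℝ E H)
    {N : Type*} [TopologicalSpace N] [ChartedSpace H N]
    {E' : Type*} [NormedAddCommGroup E'] [NormedSpace ℝ E']
    {H' : Type*} [TopologicalSpace H'] (I' : ModelWithCorners ℝ E' H')
    {N' : Type*} [TopologicalSpace N'] [ChartedSpace H' N'] (f : N → N') (x : N) : E →L[ℝ] E' :=
  mfderiv I I' f x

section Along

variable {E : Type*} [NormedAddCommGroup E] [NormedSpace ℝ E]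
  {H : Type*} [TopologicalSpace H] {I : ModelWithCorners ℝ E H}
  {N : Type*} [TopologicalSpace N] [ChartedSpace H N]
  {EG : Type*} [NormedAddCommGroup EG] [NormedSpace ℝ EG]
  {G : Type*} [TopologicalSpace G] [ChartedSpace EG G] [IsManifold 𝓘(ℝ, EG) ∞ G]

variable (I) in
/-- `X` is a smooth field of tangent vectors along the map `f`, at the point `z`. The vectors are
recorded as elements of the model space. -/
def SmoothAlong (f : N → G) (X : N → EG) (z : N) : Prop :=
  ContMDiffAt I (𝓘(ℝ, EG).tangent) ∞ (fun y => (⟨f y, X y⟩ : TangentBundle 𝓘(ℝ, EG) G)) z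

theorem smoothAlong_iff {f : N → G} {X : N → EG} {z : N} :
    SmoothAlong I f X z ↔ ContMDiffAt I 𝓘(ℝ, EG) ∞ f z ∧
      ContMDiffAt I 𝓘(ℝ, EG) ∞ (fun y =>
        (trivializationAt EG (TangentSpace 𝓘(ℝ, EG)) (f z)).continuousLinearMapAt ℝ (f y) (X y)) z := by
  unfold SmoothAlong
  rw [Bundle.contMDiffAt_totalSpace]
  refine and_congr_right fun h => ?_
  refine Filter.EventuallyEq.contMDiffAt_iff ?_
  have := h.continuousAt.preimage_mem_nhds
    ((trivializationAt EG (TangentSpace 𝓘(ℝ, EG)) (f z)).open_baseSet.mem_nhds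
      (FiberBundle.mem_baseSet_trivializationAt' (f z)))
  filter_upwards [this] with y hy
  exact (Bundle.Trivialization.continuousLinearMapAt_apply_of_mem ℝ _ hy _).symm

theorem SmoothAlong.base {f : N → G} {X : N → EG} {z : N} (h : SmoothAlong I f X z) :
    ContMDiffAt I 𝓘(ℝ, EG) ∞ f z := (smoothAlong_iff.1 h).1

theorem SmoothAlong.congr {f f' : N → G} {X X' : N → EG} {z : N} (h : SmoothAlong I f X z)
    (hf : ∀ᶠ y in 𝓝 z, f' y = f y) (hX : ∀ᶠ y in 𝓝 z, X' y = X y) : SmoothAlong I f' X' z := by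
  refine ContMDiffAt.congr_of_eventuallyEq h ?_
  filter_upwards [hf, hX] with y h1 h2
  rw [h2, h1]

theorem SmoothAlong.add {f : N → G} {X Y : N → EG} {z : N} (hX : SmoothAlong I f X z)
    (hY : SmoothAlong I f Y z) : SmoothAlong I f (fun y => X y + Y y) z := by
  rw [smoothAlong_iff] at *
  refine ⟨hX.1, (hX.2.add hY.2).congr_of_eventuallyEq (Eventually.of_forall fun y => ?_)⟩
  exact map_add _ _ _

theorem SmoothAlong.smul {f : N → G} {X : N → EG} {c : N → ℝ} {z : N}
    (hc : ContMDiffAt I 𝓘(ℝ, ℝ) ∞ c z) (hX : SmoothAlong I f X z) :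
    SmoothAlong I f (fun y => c y • X y) z := by
  rw [smoothAlong_iff] at *
  refine ⟨hX.1, (hc.smul hX.2).congr_of_eventuallyEq (Eventually.of_forall fun y => ?_)⟩
  exact map_smul _ _ _

theorem SmoothAlong.zero {f : N → G} {z : N} (hf : ContMDiffAt I 𝓘(ℝ, EG) ∞ f z) :
    SmoothAlong I f (fun _ => (0 : EG)) z := by
  rw [smoothAlong_iff]
  refine ⟨hf, (contMDiffAt_const (c := (0 : EG))).congr_of_eventuallyEq
    (Eventually.of_forall fun y => ?_)⟩
  exact map_zero _

theorem SmoothAlong.sum {ι : Type*} {f : N → G} {X : ι → N → EG} {z : N} (s : Finset ι)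
    (hf : ContMDiffAt I 𝓘(ℝ, EG) ∞ f z) (hX : ∀ i, SmoothAlong I f (X i) z) :
    SmoothAlong I f (fun y => ∑ i ∈ s, X i y) z := by
  classical
  induction s using Finset.induction_on with
  | empty => simpa using SmoothAlong.zero hf
  | insert i s hi ih =>
    simp only [Finset.sum_insert hi]
    exact (hX i).add ih

theorem SmoothAlong.neg {f : N → G} {X : N → EG} {z : N} (hX : SmoothAlong I f X z) :
    SmoothAlong I f (fun y => - X y) z := by
  simpa using hX.smul (c := fun _ => (-1 : ℝ)) contMDiffAt_const

theorem SmoothAlong.sub {f : N → G} {X Y : N → EG} {z : N} (hX : SmoothAlong I f X z)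
    (hY : SmoothAlong I f Y z) : SmoothAlong I f (fun y => X y - Y y) z := by
  simpa [sub_eq_add_neg] using hX.add hY.neg

variable {E' : Type*} [NormedAddCommGroup E'] [NormedSpace ℝ E']
  {H' : Type*} [TopologicalSpace H'] {I' : ModelWithCorners ℝ E' H'}
  {N' : Type*} [TopologicalSpace N'] [ChartedSpace H' N']

theorem SmoothAlong.comp {f : N → G} {X : N → EG} {φ : N' → N} {z : N'}
    (h : SmoothAlong I f X (φ z)) (hφ : ContMDiffAt I' I ∞ φ z) :
    SmoothAlong I' (fun y => f (φ y)) (fun y => X (φ y)) z :=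
  ContMDiffAt.comp z h hφ

/-- Differentiating a smooth map in the direction of a smooth field gives a smooth field. -/
theorem smoothAlong_mder [IsManifold I ∞ N] {f : N → G} {b : N' → N} {V : N' → E} {z : N'}
    (hf : ContMDiffAt I 𝓘(ℝ, EG) ∞ f (b z))
    (hV : ContMDiffAt I' I.tangent ∞ (fun y => (⟨b y, V y⟩ : TangentBundle I N)) z) :
    SmoothAlong I' (fun y => f (b y)) (fun y => mder I 𝓘(ℝ, EG) f (b y) (V y)) z := by
  have : IsManifold I 1 N := .of_le (n := ∞) (by simp)
  have : IsManifold 𝓘(ℝ, EG) 1 G := .of_le (n := ∞) (by simp)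
  have hb : ContMDiffAt I' I ∞ b z := (Bundle.contMDiffAt_totalSpace.1 hV).1
  have A := (hf.mfderiv_const (m := ∞) (by simp)).comp z hb
  exact ContMDiffAt.clm_apply_of_inCoordinates (b₁ := b) (b₂ := fun y => f (b y))
    (ϕ := fun y => (mfderiv I 𝓘(ℝ, EG) f (b y) :)) A hV (hf.comp z hb)

end Along

/-! ### Coefficients with respect to a smooth frame -/

section Coefficients

variable {E : Type*} [NormedAddCommGroup E] [NormedSpace ℝ E]
  {H : Type*} [TopologicalSpace H] {I : ModelWithCorners ℝ E H}
  {N : Type*} [TopologicalSpace N] [ChartedSpace H N]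

/-- The coefficients of a smooth vector-valued function with respect to smooth functions that form
a basis at each point are smooth, because inversion of linear isomorphisms is smooth. -/
theorem contMDiffAt_coeff {V : Type*} [NormedAddCommGroup V] [NormedSpace ℝ V]
    [FiniteDimensional ℝ V] {ι : Type*} [Fintype ι] {b : ι → N → V} {w : N → V} {u : N → ι → ℝ}
    {z : N} (hb : ∀ i, ContMDiffAt I 𝓘(ℝ, V) ∞ (b i) z) (hw : ContMDiffAt I 𝓘(ℝ, V) ∞ w z)
    (hli : LinearIndependent ℝ (fun i => b i z)) (hsp : Submodule.span ℝ (range fun i => b i z) = ⊤)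
    (hu : ∀ᶠ y in 𝓝 z, w y = ∑ i, u y i • b i y) (i : ι) :
    ContMDiffAt I 𝓘(ℝ, ℝ) ∞ (fun y => u y i) z := by
  classical
  let L : N → (ι → ℝ) →L[ℝ] V := fun y =>
    ∑ i, (ContinuousLinearMap.proj (R := ℝ) (φ := fun _ : ι => ℝ) i).smulRight (b i y)
  have hLapp : ∀ y c, L y c = ∑ i, c i • b i y := by
    intro y c
    simp [L]
  have hL : ContMDiffAt I 𝓘(ℝ, (ι → ℝ) →L[ℝ] V) ∞ L z := by
    have : ∀ i, ContMDiffAt I 𝓘(ℝ, (ι → ℝ) →L[ℝ] V) ∞ (fun y =>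
        (ContinuousLinearMap.proj (R := ℝ) (φ := fun _ : ι => ℝ) i).smulRight (b i y)) z := by
      intro i
      exact ContMDiffAt.comp (I' := 𝓘(ℝ, V)) z (ContDiff.contMDiff
        (f := fun v : V => (ContinuousLinearMap.proj (R := ℝ) (φ := fun _ : ι => ℝ) i).smulRight v)
        (contDiff_const.smulRight contDiff_id)).contMDiffAt (hb i)
    simpa [L] using! contMDiffAt_finsetSum (t := Finset.univ) (fun i _ => this i)
  let B : Module.Basis ι ℝ V := Module.Basis.mk hli hsp.ge
  let e : (ι → ℝ) ≃L[ℝ] V := B.equivFun.symm.toContinuousLinearEquiv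
  have he : L z = e := by
    ext c
    simp [hLapp, e, B, Module.Basis.equivFun_symm_apply]
  have hinv : ContMDiffAt I 𝓘(ℝ, V →L[ℝ] (ι → ℝ)) ∞ (fun y => (L y).inverse) z := by
    have : ContMDiffAt 𝓘(ℝ, (ι → ℝ) →L[ℝ] V) 𝓘(ℝ, V →L[ℝ] (ι → ℝ)) ∞
        (ContinuousLinearMap.inverse : ((ι → ℝ) →L[ℝ] V) → V →L[ℝ] (ι → ℝ)) (L z) := by
      rw [he]
      exact (contDiffAt_map_inverse e).contMDiffAt
    exact this.comp z hL
  have hunit : ∀ᶠ y in 𝓝 z, (L y).IsInvertible := by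
    have : range ((↑) : ((ι → ℝ) ≃L[ℝ] V) → ((ι → ℝ) →L[ℝ] V)) ∈ 𝓝 (L z) := by
      rw [he]; exact ContinuousLinearEquiv.nhds e
    exact hL.continuousAt.preimage_mem_nhds this
  have hall : ContMDiffAt I 𝓘(ℝ, ι → ℝ) ∞ (fun y => (L y).inverse (w y)) z := hinv.clm_apply hw
  have : ContMDiffAt I 𝓘(ℝ, ι → ℝ) ∞ u z := by
    refine hall.congr_of_eventuallyEq ?_
    filter_upwards [hu, hunit] with y h1 h2
    obtain ⟨e', he'⟩ := h2
    rw [h1, ← hLapp, ← he']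
    simp
  exact (contMDiffAt_pi_space.1 this) i

end Coefficients

/-! ### The exterior derivative of one-forms -/

section OneForms

variable {EG : Type*} [NormedAddCommGroup EG] [NormedSpace ℝ EG]
  {G : Type*} [TopologicalSpace G] [ChartedSpace EG G] [IsManifold 𝓘(ℝ, EG) ∞ G]

/-- The real-valued one-form `θ` is smooth at `g`: it takes vector fields that are smooth at `g`
to functions that are smooth at `g`. -/
def SmoothOneForm (θ : G → EG →ₗ[ℝ] ℝ) (g : G) : Prop :=
  ∀ X : G → EG, SmoothAlong 𝓘(ℝ, EG) (fun a => a) X g →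
    ContMDiffAt 𝓘(ℝ, EG) 𝓘(ℝ, ℝ) ∞ (fun a => θ a (X a)) g

theorem contMDiffAt_extChartAt_symm_self (g : G) :
    ContMDiffAt 𝓘(ℝ, EG) 𝓘(ℝ, EG) ∞ (extChartAt 𝓘(ℝ, EG) g).symm (extChartAt 𝓘(ℝ, EG) g g) := by
  have := contMDiffWithinAt_extChartAt_symm_range_self (I := 𝓘(ℝ, EG)) (n := ∞) g
  simpa only [modelWithCornersSelf_coe, range_id, contMDiffWithinAt_univ] using this

theorem mder_extChartAt_symm_self (g : G) :
    mder 𝓘(ℝ, EG) 𝓘(ℝ, EG) (extChartAt 𝓘(ℝ, EG) g).symm (extChartAt 𝓘(ℝ, EG) g g)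
      = ContinuousLinearMap.id ℝ EG := by
  have : IsManifold 𝓘(ℝ, EG) 1 G := .of_le (n := ∞) (by simp)
  have := mfderivWithin_range_extChartAt_symm (I := 𝓘(ℝ, EG)) (x := g)
  rw [modelWithCornersSelf_coe, range_id, mfderivWithin_univ] at this
  exact this

theorem mder_extChartAt_self' (g : G) :
    mder 𝓘(ℝ, EG) 𝓘(ℝ, EG) (extChartAt 𝓘(ℝ, EG) g) g = ContinuousLinearMap.id ℝ EG := by
  have : IsManifold 𝓘(ℝ, EG) 1 G := .of_le (n := ∞) (by simp)
  exact mfderiv_extChartAt_self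

/-- The vector field with constant coefficients in the chart at `g` that takes the value `v`
at `g`. -/
def chartField (g : G) (v : EG) : G → EG := fun a =>
  mder 𝓘(ℝ, EG) 𝓘(ℝ, EG) (extChartAt 𝓘(ℝ, EG) g).symm (extChartAt 𝓘(ℝ, EG) g a) v

theorem smoothAlong_chartField (g : G) (v : EG) :
    SmoothAlong 𝓘(ℝ, EG) (fun a => a) (chartField g v) g := by
  have hb : ContMDiffAt 𝓘(ℝ, EG) 𝓘(ℝ, EG) ∞ (extChartAt 𝓘(ℝ, EG) g) g := contMDiffAt_extChartAt
  have hV : ContMDiffAt 𝓘(ℝ, EG) 𝓘(ℝ, EG).tangent ∞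
      (fun a => (⟨extChartAt 𝓘(ℝ, EG) g a, v⟩ : TangentBundle 𝓘(ℝ, EG) EG)) g := by
    rw [Bundle.contMDiffAt_totalSpace]
    refine ⟨hb, ?_⟩
    simpa using contMDiffAt_const
  have := smoothAlong_mder (b := extChartAt 𝓘(ℝ, EG) g) (V := fun _ => v)
    (contMDiffAt_extChartAt_symm_self g) hV
  refine this.congr ?_ (Eventually.of_forall fun _ => rfl)
  filter_upwards [extChartAt_source_mem_nhds (I := 𝓘(ℝ, EG)) g] with a ha
  exact ((extChartAt 𝓘(ℝ, EG) g).left_inv ha).symm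

variable [FiniteDimensional ℝ EG]

/-- A one-form in the chart at `g`. -/
def chartForm (θ : G → EG →ₗ[ℝ] ℝ) (g : G) (y : EG) : EG →L[ℝ] ℝ :=
  LinearMap.toContinuousLinearMap (θ ((extChartAt 𝓘(ℝ, EG) g).symm y) ∘ₗ
    (mder 𝓘(ℝ, EG) 𝓘(ℝ, EG) (extChartAt 𝓘(ℝ, EG) g).symm y).toLinearMap)

/-- The exterior derivative of a one-form at `g`, computed in the chart at `g` (whose derivative
at `g` is the identity). -/
def extD (θ : G → EG →ₗ[ℝ] ℝ) (g : G) (u w : EG) : ℝ :=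
  fderiv ℝ (chartForm θ g) (extChartAt 𝓘(ℝ, EG) g g) u w
    - fderiv ℝ (chartForm θ g) (extChartAt 𝓘(ℝ, EG) g g) w u

theorem chartForm_apply (θ : G → EG →ₗ[ℝ] ℝ) (g : G) (y v : EG) :
    chartForm θ g y v = θ ((extChartAt 𝓘(ℝ, EG) g).symm y)
      (mder 𝓘(ℝ, EG) 𝓘(ℝ, EG) (extChartAt 𝓘(ℝ, EG) g).symm y v) := rfl

theorem contDiffAt_chartForm {θ : G → EG →ₗ[ℝ] ℝ} {g : G} (h : SmoothOneForm θ g) :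
    ContDiffAt ℝ ∞ (chartForm θ g) (extChartAt 𝓘(ℝ, EG) g g) := by
  have key : ∀ v, ContDiffAt ℝ ∞ (fun y => chartForm θ g y v) (extChartAt 𝓘(ℝ, EG) g g) := by
    intro v
    have h1 := h _ (smoothAlong_chartField g v)
    have h2 : ContMDiffAt 𝓘(ℝ, EG) 𝓘(ℝ, ℝ) ∞
        (fun y => θ ((extChartAt 𝓘(ℝ, EG) g).symm y)
          (chartField g v ((extChartAt 𝓘(ℝ, EG) g).symm y))) (extChartAt 𝓘(ℝ, EG) g g) :=
      ContMDiffAt.comp_of_eq h1 (contMDiffAt_extChartAt_symm_self g) (by simp)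
    refine h2.contDiffAt.congr_of_eventuallyEq ?_
    filter_upwards [extChartAt_target_mem_nhds (I := 𝓘(ℝ, EG)) g] with y hy
    rw [chartForm_apply]
    unfold chartField
    rw [(extChartAt 𝓘(ℝ, EG) g).right_inv hy]
  let b := Module.finBasis ℝ EG
  have : chartForm θ g = fun y => ∑ i, chartForm θ g y (b i) •
      LinearMap.toContinuousLinearMap (b.coord i) := by
    funext y
    ext v
    calc chartForm θ g y v = chartForm θ g y (∑ i, b.repr v i • b i) := by rw [b.sum_repr]
      _ = _ := by
        rw [map_sum]
        simp [mul_comm]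
  rw [this]
  exact ContDiffAt.sum fun i _ => (key (b i)).smul contDiffAt_const

theorem extD_swap (θ : G → EG →ₗ[ℝ] ℝ) (g : G) (u w : EG) : extD θ g u w = - extD θ g w u := by
  unfold extD; ring

theorem extD_add_left (θ : G → EG →ₗ[ℝ] ℝ) (g : G) (u u' w : EG) :
    extD θ g (u + u') w = extD θ g u w + extD θ g u' w := by
  unfold extD; simp; ring

theorem extD_smul_left (θ : G → EG →ₗ[ℝ] ℝ) (g : G) (c : ℝ) (u w : EG) :
    extD θ g (c • u) w = c * extD θ g u w := by
  unfold extD; simp; ring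

section NormedSource

variable {W : Type*} [NormedAddCommGroup W] [NormedSpace ℝ W]

/-- The derivative of a map from a normed space, in terms of its expression in the chart at a
point of the target. -/
theorem eventually_mfderiv_eq_chart {f : W → G} {x : W}
    (hf : ContMDiffAt 𝓘(ℝ, W) 𝓘(ℝ, EG) ∞ f x) :
    ∀ᶠ y in 𝓝 x, ∀ v : W, mder 𝓘(ℝ, W) 𝓘(ℝ, EG) f y v =
      mder 𝓘(ℝ, EG) 𝓘(ℝ, EG) (extChartAt 𝓘(ℝ, EG) (f x)).symm (extChartAt 𝓘(ℝ, EG) (f x) (f y))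
        (fderiv ℝ (fun z => extChartAt 𝓘(ℝ, EG) (f x) (f z)) y v) := by
  have : IsManifold 𝓘(ℝ, EG) 1 G := .of_le (n := ∞) (by simp)
  have hsrc : ∀ᶠ y in 𝓝 x, f y ∈ (extChartAt 𝓘(ℝ, EG) (f x)).source :=
    hf.continuousAt.preimage_mem_nhds (extChartAt_source_mem_nhds (I := 𝓘(ℝ, EG)) (f x))
  have hd : ∀ᶠ y in 𝓝 x, ContMDiffAt 𝓘(ℝ, W) 𝓘(ℝ, EG) 1 f y :=
    contMDiffAt_iff_contMDiffAt_nhds (by simp) |>.1 (hf.of_le (by simp))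
  filter_upwards [hsrc, hsrc.eventually_nhds, hd] with y hy hy' hyd v
  have hc : MDifferentiableAt 𝓘(ℝ, EG) 𝓘(ℝ, EG) (extChartAt 𝓘(ℝ, EG) (f x)) (f y) :=
    mdifferentiableAt_extChartAt (by simpa using hy)
  have hs : MDifferentiableAt 𝓘(ℝ, EG) 𝓘(ℝ, EG) (extChartAt 𝓘(ℝ, EG) (f x)).symm
      (extChartAt 𝓘(ℝ, EG) (f x) (f y)) := by
    have := mdifferentiableWithinAt_extChartAt_symm (I := 𝓘(ℝ, EG)) (x := f x)
      ((extChartAt 𝓘(ℝ, EG) (f x)).map_source hy)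
    simpa only [modelWithCornersSelf_coe, range_id, mdifferentiableWithinAt_univ] using this
  have hfd := hyd.mdifferentiableAt (by simp)
  have h1 : MDifferentiableAt 𝓘(ℝ, W) 𝓘(ℝ, EG) (fun z => extChartAt 𝓘(ℝ, EG) (f x) (f z)) y :=
    hc.comp y hfd
  have h2 : mder 𝓘(ℝ, W) 𝓘(ℝ, EG) ((extChartAt 𝓘(ℝ, EG) (f x)).symm ∘
      (fun z => extChartAt 𝓘(ℝ, EG) (f x) (f z))) y = _ := mfderiv_comp y hs h1
  have h3 : f =ᶠ[𝓝 y] (extChartAt 𝓘(ℝ, EG) (f x)).symm ∘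
      (fun z => extChartAt 𝓘(ℝ, EG) (f x) (f z)) := by
    filter_upwards [hy'] with z hz
    exact ((extChartAt 𝓘(ℝ, EG) (f x)).left_inv hz).symm
  have h4 := h3.mfderiv_eq (I := 𝓘(ℝ, W)) (I' := 𝓘(ℝ, EG))
  have h5 : (mder 𝓘(ℝ, W) 𝓘(ℝ, EG) f y v : EG) = mder 𝓘(ℝ, W) 𝓘(ℝ, EG)
    ((extChartAt 𝓘(ℝ, EG) (f x)).symm ∘ (fun z => extChartAt 𝓘(ℝ, EG) (f x) (f z))) y v :=
    congrArg (fun L : W →L[ℝ] EG => L v) h4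
  refine h5.trans ?_
  rw [h2]
  simp only [mfderiv_eq_fderiv]
  rfl

theorem contDiffAt_chart_comp {f : W → G} {x : W} (hf : ContMDiffAt 𝓘(ℝ, W) 𝓘(ℝ, EG) ∞ f x) :
    ContDiffAt ℝ ∞ (fun z => extChartAt 𝓘(ℝ, EG) (f x) (f z)) x :=
  (ContMDiffAt.comp (I' := 𝓘(ℝ, EG)) x contMDiffAt_extChartAt hf).contDiffAt

/-- The pull-back of a smooth one-form along a smooth map, contracted with a vector field. -/
theorem hasFDerivAt_pullback {f : W → G} {x : W} (hf : ContMDiffAt 𝓘(ℝ, W) 𝓘(ℝ, EG) ∞ f x)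
    {θ : G → EG →ₗ[ℝ] ℝ} (hθ : SmoothOneForm θ (f x)) {V : W → W} (hV : DifferentiableAt ℝ V x) :
    DifferentiableAt ℝ (fun y => θ (f y) (mder 𝓘(ℝ, W) 𝓘(ℝ, EG) f y (V y))) x ∧
    ∀ u, fderiv ℝ (fun y => θ (f y) (mder 𝓘(ℝ, W) 𝓘(ℝ, EG) f y (V y))) x u =
      fderiv ℝ (chartForm θ (f x)) (extChartAt 𝓘(ℝ, EG) (f x) (f x))
        (mder 𝓘(ℝ, W) 𝓘(ℝ, EG) f x u) (mder 𝓘(ℝ, W) 𝓘(ℝ, EG) f x (V x))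
      + θ (f x) (fderiv ℝ (fderiv ℝ (fun z => extChartAt 𝓘(ℝ, EG) (f x) (f z))) x u (V x))
      + θ (f x) (mder 𝓘(ℝ, W) 𝓘(ℝ, EG) f x (fderiv ℝ V x u)) := by
  set F : W → EG := fun z => extChartAt 𝓘(ℝ, EG) (f x) (f z) with hFdef
  have hF : ContDiffAt ℝ ∞ F x := contDiffAt_chart_comp hf
  have hE := eventually_mfderiv_eq_chart hf
  have hid : ∀ v : W, (mder 𝓘(ℝ, W) 𝓘(ℝ, EG) f x v : EG) = fderiv ℝ F x v := by
    intro v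
    have := hE.self_of_nhds v
    rw [mder_extChartAt_symm_self] at this
    exact this
  have hΘ : ∀ v, chartForm θ (f x) (F x) v = θ (f x) v := by
    intro v
    have h1 : (extChartAt 𝓘(ℝ, EG) (f x)).symm (F x) = f x := by simp [F]
    rw [chartForm_apply, h1]
    exact congrArg (θ (f x)) (congrArg (fun L : EG →L[ℝ] EG => L v)
      (mder_extChartAt_symm_self (f x)))
  have heq : (fun y => θ (f y) (mder 𝓘(ℝ, W) 𝓘(ℝ, EG) f y (V y))) =ᶠ[𝓝 x]
      fun y => chartForm θ (f x) (F y) (fderiv ℝ F y (V y)) := by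
    have hsrc : ∀ᶠ y in 𝓝 x, f y ∈ (extChartAt 𝓘(ℝ, EG) (f x)).source :=
      hf.continuousAt.preimage_mem_nhds (extChartAt_source_mem_nhds (I := 𝓘(ℝ, EG)) (f x))
    filter_upwards [hE, hsrc] with y hy hys
    have h1 : (extChartAt 𝓘(ℝ, EG) (f x)).symm (F y) = f y :=
      (extChartAt 𝓘(ℝ, EG) (f x)).left_inv hys
    rw [chartForm_apply, h1]
    exact congrArg (θ (f y)) (hy (V y))
  have hd1 : HasFDerivAt F (fderiv ℝ F x) x := (hF.differentiableAt (by simp)).hasFDerivAt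
  have hd2 : HasFDerivAt (fderiv ℝ F) (fderiv ℝ (fderiv ℝ F) x) x :=
    ((hF.fderiv_right (m := 1) (by norm_cast)).differentiableAt (by simp)).hasFDerivAt
  have hd3 : HasFDerivAt (chartForm θ (f x)) (fderiv ℝ (chartForm θ (f x)) (F x)) (F x) :=
    ((contDiffAt_chartForm hθ).differentiableAt (by simp)).hasFDerivAt
  have hmain := (hd3.comp x hd1).clm_apply (hd2.clm_apply hV.hasFDerivAt)
  have hmain' := hmain.congr_of_eventuallyEq heq
  refine ⟨hmain'.differentiableAt, fun u => ?_⟩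
  have hFx : extChartAt 𝓘(ℝ, EG) (f x) (f x) = F x := rfl
  rw [hmain'.fderiv, hFx]
  simp only [hid]
  simp only [add_apply, ContinuousLinearMap.comp_apply,
    ContinuousLinearMap.flip_apply, Function.comp_apply, map_add, hΘ]
  ring

/-- The pull-back formula: the exterior derivative of a one-form, evaluated on the images of two
vector fields on a normed space under a smooth map, is given by the Koszul formula upstairs. -/
theorem extD_pullback_normed {f : W → G} {x : W} (hf : ContMDiffAt 𝓘(ℝ, W) 𝓘(ℝ, EG) ∞ f x)
    {θ : G → EG →ₗ[ℝ] ℝ} (hθ : SmoothOneForm θ (f x)) {U V : W → W} (hU : DifferentiableAt ℝ U x)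
    (hV : DifferentiableAt ℝ V x) :
    extD θ (f x) (mder 𝓘(ℝ, W) 𝓘(ℝ, EG) f x (U x)) (mder 𝓘(ℝ, W) 𝓘(ℝ, EG) f x (V x)) =
      fderiv ℝ (fun y => θ (f y) (mder 𝓘(ℝ, W) 𝓘(ℝ, EG) f y (V y))) x (U x)
      - fderiv ℝ (fun y => θ (f y) (mder 𝓘(ℝ, W) 𝓘(ℝ, EG) f y (U y))) x (V x)
      - θ (f x) (mder 𝓘(ℝ, W) 𝓘(ℝ, EG) f x (VectorField.lieBracket (E := W) ℝ U V x)) := by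
  have hF : ContDiffAt ℝ ∞ (fun z => extChartAt 𝓘(ℝ, EG) (f x) (f z)) x := contDiffAt_chart_comp hf
  have hsymm := (hF.isSymmSndFDerivAt (by simp; norm_cast)).eq (U x) (V x)
  rw [(hasFDerivAt_pullback hf hθ hU).2, (hasFDerivAt_pullback hf hθ hV).2, hsymm,
    VectorField.lieBracket]
  unfold extD
  rw [map_sub, map_sub]
  ring

end NormedSource

end OneForms

/-! ### Calculus of manifold derivatives in the model spaces -/

section Derivatives

variable {E : Type*} [NormedAddCommGroup E] [NormedSpace ℝ E]
  {H : Type*} [TopologicalSpace H] {I : ModelWithCorners ℝ E H}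
  {N : Type*} [TopologicalSpace N] [ChartedSpace H N]
  {E' : Type*} [NormedAddCommGroup E'] [NormedSpace ℝ E']
  {H' : Type*} [TopologicalSpace H'] {I' : ModelWithCorners ℝ E' H'}
  {N' : Type*} [TopologicalSpace N'] [ChartedSpace H' N']
  {E'' : Type*} [NormedAddCommGroup E''] [NormedSpace ℝ E'']
  {H'' : Type*} [TopologicalSpace H''] {I'' : ModelWithCorners ℝ E'' H''}
  {N'' : Type*} [TopologicalSpace N''] [ChartedSpace H'' N'']

theorem mder_comp {f : N → N'} {g : N' → N''} {x : N} (hg : MDifferentiableAt I' I'' g (f x))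
    (hf : MDifferentiableAt I I' f x) (v : E) :
    mder I I'' (fun y => g (f y)) x v = mder I' I'' g (f x) (mder I I' f x v) :=
  congrArg (fun L : E →L[ℝ] E'' => L v) (mfderiv_comp x hg hf)

theorem mder_congr {f f' : N → N'} {x : N} (h : ∀ᶠ y in 𝓝 x, f y = f' y) :
    mder I I' f x = mder I I' f' x :=
  Filter.EventuallyEq.mfderiv_eq (I := I) (I' := I') h

theorem mder_of_hasMFDerivAt {f : N → N'} {x : N} {L : E →L[ℝ] E'}
    (h : HasMFDerivAt I I' f x L) : mder I I' f x = L := h.mfderiv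

theorem mder_id (x : N) (v : E) : mder I I (fun y => y) x v = v :=
  congrArg (fun L : E →L[ℝ] E => L v) (mfderiv_id (I := I) (x := x))

theorem mder_const (c : N') (x : N) (v : E) : mder I I' (fun _ => c) x v = 0 :=
  congrArg (fun L : E →L[ℝ] E' => L v) (mfderiv_const (I := I) (I' := I') (x := x) (c := c))

theorem mder_add {f g : N → E'} {x : N} (hf : MDifferentiableAt I 𝓘(ℝ, E') f x)
    (hg : MDifferentiableAt I 𝓘(ℝ, E') g x) (v : E) :
    mder I 𝓘(ℝ, E') (fun y => f y + g y) x v =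
      mder I 𝓘(ℝ, E') f x v + mder I 𝓘(ℝ, E') g x v :=
  congrArg (fun L : E →L[ℝ] E' => L v) (hf.hasMFDerivAt.add hg.hasMFDerivAt).mfderiv

theorem mder_mul {f g : N → ℝ} {x : N} (hf : MDifferentiableAt I 𝓘(ℝ, ℝ) f x)
    (hg : MDifferentiableAt I 𝓘(ℝ, ℝ) g x) (v : E) :
    mder I 𝓘(ℝ, ℝ) (fun y => f y * g y) x v =
      f x * mder I 𝓘(ℝ, ℝ) g x v + g x * mder I 𝓘(ℝ, ℝ) f x v :=
  congrArg (fun L : E →L[ℝ] ℝ => L v) (hf.hasMFDerivAt.mul hg.hasMFDerivAt).mfderiv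

theorem mder_sum {ι : Type*} (s : Finset ι) {f : ι → N → ℝ} {x : N}
    (hf : ∀ i, MDifferentiableAt I 𝓘(ℝ, ℝ) (f i) x) (v : E) :
    MDifferentiableAt I 𝓘(ℝ, ℝ) (fun y => ∑ i ∈ s, f i y) x ∧
    mder I 𝓘(ℝ, ℝ) (fun y => ∑ i ∈ s, f i y) x v = ∑ i ∈ s, mder I 𝓘(ℝ, ℝ) (f i) x v := by
  classical
  induction s using Finset.induction_on with
  | empty => simpa using! ⟨mdifferentiableAt_const (c := (0 : ℝ)), mder_const (0 : ℝ) x v⟩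
  | insert i s hi ih =>
    simp only [Finset.sum_insert hi]
    exact ⟨(hf i).add ih.1, by rw [mder_add (hf i) ih.1, ih.2]⟩

end Derivatives

/-! ### Lie brackets and related vector fields -/

section Brackets

variable {EG : Type*} [NormedAddCommGroup EG] [NormedSpace ℝ EG] [FiniteDimensional ℝ EG]
  {G : Type*} [TopologicalSpace G] [ChartedSpace EG G] [IsManifold 𝓘(ℝ, EG) ∞ G]
  {EN : Type*} [NormedAddCommGroup EN] [NormedSpace ℝ EN] [FiniteDimensional ℝ EN]
  {N : Type*} [TopologicalSpace N] [ChartedSpace EN N] [IsManifold 𝓘(ℝ, EN) ∞ N]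

/-- The Lie bracket of vector fields that are given by functions to the model space. -/
def lieBr (X Y : G → EG) (g : G) : EG := VectorField.mlieBracket 𝓘(ℝ, EG) (M := G) X Y g

/-- The expression of a vector field in the chart at `n`. -/
def chartRep (n : N) (U : N → EN) : EN → EN := fun y =>
  (mder 𝓘(ℝ, EN) 𝓘(ℝ, EN) (extChartAt 𝓘(ℝ, EN) n).symm y).inverse
    (U ((extChartAt 𝓘(ℝ, EN) n).symm y))

theorem mpullbackWithin_eq_chartRep (n : N) (U : N → EN) :
    VectorField.mpullbackWithin 𝓘(ℝ, EN) 𝓘(ℝ, EN) (extChartAt 𝓘(ℝ, EN) n).symm U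
      (range 𝓘(ℝ, EN)) = chartRep n U := by
  rw [modelWithCornersSelf_coe, range_id]
  exact VectorField.mpullbackWithin_univ

theorem lieBr_eq_lieBracket (U V : N → EN) (n : N) :
    lieBr U V n = VectorField.lieBracket ℝ (chartRep n U) (chartRep n V)
      (extChartAt 𝓘(ℝ, EN) n n) := by
  have h : lieBr U V n = (mder 𝓘(ℝ, EN) 𝓘(ℝ, EN) (extChartAt 𝓘(ℝ, EN) n) n).inverse
      (VectorField.lieBracketWithin ℝ
        (VectorField.mpullbackWithin 𝓘(ℝ, EN) 𝓘(ℝ, EN) (extChartAt 𝓘(ℝ, EN) n).symm U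
          (range 𝓘(ℝ, EN)))
        (VectorField.mpullbackWithin 𝓘(ℝ, EN) 𝓘(ℝ, EN) (extChartAt 𝓘(ℝ, EN) n).symm V
          (range 𝓘(ℝ, EN))) ((extChartAt 𝓘(ℝ, EN) n).symm ⁻¹' univ ∩ range 𝓘(ℝ, EN))
        (extChartAt 𝓘(ℝ, EN) n n)) := rfl
  have h1 : mder 𝓘(ℝ, EN) 𝓘(ℝ, EN) (extChartAt 𝓘(ℝ, EN) n) n = ContinuousLinearMap.id ℝ EN :=
    mder_extChartAt_self' n
  rw [h, mpullbackWithin_eq_chartRep, mpullbackWithin_eq_chartRep, h1]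
  simp

theorem differentiableAt_chartRep {n : N} {U : N → EN}
    (hU : SmoothAlong 𝓘(ℝ, EN) (fun a => a) U n) :
    DifferentiableAt ℝ (chartRep n U) (extChartAt 𝓘(ℝ, EN) n n) := by
  have : IsManifold 𝓘(ℝ, EN) 2 N := .of_le (n := ∞) (by norm_cast)
  have h1 : MDifferentiableWithinAt 𝓘(ℝ, EN) 𝓘(ℝ, EN).tangent
      (fun a => (⟨a, U a⟩ : TangentBundle 𝓘(ℝ, EN) N)) univ n :=
    (ContMDiffAt.mdifferentiableAt (n := ∞) hU (by simp)).mdifferentiableWithinAt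
  have h2 := h1.differentiableWithinAt_mpullbackWithin_vectorField
  rw [mpullbackWithin_eq_chartRep] at h2
  simpa [differentiableWithinAt_univ] using h2

theorem mder_extChartAt_symm_chartRep {n : N} (U : N → EN) :
    ∀ᶠ y in 𝓝 (extChartAt 𝓘(ℝ, EN) n n),
      mder 𝓘(ℝ, EN) 𝓘(ℝ, EN) (extChartAt 𝓘(ℝ, EN) n).symm y (chartRep n U y)
        = U ((extChartAt 𝓘(ℝ, EN) n).symm y) := by
  have : IsManifold 𝓘(ℝ, EN) 1 N := .of_le (n := ∞) (by simp)
  filter_upwards [extChartAt_target_mem_nhds (I := 𝓘(ℝ, EN)) n] with y hy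
  have h1 := isInvertible_mfderivWithin_extChartAt_symm (I := 𝓘(ℝ, EN)) hy
  rw [modelWithCornersSelf_coe, range_id, mfderivWithin_univ] at h1
  obtain ⟨e, he⟩ : ContinuousLinearMap.IsInvertible
    (mder 𝓘(ℝ, EN) 𝓘(ℝ, EN) (extChartAt 𝓘(ℝ, EN) n).symm y) := h1
  unfold chartRep
  rw [← he]
  simp

theorem chartRep_self (U : N → EN) (n : N) : chartRep n U (extChartAt 𝓘(ℝ, EN) n n) = U n := by
  have h1 : mder 𝓘(ℝ, EN) 𝓘(ℝ, EN) (extChartAt 𝓘(ℝ, EN) n).symm (extChartAt 𝓘(ℝ, EN) n n)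
    = ContinuousLinearMap.id ℝ EN := mder_extChartAt_symm_self n
  unfold chartRep
  rw [h1]
  simp

/-- The pull-back of a smooth one-form along a smooth map, contracted with a smooth vector field,
is differentiable. -/
theorem pullback_chart {f : N → G} {n : N} (hf : ContMDiffAt 𝓘(ℝ, EN) 𝓘(ℝ, EG) ∞ f n)
    {θ : G → EG →ₗ[ℝ] ℝ} (hθ : SmoothOneForm θ (f n)) {V : N → EN}
    (hV : SmoothAlong 𝓘(ℝ, EN) (fun a => a) V n) :
    mder 𝓘(ℝ, EN) 𝓘(ℝ, ℝ) (fun p => θ (f p) (mder 𝓘(ℝ, EN) 𝓘(ℝ, EG) f p (V p))) n =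
      fderiv ℝ (fun y => θ (f ((extChartAt 𝓘(ℝ, EN) n).symm y))
        (mder 𝓘(ℝ, EN) 𝓘(ℝ, EG) (fun z => f ((extChartAt 𝓘(ℝ, EN) n).symm z)) y (chartRep n V y)))
        (extChartAt 𝓘(ℝ, EN) n n) := by
  have : IsManifold 𝓘(ℝ, EN) 1 N := .of_le (n := ∞) (by simp)
  have : IsManifold 𝓘(ℝ, EG) 1 G := .of_le (n := ∞) (by simp)
  set ψ := extChartAt 𝓘(ℝ, EN) n with hψ
  have hsymm : ψ.symm (ψ n) = n := by simp [hψ]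
  have hf1 : ContMDiffAt 𝓘(ℝ, EN) 𝓘(ℝ, EG) ∞ (fun z => f (ψ.symm z)) (ψ n) :=
    ContMDiffAt.comp_of_eq hf (contMDiffAt_extChartAt_symm_self n) hsymm
  have hd : DifferentiableAt ℝ (fun y => θ (f (ψ.symm y))
        (mder 𝓘(ℝ, EN) 𝓘(ℝ, EG) (fun z => f (ψ.symm z)) y (chartRep n V y))) (ψ n) :=
    (hasFDerivAt_pullback hf1 (by simpa only [hsymm] using hθ) (differentiableAt_chartRep hV)).1
  have hψd : MDifferentiableAt 𝓘(ℝ, EN) 𝓘(ℝ, EN) ψ n :=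
    mdifferentiableAt_extChartAt (by simp)
  -- In the chart, the function is the one that occurs on the right.
  have hev : ∀ᶠ p in 𝓝 n, θ (f p) (mder 𝓘(ℝ, EN) 𝓘(ℝ, EG) f p (V p)) =
      θ (f (ψ.symm (ψ p))) (mder 𝓘(ℝ, EN) 𝓘(ℝ, EG) (fun z => f (ψ.symm z)) (ψ p)
        (chartRep n V (ψ p))) := by
    have h1 := (contMDiffAt_extChartAt (I := 𝓘(ℝ, EN)) (n := ∞)
      (x := n)).continuousAt.eventually (mder_extChartAt_symm_chartRep (n := n) V)
    have h2 : ∀ᶠ p in 𝓝 n, ContMDiffAt 𝓘(ℝ, EN) 𝓘(ℝ, EG) 1 f p :=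
      contMDiffAt_iff_contMDiffAt_nhds (by simp) |>.1 (hf.of_le (by simp))
    filter_upwards [h1, h2, extChartAt_source_mem_nhds (I := 𝓘(ℝ, EN)) n] with p hp1 hp2 hp3
    have h3 : ψ.symm (ψ p) = p := ψ.left_inv hp3
    have h4 : MDifferentiableAt 𝓘(ℝ, EN) 𝓘(ℝ, EN) ψ.symm (ψ p) := by
      have := mdifferentiableWithinAt_extChartAt_symm (I := 𝓘(ℝ, EN)) (x := n) (ψ.map_source hp3)
      simpa only [modelWithCornersSelf_coe, range_id, mdifferentiableWithinAt_univ] using this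
    rw [mder_comp (by rw [h3]; exact hp2.mdifferentiableAt (by simp)) h4, hp1, h3]
  rw [mder_congr hev]
  ext u
  have := mder_comp (I := 𝓘(ℝ, EN)) (I' := 𝓘(ℝ, EN)) (I'' := 𝓘(ℝ, ℝ)) (f := ψ)
    (g := fun y => θ (f (ψ.symm y))
        (mder 𝓘(ℝ, EN) 𝓘(ℝ, EG) (fun z => f (ψ.symm z)) y (chartRep n V y))) (x := n)
    hd.mdifferentiableAt hψd u
  refine this.trans ?_
  have h1 : mder 𝓘(ℝ, EN) 𝓘(ℝ, EN) ψ n = ContinuousLinearMap.id ℝ EN := mder_extChartAt_self' n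
  rw [h1]
  exact congrArg (fun L : EN →L[ℝ] ℝ => L u) mfderiv_eq_fderiv

/-- The exterior derivative of a one-form, evaluated on the images of two vector fields under a
smooth map, is given by the Koszul formula for the pulled back form. -/
theorem extD_pullback {f : N → G} {n : N} (hf : ContMDiffAt 𝓘(ℝ, EN) 𝓘(ℝ, EG) ∞ f n)
    {θ : G → EG →ₗ[ℝ] ℝ} (hθ : SmoothOneForm θ (f n)) {U V : N → EN}
    (hU : SmoothAlong 𝓘(ℝ, EN) (fun a => a) U n) (hV : SmoothAlong 𝓘(ℝ, EN) (fun a => a) V n) :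
    extD θ (f n) (mder 𝓘(ℝ, EN) 𝓘(ℝ, EG) f n (U n)) (mder 𝓘(ℝ, EN) 𝓘(ℝ, EG) f n (V n)) =
      mder 𝓘(ℝ, EN) 𝓘(ℝ, ℝ) (fun p => θ (f p) (mder 𝓘(ℝ, EN) 𝓘(ℝ, EG) f p (V p))) n (U n)
      - mder 𝓘(ℝ, EN) 𝓘(ℝ, ℝ) (fun p => θ (f p) (mder 𝓘(ℝ, EN) 𝓘(ℝ, EG) f p (U p))) n (V n)
      - θ (f n) (mder 𝓘(ℝ, EN) 𝓘(ℝ, EG) f n (lieBr U V n)) := by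
  rw [pullback_chart hf hθ hU, pullback_chart hf hθ hV, lieBr_eq_lieBracket]
  set ψ := extChartAt 𝓘(ℝ, EN) n with hψ
  have hsymm : ψ.symm (ψ n) = n := by simp [hψ]
  have hf1 : ContMDiffAt 𝓘(ℝ, EN) 𝓘(ℝ, EG) ∞ (fun z => f (ψ.symm z)) (ψ n) :=
    ContMDiffAt.comp_of_eq hf (contMDiffAt_extChartAt_symm_self n) hsymm
  have h := extD_pullback_normed hf1 (by simpa only [hsymm] using hθ)
    (differentiableAt_chartRep hU) (differentiableAt_chartRep hV)
  have hder : ∀ v, mder 𝓘(ℝ, EN) 𝓘(ℝ, EG) (fun z => f (ψ.symm z)) (ψ n) v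
      = mder 𝓘(ℝ, EN) 𝓘(ℝ, EG) f n v := by
    intro v
    rw [mder_comp (I' := 𝓘(ℝ, EN)) (by rw [hsymm]; exact hf.mdifferentiableAt (by simp))
      ((contMDiffAt_extChartAt_symm_self n).mdifferentiableAt (by simp)), hsymm]
    exact congrArg _ (congrArg (fun L : EN →L[ℝ] EN => L v) (mder_extChartAt_symm_self n))
  rw [hder, hder, hder, chartRep_self, chartRep_self, hsymm] at h
  exact h

/-- The Koszul formula for the exterior derivative of a one-form. -/
theorem extD_apply {θ : G → EG →ₗ[ℝ] ℝ} {g : G} (hθ : SmoothOneForm θ g) {X Y : G → EG}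
    (hX : SmoothAlong 𝓘(ℝ, EG) (fun a => a) X g) (hY : SmoothAlong 𝓘(ℝ, EG) (fun a => a) Y g) :
    extD θ g (X g) (Y g) =
      mder 𝓘(ℝ, EG) 𝓘(ℝ, ℝ) (fun p => θ p (Y p)) g (X g)
      - mder 𝓘(ℝ, EG) 𝓘(ℝ, ℝ) (fun p => θ p (X p)) g (Y g) - θ g (lieBr X Y g) := by
  have h := extD_pullback (f := fun a : G => a) contMDiffAt_id hθ hX hY
  simpa only [mder_id] using h

/-- A one-form with prescribed value at `g`, smooth near `g`. -/
theorem exists_smoothOneForm (g : G) (l : EG →ₗ[ℝ] ℝ) :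
    ∃ θ : G → EG →ₗ[ℝ] ℝ, SmoothOneForm θ g ∧ θ g = l := by
  refine ⟨fun a => l ∘ₗ (mder 𝓘(ℝ, EG) 𝓘(ℝ, EG) (extChartAt 𝓘(ℝ, EG) g) a).toLinearMap,
    fun X hX => ?_, ?_⟩
  · have h1 : SmoothAlong 𝓘(ℝ, EG) (fun a => extChartAt 𝓘(ℝ, EG) g a)
        (fun a => mder 𝓘(ℝ, EG) 𝓘(ℝ, EG) (extChartAt 𝓘(ℝ, EG) g) a (X a)) g :=
      smoothAlong_mder (b := fun a => a) contMDiffAt_extChartAt hX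
    have h2 := (Bundle.contMDiffAt_totalSpace.1 h1).2
    have h3 : ContMDiffAt 𝓘(ℝ, EG) 𝓘(ℝ, EG) ∞
        (fun a => mder 𝓘(ℝ, EG) 𝓘(ℝ, EG) (extChartAt 𝓘(ℝ, EG) g) a (X a)) g := by
      simpa using h2
    exact (LinearMap.toContinuousLinearMap l).contMDiff.contMDiffAt.comp g h3
  · ext v
    exact congrArg l (congrArg (fun L : EG →L[ℝ] EG => L v) (mder_extChartAt_self' g))

/-- Brackets of related vector fields are related. -/
theorem mder_lieBr_of_related {f : N → G} {n : N} (hf : ContMDiffAt 𝓘(ℝ, EN) 𝓘(ℝ, EG) ∞ f n)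
    {U V : N → EN} {X Y : G → EG}
    (hU : SmoothAlong 𝓘(ℝ, EN) (fun a => a) U n) (hV : SmoothAlong 𝓘(ℝ, EN) (fun a => a) V n)
    (hX : SmoothAlong 𝓘(ℝ, EG) (fun a => a) X (f n))
    (hY : SmoothAlong 𝓘(ℝ, EG) (fun a => a) Y (f n))
    (hUX : ∀ᶠ p in 𝓝 n, mder 𝓘(ℝ, EN) 𝓘(ℝ, EG) f p (U p) = X (f p))
    (hVY : ∀ᶠ p in 𝓝 n, mder 𝓘(ℝ, EN) 𝓘(ℝ, EG) f p (V p) = Y (f p)) :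
    mder 𝓘(ℝ, EN) 𝓘(ℝ, EG) f n (lieBr U V n) = lieBr X Y (f n) := by
  refine (Module.finBasis ℝ EG).ext_elem fun i => ?_
  obtain ⟨θ, hθ, hθv⟩ := exists_smoothOneForm (f n) ((Module.finBasis ℝ EG).coord i)
  have h1 := extD_pullback hf hθ hU hV
  have h2 := extD_apply hθ hX hY
  have hfd := hf.mdifferentiableAt (n := ∞) (by simp)
  rw [hUX.self_of_nhds, hVY.self_of_nhds, h2] at h1
  have hc : ∀ {U : N → EN} {X : G → EG} (hX : SmoothAlong 𝓘(ℝ, EG) (fun a => a) X (f n))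
      (hUX : ∀ᶠ p in 𝓝 n, mder 𝓘(ℝ, EN) 𝓘(ℝ, EG) f p (U p) = X (f p)) (v : EN),
      mder 𝓘(ℝ, EN) 𝓘(ℝ, ℝ) (fun p => θ (f p) (mder 𝓘(ℝ, EN) 𝓘(ℝ, EG) f p (U p))) n v =
        mder 𝓘(ℝ, EG) 𝓘(ℝ, ℝ) (fun p => θ p (X p)) (f n) (mder 𝓘(ℝ, EN) 𝓘(ℝ, EG) f n v) := by
    intro U X hX hUX v
    rw [← mder_comp (I'' := 𝓘(ℝ, ℝ)) ((hθ X hX).mdifferentiableAt (by simp)) hfd]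
    refine congrArg (fun L : EN →L[ℝ] ℝ => L v) (mder_congr ?_)
    filter_upwards [hUX] with p hp
    rw [hp]
  rw [hc hX hUX, hc hY hVY, hUX.self_of_nhds, hVY.self_of_nhds, hθv] at h1
  have h3 : (Module.finBasis ℝ EG).coord i (lieBr X Y (f n)) =
    (Module.finBasis ℝ EG).coord i (mder 𝓘(ℝ, EN) 𝓘(ℝ, EG) f n (lieBr U V n)) := by linarith
  exact h3.symm

end Brackets

/-! ### Rules for Lie brackets -/

section BracketRules

variable {EG : Type*} [NormedAddCommGroup EG] [NormedSpace ℝ EG] [FiniteDimensional ℝ EG]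
  {G : Type*} [TopologicalSpace G] [ChartedSpace EG G] [IsManifold 𝓘(ℝ, EG) ∞ G]

theorem lieBr_swap (X Y : G → EG) (g : G) : lieBr X Y g = - lieBr Y X g :=
  VectorField.mlieBracket_swap_apply

theorem lieBr_zero_right (X : G → EG) (g : G) : lieBr X (fun _ => 0) g = 0 := by
  have := VectorField.mlieBracket_zero_right (I := 𝓘(ℝ, EG)) (M := G) (W := X)
  exact congrFun this g

theorem SmoothAlong.lieBr {X Y : G → EG} {g : G} (hX : SmoothAlong 𝓘(ℝ, EG) (fun a => a) X g)
    (hY : SmoothAlong 𝓘(ℝ, EG) (fun a => a) Y g) :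
    SmoothAlong 𝓘(ℝ, EG) (fun a => a) (lieBr X Y) g := by
  have : IsManifold 𝓘(ℝ, EG) (((⊤ : ℕ∞) : WithTop ℕ∞) + 1) G := by
    simpa using (inferInstance : IsManifold 𝓘(ℝ, EG) ∞ G)
  have : IsManifold 𝓘(ℝ, EG) (minSmoothness ℝ 2) G :=
    .of_le (n := ∞) (by simp only [minSmoothness_of_isRCLikeNormedField]; norm_cast)
  exact ContMDiffAt.mlieBracket_vectorField (m := ⊤) (n := ⊤) (U := X) (V := Y) hX hY (by simp)

/-- The Jacobi identity. -/
theorem lieBr_jacobi {X Y Z : G → EG} {g : G} (hX : SmoothAlong 𝓘(ℝ, EG) (fun a => a) X g)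
    (hY : SmoothAlong 𝓘(ℝ, EG) (fun a => a) Y g) (hZ : SmoothAlong 𝓘(ℝ, EG) (fun a => a) Z g) :
    lieBr X (lieBr Y Z) g = lieBr (lieBr X Y) Z g + lieBr Y (lieBr X Z) g := by
  have : IsManifold 𝓘(ℝ, EG) (minSmoothness ℝ 3) G :=
    .of_le (n := ∞) (by simp only [minSmoothness_of_isRCLikeNormedField]; norm_cast)
  have h2 : minSmoothness ℝ 2 ≤ (∞ : WithTop ℕ∞) := by
    simp only [minSmoothness_of_isRCLikeNormedField]; norm_cast
  exact VectorField.leibniz_identity_mlieBracket_apply (U := X) (V := Y) (W := Z)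
    (ContMDiffAt.of_le hX h2) (ContMDiffAt.of_le hY h2) (ContMDiffAt.of_le hZ h2)

end BracketRules

/-! ### Lifting along submersions -/

section Submersions

variable {EG : Type*} [NormedAddCommGroup EG] [NormedSpace ℝ EG]
  {G : Type*} [TopologicalSpace G] [ChartedSpace EG G]
  {EM : Type*} [NormedAddCommGroup EM] [NormedSpace ℝ EM]
  {M : Type*} [TopologicalSpace M] [ChartedSpace EM M]

/-- Near `g`, a submersion `π` is a projection: `a ↦ (π a, q a)` has a smooth inverse `τ`. -/
theorem Manifold.IsSubmersionAt.exists_split [IsManifold 𝓘(ℝ, EG) ∞ G] [IsManifold 𝓘(ℝ, EM) ∞ M]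
    {π : G → M} {g : G} (h : Manifold.IsSubmersionAt 𝓘(ℝ, EG) 𝓘(ℝ, EM) ∞ π g) :
    ∃ (q : G → h.complement) (τ : M × h.complement → G),
      ContMDiffAt 𝓘(ℝ, EG) 𝓘(ℝ, h.complement) ∞ q g ∧
      ContMDiffAt (𝓘(ℝ, EM).prod 𝓘(ℝ, h.complement)) 𝓘(ℝ, EG) ∞ τ (π g, q g) ∧
      (∀ᶠ a in 𝓝 g, τ (π a, q a) = a) ∧ ∀ᶠ p in 𝓝 (π g, q g), π (τ p) = p.1 := by
  have hsub : ∀ a ∈ h.domChart.source, π a ∈ h.codChart.source := h.source_subset_preimage_source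
  have hw : ∀ y ∈ h.domChart.target, h.codChart (π (h.domChart.symm y)) = (h.equiv y).1 := by
    intro y hy
    have hy' : y ∈ (h.domChart.extend 𝓘(ℝ, EG)).target := by simpa using hy
    have := h.writtenInCharts hy'
    simpa using this
  have hw' : ∀ a ∈ h.domChart.source, h.codChart (π a) = (h.equiv (h.domChart a)).1 := by
    intro a ha
    have := hw _ (h.domChart.map_source ha)
    rwa [h.domChart.left_inv ha] at this
  have hd := contMDiffAt_of_mem_maximalAtlas h.domChart_mem_maximalAtlas h.mem_domChart_source
  have hk := contMDiffAt_of_mem_maximalAtlas h.codChart_mem_maximalAtlas h.mem_codChart_source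
  have hds : ContMDiffAt 𝓘(ℝ, EG) 𝓘(ℝ, EG) ∞ h.domChart.symm (h.domChart g) :=
    contMDiffAt_symm_of_mem_maximalAtlas h.domChart_mem_maximalAtlas
      (h.domChart.map_source h.mem_domChart_source)
  have hpt : h.equiv.symm (h.codChart (π g), (h.equiv (h.domChart g)).2) = h.domChart g := by
    rw [hw' g h.mem_domChart_source, Prod.mk.eta, ContinuousLinearEquiv.symm_apply_apply]
  have hin : ContMDiffAt (𝓘(ℝ, EM).prod 𝓘(ℝ, h.complement)) 𝓘(ℝ, EG) ∞
      (fun p : M × h.complement => h.equiv.symm (h.codChart p.1, p.2))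
      (π g, (h.equiv (h.domChart g)).2) := by
    have h1 : ContMDiffAt (𝓘(ℝ, EM).prod 𝓘(ℝ, h.complement)) 𝓘(ℝ, EM × h.complement) ∞
        (fun p : M × h.complement => (h.codChart p.1, p.2)) (π g, (h.equiv (h.domChart g)).2) :=
      ContMDiffAt.prodMk_space (ContMDiffAt.comp (I' := 𝓘(ℝ, EM)) _ hk contMDiffAt_fst)
        contMDiffAt_snd
    exact ContMDiffAt.comp _ h.equiv.symm.contDiff.contMDiff.contMDiffAt h1
  refine ⟨fun a => (h.equiv (h.domChart a)).2,
    fun p => h.domChart.symm (h.equiv.symm (h.codChart p.1, p.2)), ?_, ?_, ?_, ?_⟩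
  · have h1 : ContMDiffAt 𝓘(ℝ, EG) 𝓘(ℝ, h.complement) ∞ (fun y => (h.equiv y).2)
        (h.domChart g) := (contDiff_snd.comp h.equiv.contDiff).contMDiff.contMDiffAt
    exact h1.comp g hd
  · exact ContMDiffAt.comp_of_eq hds hin hpt
  · filter_upwards [h.domChart.open_source.mem_nhds h.mem_domChart_source] with a ha
    rw [hw' a ha, Prod.mk.eta, ContinuousLinearEquiv.symm_apply_apply, h.domChart.left_inv ha]
  · have h1 : ∀ᶠ p : M × h.complement in 𝓝 (π g, (h.equiv (h.domChart g)).2),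
        h.equiv.symm (h.codChart p.1, p.2) ∈ h.domChart.target := by
      refine hin.continuousAt.preimage_mem_nhds (h.domChart.open_target.mem_nhds ?_)
      rw [hpt]
      exact h.domChart.map_source h.mem_domChart_source
    have h2 : ∀ᶠ p : M × h.complement in 𝓝 (π g, (h.equiv (h.domChart g)).2),
        p.1 ∈ h.codChart.source :=
      continuousAt_fst.preimage_mem_nhds
        (h.codChart.open_source.mem_nhds h.mem_codChart_source)
    filter_upwards [h1, h2] with p hp1 hp2
    refine h.codChart.injOn (hsub _ (h.domChart.map_target hp1)) hp2 ?_
    rw [hw _ hp1, ContinuousLinearEquiv.apply_symm_apply]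

variable [IsManifold 𝓘(ℝ, EG) ∞ G] [IsManifold 𝓘(ℝ, EM) ∞ M]

/-- Smoothness at a point, unlike differentiability, spreads to a neighbourhood. -/
theorem ContMDiffAt.eventually_mdifferentiableAt {E : Type*} [NormedAddCommGroup E]
    [NormedSpace ℝ E] {H : Type*} [TopologicalSpace H] {I : ModelWithCorners ℝ E H}
    {N : Type*} [TopologicalSpace N] [ChartedSpace H N] [IsManifold I ∞ N]
    {E' : Type*} [NormedAddCommGroup E'] [NormedSpace ℝ E']
    {N' : Type*} [TopologicalSpace N'] [ChartedSpace E' N'] [IsManifold 𝓘(ℝ, E') ∞ N']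
    {f : N → N'} {x : N} (hf : ContMDiffAt I 𝓘(ℝ, E') ∞ f x) :
    ∀ᶠ y in 𝓝 x, MDifferentiableAt I 𝓘(ℝ, E') f y := by
  have : IsManifold I 1 N := .of_le (n := ∞) (by simp)
  have : IsManifold 𝓘(ℝ, E') 1 N' := .of_le (n := ∞) (by simp)
  have h2 : ∀ᶠ p in 𝓝 x, ContMDiffAt I 𝓘(ℝ, E') 1 f p :=
    contMDiffAt_iff_contMDiffAt_nhds (by simp) |>.1 (hf.of_le (by simp))
  filter_upwards [h2] with y hy using hy.mdifferentiableAt (by simp)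

theorem mder_prodMk {E : Type*} [NormedAddCommGroup E]
    [NormedSpace ℝ E] {H : Type*} [TopologicalSpace H] {I : ModelWithCorners ℝ E H}
    {N : Type*} [TopologicalSpace N] [ChartedSpace H N]
    {E' : Type*} [NormedAddCommGroup E'] [NormedSpace ℝ E']
    {H' : Type*} [TopologicalSpace H'] {I' : ModelWithCorners ℝ E' H'}
    {N' : Type*} [TopologicalSpace N'] [ChartedSpace H' N']
    {E'' : Type*} [NormedAddCommGroup E''] [NormedSpace ℝ E'']
    {H'' : Type*} [TopologicalSpace H''] {I'' : ModelWithCorners ℝ E'' H''}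
    {N'' : Type*} [TopologicalSpace N''] [ChartedSpace H'' N'']
    {f : N → N'} {g : N → N''} {x : N} (hf : MDifferentiableAt I I' f x)
    (hg : MDifferentiableAt I I'' g x) (v : E) :
    mder I (I'.prod I'') (fun y => (f y, g y)) x v = (mder I I' f x v, mder I I'' g x v) :=
  congrArg (fun L : E →L[ℝ] E' × E'' => L v) (hf.mfderiv_prod hg)

/-- The derivative of the inverse `τ` of `a ↦ (π a, q a)`. -/
theorem mder_split {F : Type*} [NormedAddCommGroup F] [NormedSpace ℝ F] {π : G → M} {g : G}
    {q : G → F} {τ : M × F → G} (hπ : MDifferentiableAt 𝓘(ℝ, EG) 𝓘(ℝ, EM) π g)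
    (hq : MDifferentiableAt 𝓘(ℝ, EG) 𝓘(ℝ, F) q g)
    (hτ : MDifferentiableAt (𝓘(ℝ, EM).prod 𝓘(ℝ, F)) 𝓘(ℝ, EG) τ (π g, q g))
    (h : ∀ᶠ a in 𝓝 g, τ (π a, q a) = a) (v : EG) :
    mder (𝓘(ℝ, EM).prod 𝓘(ℝ, F)) 𝓘(ℝ, EG) τ (π g, q g)
      (mder 𝓘(ℝ, EG) 𝓘(ℝ, EM) π g v, mder 𝓘(ℝ, EG) 𝓘(ℝ, F) q g v) = v := by
  have h1 := mder_comp (I := 𝓘(ℝ, EG)) (f := fun a => (π a, q a)) hτ (hπ.prodMk hq) v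
  rw [mder_prodMk hπ hq] at h1
  rw [← h1, mder_congr h, mder_id]

/-- Maps from a normed space lift along a submersion, with prescribed value and derivative at the
origin. -/
theorem Manifold.IsSubmersionAt.exists_lift {π : G → M} {g : G}
    (h : Manifold.IsSubmersionAt 𝓘(ℝ, EG) 𝓘(ℝ, EM) ∞ π g)
    {W : Type*} [NormedAddCommGroup W] [NormedSpace ℝ W] {β : W → M}
    (hβ : ContMDiffAt 𝓘(ℝ, W) 𝓘(ℝ, EM) ∞ β 0) (hβ0 : β 0 = π g) (L : W →L[ℝ] EG)
    (hL : ∀ w, mder 𝓘(ℝ, EG) 𝓘(ℝ, EM) π g (L w) = mder 𝓘(ℝ, W) 𝓘(ℝ, EM) β 0 w) :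
    ∃ γ : W → G, ContMDiffAt 𝓘(ℝ, W) 𝓘(ℝ, EG) ∞ γ 0 ∧ γ 0 = g ∧ (∀ᶠ y in 𝓝 0, π (γ y) = β y) ∧
      ∀ w, mder 𝓘(ℝ, W) 𝓘(ℝ, EG) γ 0 w = L w := by
  obtain ⟨q, τ, hq, hτ, hid, hπτ⟩ := h.exists_split
  let D : W →L[ℝ] h.complement := (mder 𝓘(ℝ, EG) 𝓘(ℝ, h.complement) q g).comp L
  have hD : ContMDiffAt 𝓘(ℝ, W) 𝓘(ℝ, h.complement) ∞ (fun y => q g + D y) 0 :=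
    (contDiff_const.add D.contDiff).contMDiff.contMDiffAt
  have hb0 : (β 0, q g + D 0) = (π g, q g) := by simp [hβ0]
  have hpair : ContMDiffAt 𝓘(ℝ, W) (𝓘(ℝ, EM).prod 𝓘(ℝ, h.complement)) ∞
    (fun y => (β y, q g + D y)) 0 := hβ.prodMk hD
  refine ⟨fun y => τ (β y, q g + D y), ContMDiffAt.comp_of_eq hτ hpair hb0, ?_, ?_, fun w => ?_⟩
  · change τ (β 0, q g + D 0) = g
    rw [hb0]; exact hid.self_of_nhds
  · have : Tendsto (fun y => (β y, q g + D y)) (𝓝 0) (𝓝 (π g, q g)) := by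
      simpa only [ContinuousAt, hb0] using hpair.continuousAt
    exact this.eventually hπτ
  · rw [mder_comp (I' := 𝓘(ℝ, EM).prod 𝓘(ℝ, h.complement))
      (by rw [hb0]; exact hτ.mdifferentiableAt (by simp)) (hpair.mdifferentiableAt (by simp)),
      mder_prodMk (hβ.mdifferentiableAt (by simp)) (hD.mdifferentiableAt (by simp)), hb0]
    have h1 : mder 𝓘(ℝ, W) 𝓘(ℝ, h.complement) (fun y => q g + D y) 0 w = D w := by
      have : HasFDerivAt (fun y => q g + D y) D 0 := D.hasFDerivAt.const_add _
      exact congrArg (fun L : W →L[ℝ] h.complement => L w) this.hasMFDerivAt.mfderiv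
    rw [h1, ← hL]
    exact mder_split (h.contMDiffAt.mdifferentiableAt (by simp)) (hq.mdifferentiableAt (by simp))
      (hτ.mdifferentiableAt (by simp)) hid (L w)

/-- A smooth field `ξ` of vertical vectors along a section `σ` of a submersion `π` is the velocity,
at time zero, of a smooth family of curves in the fibres of `π` starting on the section. -/
theorem Manifold.IsSubmersionAt.exists_curves {π : G → M} {σ : M → G} {x₀ : M}
    (h : Manifold.IsSubmersionAt 𝓘(ℝ, EG) 𝓘(ℝ, EM) ∞ π (σ x₀)) (hσ : ∀ x, π (σ x) = x) {ξ : M → EG}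
    (hξ : SmoothAlong 𝓘(ℝ, EM) σ ξ x₀)
    (hvert : ∀ᶠ x in 𝓝 x₀, mder 𝓘(ℝ, EG) 𝓘(ℝ, EM) π (σ x) (ξ x) = 0) :
    ∃ c : M × ℝ → G, ContMDiffAt (𝓘(ℝ, EM).prod 𝓘(ℝ, ℝ)) 𝓘(ℝ, EG) ∞ c (x₀, 0) ∧
      (∀ᶠ p in 𝓝 (x₀, (0 : ℝ)), π (c p) = p.1) ∧
      ∀ᶠ x in 𝓝 x₀, c (x, 0) = σ x ∧
        mder (𝓘(ℝ, EM).prod 𝓘(ℝ, ℝ)) 𝓘(ℝ, EG) c (x, 0) (0, 1) = ξ x := by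
  obtain ⟨q, τ, hq, hτ, hid, hπτ⟩ := h.exists_split
  rw [hσ] at hτ hπτ
  have hσ' := hξ.base
  let η : M → h.complement := fun x => mder 𝓘(ℝ, EG) 𝓘(ℝ, h.complement) q (σ x) (ξ x)
  have hη : ContMDiffAt 𝓘(ℝ, EM) 𝓘(ℝ, h.complement) ∞ η x₀ := by
    have := smoothAlong_mder (b := σ) hq hξ
    simpa using (Bundle.contMDiffAt_totalSpace.1 this).2
  have hin : ContMDiffAt (𝓘(ℝ, EM).prod 𝓘(ℝ, ℝ)) 𝓘(ℝ, h.complement) ∞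
      (fun p : M × ℝ => q (σ p.1) + p.2 • η p.1) (x₀, 0) :=
    (ContMDiffAt.comp (I' := 𝓘(ℝ, EM)) (x₀, (0 : ℝ)) (hq.comp x₀ hσ') contMDiffAt_fst).add
      (contMDiffAt_snd.smul (ContMDiffAt.comp (I' := 𝓘(ℝ, EM)) (x₀, (0 : ℝ)) hη contMDiffAt_fst))
  have hpair : ContMDiffAt (𝓘(ℝ, EM).prod 𝓘(ℝ, ℝ)) (𝓘(ℝ, EM).prod 𝓘(ℝ, h.complement)) ∞
      (fun p : M × ℝ => (p.1, q (σ p.1) + p.2 • η p.1)) (x₀, 0) := contMDiffAt_fst.prodMk hin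
  have hb0 : ((x₀, (0 : ℝ)).1, q (σ (x₀, (0 : ℝ)).1) + (x₀, (0 : ℝ)).2 • η (x₀, (0 : ℝ)).1) =
      (x₀, q (σ x₀)) := by simp
  refine ⟨fun p => τ (p.1, q (σ p.1) + p.2 • η p.1), ContMDiffAt.comp_of_eq hτ hpair hb0, ?_, ?_⟩
  · have : Tendsto (fun p : M × ℝ => (p.1, q (σ p.1) + p.2 • η p.1)) (𝓝 (x₀, 0))
        (𝓝 (x₀, q (σ x₀))) := by
      simpa only [ContinuousAt, hb0] using hpair.continuousAt
    exact this.eventually hπτ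
  · have hσc := hσ'.continuousAt
    have hpairσ : ContinuousAt (fun x => (x, q (σ x))) x₀ :=
      continuousAt_id.prodMk (hq.continuousAt.comp hσc)
    have hslice : ContinuousAt (fun x : M => (x, (0 : ℝ))) x₀ := continuousAt_id.prodMk continuousAt_const
    filter_upwards [hvert, hσc.eventually hid.eventually_nhds,
      hσc.eventually (hq.eventually_mdifferentiableAt),
      hσc.eventually (h.contMDiffAt.eventually_mdifferentiableAt),
      hpairσ.eventually hτ.eventually_mdifferentiableAt,
      hslice.eventually hin.eventually_mdifferentiableAt] with x hx1 hx2 hx3 hx4 hx5 hx6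
    have hb : ((x, (0 : ℝ)).1, q (σ (x, (0 : ℝ)).1) + (x, (0 : ℝ)).2 • η (x, (0 : ℝ)).1) =
      (x, q (σ x)) := by simp
    refine ⟨by rw [hb]; simpa only [hσ] using hx2.self_of_nhds, ?_⟩
    have hfst : MDifferentiableAt (𝓘(ℝ, EM).prod 𝓘(ℝ, ℝ)) 𝓘(ℝ, EM) (fun p : M × ℝ => p.1) (x, 0) :=
      mdifferentiableAt_fst
    rw [mder_comp (I' := 𝓘(ℝ, EM).prod 𝓘(ℝ, h.complement)) (by rw [hb]; exact hx5)
      (hfst.prodMk hx6), mder_prodMk hfst hx6, hb]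
    have h1 : mder (𝓘(ℝ, EM).prod 𝓘(ℝ, ℝ)) 𝓘(ℝ, EM) (fun p : M × ℝ => p.1) (x, 0) (0, 1) = 0 :=
      congrArg (fun L : EM × ℝ →L[ℝ] EM => L (0, 1)) (mfderiv_fst (I := 𝓘(ℝ, EM)) (I' := 𝓘(ℝ, ℝ)))
    -- The derivative in the direction of time is computed along the curve through `x`.
    have h2 : mder (𝓘(ℝ, EM).prod 𝓘(ℝ, ℝ)) 𝓘(ℝ, h.complement)
        (fun p : M × ℝ => q (σ p.1) + p.2 • η p.1) (x, 0) (0, 1) = η x := by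
      have hi : HasMFDerivAt 𝓘(ℝ, ℝ) (𝓘(ℝ, EM).prod 𝓘(ℝ, ℝ)) (fun b : ℝ => (x, b)) 0
        ((0 : ℝ →L[ℝ] EM).prod (ContinuousLinearMap.id ℝ ℝ)) :=
        (hasMFDerivAt_const x (0 : ℝ)).prodMk (hasMFDerivAt_id (0 : ℝ))
      have hc := mder_comp (I := 𝓘(ℝ, ℝ)) (f := fun b : ℝ => (x, b)) hx6
        hi.mdifferentiableAt (1 : ℝ)
      rw [mder_of_hasMFDerivAt hi] at hc
      have hd : HasDerivAt (fun b : ℝ => q (σ x) + b • η x) (η x) 0 := by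
        simpa using ((hasDerivAt_id (0 : ℝ)).smul_const (η x)).const_add (q (σ x))
      have hd' : mder 𝓘(ℝ, ℝ) 𝓘(ℝ, h.complement) (fun b : ℝ => q (σ x) + b • η x) 0 1 = η x := by
        rw [mder_of_hasMFDerivAt hd.hasFDerivAt.hasMFDerivAt]
        simp
      rw [← hd']
      exact hc.symm
    have h3 := mder_split hx4 hx3 (by rw [hσ]; exact hx5) hx2 (ξ x)
    rw [hx1, hσ] at h3
    rw [h1, h2]
    exact h3

end Submersions

/-! ### The tangent groupoid -/

/-- In the model space, transport along an equality of base points is the identity. -/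
theorem tcast_eq {EG : Type*} [NormedAddCommGroup EG] [NormedSpace ℝ EG]
    {G : Type*} [TopologicalSpace G] [ChartedSpace EG G] {g h : G} (e : g = h)
    (v : TangentSpace 𝓘(ℝ, EG) g) : (tcast e v : EG) = v := by
  subst e; rfl

namespace LieGroupoid

section TangentGroupoid

variable {EG : Type*} [NormedAddCommGroup EG] [NormedSpace ℝ EG]
  {G : Type*} [TopologicalSpace G] [ChartedSpace EG G] [IsManifold 𝓘(ℝ, EG) ∞ G]
  {EM : Type*} [NormedAddCommGroup EM] [NormedSpace ℝ EM]
  {M : Type*} [TopologicalSpace M] [ChartedSpace EM M] [IsManifold 𝓘(ℝ, EM) ∞ M]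
  (𝒢 : LieGroupoid EG G EM M)

theorem inv_inv (g : G) : 𝒢.inv (𝒢.inv g) = g := by
  have h1 : 𝒢.mul (𝒢.mul (𝒢.inv (𝒢.inv g)) (𝒢.inv g)) g = 𝒢.inv (𝒢.inv g) := by
    rw [𝒢.mul_assoc _ _ _ (𝒢.s_inv _) (𝒢.s_inv _), 𝒢.inv_mul]
    have := 𝒢.mul_one (𝒢.inv (𝒢.inv g))
    rwa [𝒢.s_inv, 𝒢.t_inv] at this
  rw [𝒢.inv_mul, 𝒢.s_inv, 𝒢.one_mul] at h1
  exact h1.symm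

/-- The differential of the source map, between the model spaces. -/
def Ds (g : G) : EG →L[ℝ] EM := mder 𝓘(ℝ, EG) 𝓘(ℝ, EM) 𝒢.s g

/-- The differential of the target map, between the model spaces. -/
def Dt (g : G) : EG →L[ℝ] EM := mder 𝓘(ℝ, EG) 𝓘(ℝ, EM) 𝒢.t g

/-- The differential of the unit map, between the model spaces. -/
def Done (x : M) : EM →L[ℝ] EG := mder 𝓘(ℝ, EM) 𝓘(ℝ, EG) 𝒢.one x

/-- The multiplication of the tangent groupoid, on vectors in the model space. It is meaningful
on pairs with `Ds g v = Dt h w`. -/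
def Dm (g h : G) (v w : EG) : EG := 𝒢.dmul g h (v, w)

/-- Left translation from the unit at `s g`, in the model space. -/
def lT (g : G) : EG →ₗ[ℝ] EG := 𝒢.dLunit g

/-- Left translation by the inverse of `g`, in the model space. -/
def lI (g : G) : EG →ₗ[ℝ] EG := 𝒢.dLinv g

/-- Right translation from the unit at `t g`, in the model space. -/
def rT (g : G) : EG →ₗ[ℝ] EG := 𝒢.dR (𝒢.one (𝒢.t g)) g

theorem Dm_add (g h : G) (v w v' w' : EG) :
    𝒢.Dm g h (v + v') (w + w') = 𝒢.Dm g h v w + 𝒢.Dm g h v' w' :=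
  map_add (𝒢.dmul g h) (v, w) (v', w')

theorem Dm_zero (g h : G) : 𝒢.Dm g h 0 0 = 0 := map_zero (𝒢.dmul g h)

theorem lT_apply (g : G) (a : EG) : 𝒢.lT g a = 𝒢.Dm g (𝒢.one (𝒢.s g)) 0 a :=
  tcast_eq (𝒢.mul_one g) _

theorem lI_apply (g : G) (v : EG) : 𝒢.lI g v = 𝒢.Dm (𝒢.inv g) g 0 v :=
  tcast_eq (𝒢.inv_mul g) _

theorem rT_apply (g : G) (a : EG) : 𝒢.rT g a = 𝒢.Dm (𝒢.one (𝒢.t g)) g a 0 := rfl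

theorem Ad_apply (g : G) (a : EG) :
    (𝒢.Ad g a : EG) = 𝒢.Dm g (𝒢.inv g) (𝒢.Dm g (𝒢.one (𝒢.s g)) 0 a) 0 := by
  have h1 : (𝒢.Ad g a : EG) = 𝒢.Dm g (𝒢.inv g) (𝒢.lT g a) 0 := tcast_eq (𝒢.mul_inv g) _
  rw [h1, lT_apply]

theorem contMDiff_s : ContMDiff 𝓘(ℝ, EG) 𝓘(ℝ, EM) ∞ 𝒢.s := 𝒢.submersion_s.contMDiff

theorem contMDiff_t : ContMDiff 𝓘(ℝ, EG) 𝓘(ℝ, EM) ∞ 𝒢.t := 𝒢.submersion_t.contMDiff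

theorem mdiff_s (g : G) : MDifferentiableAt 𝓘(ℝ, EG) 𝓘(ℝ, EM) 𝒢.s g :=
  𝒢.contMDiff_s.contMDiffAt.mdifferentiableAt (by simp)

theorem mdiff_t (g : G) : MDifferentiableAt 𝓘(ℝ, EG) 𝓘(ℝ, EM) 𝒢.t g :=
  𝒢.contMDiff_t.contMDiffAt.mdifferentiableAt (by simp)

theorem mdiff_one (x : M) : MDifferentiableAt 𝓘(ℝ, EM) 𝓘(ℝ, EG) 𝒢.one x :=
  𝒢.smooth_one.contMDiffAt.mdifferentiableAt (by simp)

section Maps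

variable {E : Type*} [NormedAddCommGroup E] [NormedSpace ℝ E]
  {H : Type*} [TopologicalSpace H] {I : ModelWithCorners ℝ E H}
  {N : Type*} [TopologicalSpace N] [ChartedSpace H N]

theorem contMDiffAt_mul {γ₁ γ₂ : N → G} {x : N} (h1 : ContMDiffAt I 𝓘(ℝ, EG) ∞ γ₁ x)
    (h2 : ContMDiffAt I 𝓘(ℝ, EG) ∞ γ₂ x) (hc : ∀ᶠ y in 𝓝 x, 𝒢.s (γ₁ y) = 𝒢.t (γ₂ y)) :
    ContMDiffAt I 𝓘(ℝ, EG) ∞ (fun y => 𝒢.mul (γ₁ y) (γ₂ y)) x := by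
  have hm := 𝒢.smooth_mul (γ₁ x, γ₂ x) hc.self_of_nhds
  have := hm.comp (s := {y | 𝒢.s (γ₁ y) = 𝒢.t (γ₂ y)}) x (h1.prodMk h2).contMDiffWithinAt
    (show {y | 𝒢.s (γ₁ y) = 𝒢.t (γ₂ y)} ⊆ (fun y => (γ₁ y, γ₂ y)) ⁻¹'
      {p : G × G | 𝒢.s p.1 = 𝒢.t p.2} from fun y hy => hy)
  exact this.contMDiffAt hc

theorem mdiff_mul {γ₁ γ₂ : N → G} {x : N} (h1 : MDifferentiableAt I 𝓘(ℝ, EG) γ₁ x)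
    (h2 : MDifferentiableAt I 𝓘(ℝ, EG) γ₂ x) (hc : ∀ᶠ y in 𝓝 x, 𝒢.s (γ₁ y) = 𝒢.t (γ₂ y)) :
    MDifferentiableAt I 𝓘(ℝ, EG) (fun y => 𝒢.mul (γ₁ y) (γ₂ y)) x := by
  have hm := (𝒢.smooth_mul (γ₁ x, γ₂ x) hc.self_of_nhds).mdifferentiableWithinAt (by simp)
  have := hm.comp (s := {y | 𝒢.s (γ₁ y) = 𝒢.t (γ₂ y)}) x (h1.prodMk h2).mdifferentiableWithinAt
    (show {y | 𝒢.s (γ₁ y) = 𝒢.t (γ₂ y)} ⊆ (fun y => (γ₁ y, γ₂ y)) ⁻¹'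
      {p : G × G | 𝒢.s p.1 = 𝒢.t p.2} from fun y hy => hy)
  exact this.mdifferentiableAt hc

/-- The derivative of a product of maps is the product, in the tangent groupoid, of the
derivatives. -/
theorem mder_mul {γ₁ γ₂ : N → G} {x : N} (h1 : MDifferentiableAt I 𝓘(ℝ, EG) γ₁ x)
    (h2 : MDifferentiableAt I 𝓘(ℝ, EG) γ₂ x) (hc : ∀ᶠ y in 𝓝 x, 𝒢.s (γ₁ y) = 𝒢.t (γ₂ y)) (v : E) :
    mder I 𝓘(ℝ, EG) (fun y => 𝒢.mul (γ₁ y) (γ₂ y)) x v =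
      𝒢.Dm (γ₁ x) (γ₂ x) (mder I 𝓘(ℝ, EG) γ₁ x v) (mder I 𝓘(ℝ, EG) γ₂ x v) := by
  have hm := ((𝒢.smooth_mul (γ₁ x, γ₂ x) hc.self_of_nhds).mdifferentiableWithinAt
    (by simp)).hasMFDerivWithinAt
  have hg := (h1.hasMFDerivAt.prodMk h2.hasMFDerivAt).hasMFDerivWithinAt
    (s := {y | 𝒢.s (γ₁ y) = 𝒢.t (γ₂ y)})
  have hcomp := (hm.comp x hg
    (show {y | 𝒢.s (γ₁ y) = 𝒢.t (γ₂ y)} ⊆ (fun y => (γ₁ y, γ₂ y)) ⁻¹'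
      {p : G × G | 𝒢.s p.1 = 𝒢.t p.2} from fun y hy => hy)).hasMFDerivAt hc
  have := hcomp.mfderiv
  exact congrArg (fun L : E →L[ℝ] EG => L v) this

end Maps

variable {𝒢}

/-- Every linear family of composable vectors of the tangent groupoid is the derivative of a smooth
family of composable pairs: the second factor is affine in a chart, and the first one lifts its
target along `s`. -/
theorem exists_composable_pair {g₁ g₂ : G} (e : 𝒢.s g₁ = 𝒢.t g₂) {W : Type*}
    [NormedAddCommGroup W] [NormedSpace ℝ W] (L₁ L₂ : W →L[ℝ] EG)
    (hL : ∀ w, 𝒢.Ds g₁ (L₁ w) = 𝒢.Dt g₂ (L₂ w)) :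
    ∃ γ₁ γ₂ : W → G, ContMDiffAt 𝓘(ℝ, W) 𝓘(ℝ, EG) ∞ γ₁ 0 ∧ ContMDiffAt 𝓘(ℝ, W) 𝓘(ℝ, EG) ∞ γ₂ 0 ∧
      γ₁ 0 = g₁ ∧ γ₂ 0 = g₂ ∧ (∀ᶠ y in 𝓝 0, 𝒢.s (γ₁ y) = 𝒢.t (γ₂ y)) ∧
      (∀ w, mder 𝓘(ℝ, W) 𝓘(ℝ, EG) γ₁ 0 w = L₁ w) ∧ ∀ w, mder 𝓘(ℝ, W) 𝓘(ℝ, EG) γ₂ 0 w = L₂ w := by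
  set φ := extChartAt 𝓘(ℝ, EG) g₂ with hφ
  have hlin : ContMDiffAt 𝓘(ℝ, W) 𝓘(ℝ, EG) ∞ (fun y => φ g₂ + L₂ y) 0 :=
    (contDiff_const.add L₂.contDiff).contMDiff.contMDiffAt
  have h0 : φ g₂ + L₂ 0 = φ g₂ := by simp
  have hγ₂ : ContMDiffAt 𝓘(ℝ, W) 𝓘(ℝ, EG) ∞ (fun y => φ.symm (φ g₂ + L₂ y)) 0 :=
    ContMDiffAt.comp_of_eq (contMDiffAt_extChartAt_symm_self g₂) hlin h0
  have hγ₂0 : φ.symm (φ g₂ + L₂ 0) = g₂ := by rw [h0]; simp [hφ]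
  have hd : ∀ w, mder 𝓘(ℝ, W) 𝓘(ℝ, EG) (fun y => φ.symm (φ g₂ + L₂ y)) 0 w = L₂ w := by
    intro w
    rw [mder_comp (I' := 𝓘(ℝ, EG))
      (by rw [h0]; exact (contMDiffAt_extChartAt_symm_self g₂).mdifferentiableAt (by simp))
      (hlin.mdifferentiableAt (by simp)), h0, mder_extChartAt_symm_self]
    have : HasFDerivAt (fun y => φ g₂ + L₂ y) L₂ 0 := L₂.hasFDerivAt.const_add _
    exact congrArg (fun L : W →L[ℝ] EG => L w) this.hasMFDerivAt.mfderiv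
  have hβ : ContMDiffAt 𝓘(ℝ, W) 𝓘(ℝ, EM) ∞ (fun y => 𝒢.t (φ.symm (φ g₂ + L₂ y))) 0 :=
    ContMDiffAt.comp (I' := 𝓘(ℝ, EG)) 0 𝒢.contMDiff_t.contMDiffAt hγ₂
  obtain ⟨γ₁, h1, h2, h3, h4⟩ := (𝒢.submersion_s.isSubmersionAt g₁).exists_lift hβ
    (by rw [hγ₂0, e]) L₁ (fun w => by
      rw [mder_comp (I' := 𝓘(ℝ, EG)) (𝒢.mdiff_t _) (hγ₂.mdifferentiableAt (by simp)), hd, hγ₂0]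
      exact hL w)
  exact ⟨γ₁, _, h1, hγ₂, h2, hγ₂0, h3, h4, hd⟩

/-- A linear map from `ℝ` with prescribed value at `1`. -/
def lineMap (v : EG) : ℝ →L[ℝ] EG := (ContinuousLinearMap.id ℝ ℝ).smulRight v

/-- Composable vectors are the velocities of composable curves. This reduces the identities of the
tangent groupoid to those of `G`. -/
theorem exists_composable_curves {g₁ g₂ : G} (e : 𝒢.s g₁ = 𝒢.t g₂) {v w : EG}
    (h : 𝒢.Ds g₁ v = 𝒢.Dt g₂ w) :
    ∃ γ₁ γ₂ : ℝ → G, MDifferentiableAt 𝓘(ℝ, ℝ) 𝓘(ℝ, EG) γ₁ 0 ∧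
      MDifferentiableAt 𝓘(ℝ, ℝ) 𝓘(ℝ, EG) γ₂ 0 ∧
      γ₁ 0 = g₁ ∧ γ₂ 0 = g₂ ∧ (∀ᶠ y in 𝓝 0, 𝒢.s (γ₁ y) = 𝒢.t (γ₂ y)) ∧
      mder 𝓘(ℝ, ℝ) 𝓘(ℝ, EG) γ₁ 0 1 = v ∧ mder 𝓘(ℝ, ℝ) 𝓘(ℝ, EG) γ₂ 0 1 = w := by
  obtain ⟨γ₁, γ₂, h1, h2, h3, h4, h5, h6, h7⟩ := exists_composable_pair e (lineMap v) (lineMap w)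
    (fun c => by simp [lineMap, h])
  exact ⟨γ₁, γ₂, h1.mdifferentiableAt (by simp), h2.mdifferentiableAt (by simp), h3, h4, h5,
    by rw [h6]; simp [lineMap], by rw [h7]; simp [lineMap]⟩

theorem Ds_Dm {g₁ g₂ : G} (e : 𝒢.s g₁ = 𝒢.t g₂) {v w : EG} (h : 𝒢.Ds g₁ v = 𝒢.Dt g₂ w) :
    𝒢.Ds (𝒢.mul g₁ g₂) (𝒢.Dm g₁ g₂ v w) = 𝒢.Ds g₂ w := by
  obtain ⟨γ₁, γ₂, h1, h2, rfl, rfl, h5, rfl, rfl⟩ := exists_composable_curves e h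
  have hd := 𝒢.mdiff_mul h1 h2 h5
  rw [← 𝒢.mder_mul h1 h2 h5]
  unfold Ds
  rw [← mder_comp (𝒢.mdiff_s _) hd, ← mder_comp (𝒢.mdiff_s _) h2]
  refine congrArg (fun L : ℝ →L[ℝ] EM => L 1) (mder_congr ?_)
  filter_upwards [h5] with y hy using 𝒢.s_mul _ _ hy

theorem Dt_Dm {g₁ g₂ : G} (e : 𝒢.s g₁ = 𝒢.t g₂) {v w : EG} (h : 𝒢.Ds g₁ v = 𝒢.Dt g₂ w) :
    𝒢.Dt (𝒢.mul g₁ g₂) (𝒢.Dm g₁ g₂ v w) = 𝒢.Dt g₁ v := by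
  obtain ⟨γ₁, γ₂, h1, h2, rfl, rfl, h5, rfl, rfl⟩ := exists_composable_curves e h
  have hd := 𝒢.mdiff_mul h1 h2 h5
  rw [← 𝒢.mder_mul h1 h2 h5]
  unfold Dt
  rw [← mder_comp (𝒢.mdiff_t _) hd, ← mder_comp (𝒢.mdiff_t _) h1]
  refine congrArg (fun L : ℝ →L[ℝ] EM => L 1) (mder_congr ?_)
  filter_upwards [h5] with y hy using 𝒢.t_mul _ _ hy

/-- Associativity in the tangent groupoid, from a curve of composable triples. -/
theorem Dm_assoc {g₁ g₂ g₃ : G} (e : 𝒢.s g₁ = 𝒢.t g₂) (e' : 𝒢.s g₂ = 𝒢.t g₃) {u v w : EG}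
    (h : 𝒢.Ds g₁ u = 𝒢.Dt g₂ v) (h' : 𝒢.Ds g₂ v = 𝒢.Dt g₃ w) :
    𝒢.Dm (𝒢.mul g₁ g₂) g₃ (𝒢.Dm g₁ g₂ u v) w = 𝒢.Dm g₁ (𝒢.mul g₂ g₃) u (𝒢.Dm g₂ g₃ v w) := by
  obtain ⟨γ₂, γ₃, h1, h2, h3, h4, h5, h6, h7⟩ := exists_composable_pair e' (lineMap v) (lineMap w)
    (fun c => by simp [lineMap, h'])
  have hβ : ContMDiffAt 𝓘(ℝ, ℝ) 𝓘(ℝ, EM) ∞ (fun y => 𝒢.t (γ₂ y)) 0 :=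
    ContMDiffAt.comp (I' := 𝓘(ℝ, EG)) 0 𝒢.contMDiff_t.contMDiffAt h1
  obtain ⟨γ₁, k1, k2, k3, k4⟩ := (𝒢.submersion_s.isSubmersionAt g₁).exists_lift hβ
    (by rw [h3, e]) (lineMap u) (fun c => by
      rw [mder_comp (I' := 𝓘(ℝ, EG)) (𝒢.mdiff_t _) (h1.mdifferentiableAt (by simp)), h6, h3]
      change 𝒢.Ds g₁ _ = 𝒢.Dt g₂ _
      simp [lineMap, h])
  have h6' : mder 𝓘(ℝ, ℝ) 𝓘(ℝ, EG) γ₂ 0 1 = v := by rw [h6]; simp [lineMap]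
  have h7' : mder 𝓘(ℝ, ℝ) 𝓘(ℝ, EG) γ₃ 0 1 = w := by rw [h7]; simp [lineMap]
  have k4' : mder 𝓘(ℝ, ℝ) 𝓘(ℝ, EG) γ₁ 0 1 = u := by rw [k4]; simp [lineMap]
  have d1 := k1.mdifferentiableAt (n := ∞) (by simp)
  have d2 := h1.mdifferentiableAt (n := ∞) (by simp)
  have d3 := h2.mdifferentiableAt (n := ∞) (by simp)
  have d12 := (𝒢.contMDiffAt_mul k1 h1 k3).mdifferentiableAt (n := ∞) (by simp)
  have d23 := (𝒢.contMDiffAt_mul h1 h2 h5).mdifferentiableAt (n := ∞) (by simp)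
  have c12 : ∀ᶠ y in 𝓝 0, 𝒢.s (𝒢.mul (γ₁ y) (γ₂ y)) = 𝒢.t (γ₃ y) := by
    filter_upwards [k3, h5] with y hy hy'
    rw [𝒢.s_mul _ _ hy, hy']
  have c23 : ∀ᶠ y in 𝓝 0, 𝒢.s (γ₁ y) = 𝒢.t (𝒢.mul (γ₂ y) (γ₃ y)) := by
    filter_upwards [k3, h5] with y hy hy'
    rw [𝒢.t_mul _ _ hy', hy]
  have q1 := 𝒢.mder_mul d12 d3 c12 1
  have q2 := 𝒢.mder_mul d1 d23 c23 1
  rw [𝒢.mder_mul d1 d2 k3, k4', h6', h7', k2, h3, h4] at q1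
  rw [𝒢.mder_mul d2 d3 h5, k4', h6', h7', k2, h3, h4] at q2
  rw [← q1, ← q2]
  refine congrArg (fun L : ℝ →L[ℝ] EG => L 1) (mder_congr ?_)
  filter_upwards [k3, h5] with y hy hy' using 𝒢.mul_assoc _ _ _ hy hy'

theorem exists_curve (g : G) (w : EG) : ∃ γ : ℝ → G, MDifferentiableAt 𝓘(ℝ, ℝ) 𝓘(ℝ, EG) γ 0 ∧
    γ 0 = g ∧ mder 𝓘(ℝ, ℝ) 𝓘(ℝ, EG) γ 0 1 = w := by
  have hlin : MDifferentiableAt 𝓘(ℝ, ℝ) 𝓘(ℝ, EG)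
      (fun y => extChartAt 𝓘(ℝ, EG) g g + lineMap w y) 0 :=
    ((lineMap w).differentiableAt.const_add _).mdifferentiableAt
  have h0 : extChartAt 𝓘(ℝ, EG) g g + lineMap w 0 = extChartAt 𝓘(ℝ, EG) g g := by simp
  have hs := (contMDiffAt_extChartAt_symm_self (EG := EG) g).mdifferentiableAt (n := ∞) (by simp)
  refine ⟨fun y => (extChartAt 𝓘(ℝ, EG) g).symm (extChartAt 𝓘(ℝ, EG) g g + lineMap w y),
    MDifferentiableAt.comp (0 : ℝ) (by rw [h0]; exact hs) hlin, by simp, ?_⟩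
  rw [mder_comp (I' := 𝓘(ℝ, EG)) (by rw [h0]; exact hs) hlin, h0, mder_extChartAt_symm_self]
  have : HasFDerivAt (fun y => extChartAt 𝓘(ℝ, EG) g g + lineMap w y) (lineMap w) 0 :=
    (lineMap w).hasFDerivAt.const_add _
  rw [mder_of_hasMFDerivAt this.hasMFDerivAt]
  simp [lineMap]

/-- The vectors tangent to the units are left units of the tangent groupoid. -/
theorem Dm_Done_left (g : G) (w : EG) :
    𝒢.Dm (𝒢.one (𝒢.t g)) g (𝒢.Done (𝒢.t g) (𝒢.Dt g w)) w = w := by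
  obtain ⟨γ, h1, rfl, rfl⟩ := exists_curve g w
  have ht : MDifferentiableAt 𝓘(ℝ, ℝ) 𝓘(ℝ, EM) (fun y => 𝒢.t (γ y)) 0 := (𝒢.mdiff_t _).comp 0 h1
  have h2 : MDifferentiableAt 𝓘(ℝ, ℝ) 𝓘(ℝ, EG) (fun y => 𝒢.one (𝒢.t (γ y))) 0 :=
    (𝒢.mdiff_one _).comp 0 ht
  have h3 := 𝒢.mder_mul h2 h1 (Eventually.of_forall fun y => 𝒢.s_one _) 1
  rw [mder_comp (𝒢.mdiff_one _) ht, mder_comp (𝒢.mdiff_t _) h1] at h3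
  refine h3.symm.trans (congrArg (fun L : ℝ →L[ℝ] EG => L 1) (mder_congr ?_))
  exact Eventually.of_forall fun y => 𝒢.one_mul _

/-- The vectors tangent to the units are right units of the tangent groupoid. -/
theorem Dm_Done_right (g : G) (w : EG) :
    𝒢.Dm g (𝒢.one (𝒢.s g)) w (𝒢.Done (𝒢.s g) (𝒢.Ds g w)) = w := by
  obtain ⟨γ, h1, rfl, rfl⟩ := exists_curve g w
  have ht : MDifferentiableAt 𝓘(ℝ, ℝ) 𝓘(ℝ, EM) (fun y => 𝒢.s (γ y)) 0 := (𝒢.mdiff_s _).comp 0 h1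
  have h2 : MDifferentiableAt 𝓘(ℝ, ℝ) 𝓘(ℝ, EG) (fun y => 𝒢.one (𝒢.s (γ y))) 0 :=
    (𝒢.mdiff_one _).comp 0 ht
  have h3 := 𝒢.mder_mul h1 h2 (Eventually.of_forall fun y => (𝒢.t_one _).symm) 1
  rw [mder_comp (𝒢.mdiff_one _) ht, mder_comp (𝒢.mdiff_s _) h1] at h3
  refine h3.symm.trans (congrArg (fun L : ℝ →L[ℝ] EG => L 1) (mder_congr ?_))
  exact Eventually.of_forall fun y => 𝒢.mul_one _

theorem Ds_Done (x : M) (v : EM) : 𝒢.Ds (𝒢.one x) (𝒢.Done x v) = v := by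
  unfold Ds Done
  rw [← mder_comp (𝒢.mdiff_s _) (𝒢.mdiff_one x)]
  simp only [𝒢.s_one, mder_id]

theorem Dt_Done (x : M) (v : EM) : 𝒢.Dt (𝒢.one x) (𝒢.Done x v) = v := by
  unfold Dt Done
  rw [← mder_comp (𝒢.mdiff_t _) (𝒢.mdiff_one x)]
  simp only [𝒢.t_one, mder_id]

/-! ### Translations -/

theorem Dm_one_zero {g : G} {w : EG} (h : 𝒢.Dt g w = 0) : 𝒢.Dm (𝒢.one (𝒢.t g)) g 0 w = w := by
  have := 𝒢.Dm_Done_left g w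
  rwa [h, map_zero] at this

theorem Dm_zero_one {g : G} {w : EG} (h : 𝒢.Ds g w = 0) : 𝒢.Dm g (𝒢.one (𝒢.s g)) w 0 = w := by
  have := 𝒢.Dm_Done_right g w
  rwa [h, map_zero] at this

theorem Dt_lT {g : G} {a : EG} (h : 𝒢.Dt (𝒢.one (𝒢.s g)) a = 0) : 𝒢.Dt g (𝒢.lT g a) = 0 := by
  have := Dt_Dm (𝒢 := 𝒢) (g₁ := g) (g₂ := 𝒢.one (𝒢.s g)) (𝒢.t_one _).symm (v := 0) (w := a)
    (by rw [h, map_zero])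
  rwa [𝒢.mul_one, ← lT_apply, map_zero] at this

theorem Ds_lT {g : G} {a : EG} (h : 𝒢.Dt (𝒢.one (𝒢.s g)) a = 0) :
    𝒢.Ds g (𝒢.lT g a) = 𝒢.Ds (𝒢.one (𝒢.s g)) a := by
  have := Ds_Dm (𝒢 := 𝒢) (g₁ := g) (g₂ := 𝒢.one (𝒢.s g)) (𝒢.t_one _).symm (v := 0) (w := a)
    (by rw [h, map_zero])
  rwa [𝒢.mul_one, ← lT_apply] at this

theorem lI_lT {g : G} {a : EG} (h : 𝒢.Dt (𝒢.one (𝒢.s g)) a = 0) : 𝒢.lI g (𝒢.lT g a) = a := by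
  rw [lI_apply, lT_apply]
  have h1 := Dm_assoc (𝒢 := 𝒢) (g₁ := 𝒢.inv g) (g₂ := g) (g₃ := 𝒢.one (𝒢.s g)) (𝒢.s_inv g)
    (𝒢.t_one _).symm (u := 0) (v := 0) (w := a) (by simp) (by rw [h, map_zero])
  rw [𝒢.mul_one, 𝒢.inv_mul, Dm_zero] at h1
  rw [← h1]
  have := Dm_one_zero h
  rwa [𝒢.t_one] at this

theorem lT_lI {g : G} {v : EG} (h : 𝒢.Dt g v = 0) : 𝒢.lT g (𝒢.lI g v) = v := by
  rw [lI_apply, lT_apply]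
  have h1 := Dm_assoc (𝒢 := 𝒢) (g₁ := g) (g₂ := 𝒢.inv g) (g₃ := g) (𝒢.t_inv g).symm
    (𝒢.s_inv g) (u := 0) (v := 0) (w := v) (by simp) (by rw [h, map_zero])
  rw [𝒢.mul_inv, 𝒢.inv_mul, Dm_zero] at h1
  rw [← h1]
  exact Dm_one_zero h

theorem lT_one {x : M} {a : EG} (h : 𝒢.Dt (𝒢.one x) a = 0) : 𝒢.lT (𝒢.one x) a = a := by
  rw [lT_apply, 𝒢.s_one]
  have := Dm_one_zero h
  rwa [𝒢.t_one] at this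

/-- Left translation is compatible with products. -/
theorem Dm_zero_lT {g₁ g₂ : G} (e : 𝒢.s g₁ = 𝒢.t g₂) {a : EG}
    (h : 𝒢.Dt (𝒢.one (𝒢.s g₂)) a = 0) : 𝒢.Dm g₁ g₂ 0 (𝒢.lT g₂ a) = 𝒢.lT (𝒢.mul g₁ g₂) a := by
  rw [lT_apply, lT_apply, 𝒢.s_mul _ _ e]
  have h1 := Dm_assoc (𝒢 := 𝒢) (g₁ := g₁) (g₂ := g₂) (g₃ := 𝒢.one (𝒢.s g₂)) e
    (𝒢.t_one _).symm (u := 0) (v := 0) (w := a) (by simp) (by rw [h, map_zero])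
  rw [𝒢.mul_one, Dm_zero] at h1
  exact h1.symm

theorem Dm_lT_zero {g₁ g₂ : G} (e : 𝒢.s g₁ = 𝒢.t g₂) {a : EG}
    (h : 𝒢.Dt (𝒢.one (𝒢.s g₁)) a = 0) (h' : 𝒢.Ds (𝒢.one (𝒢.s g₁)) a = 0) :
    𝒢.Dm g₁ g₂ (𝒢.lT g₁ a) 0 = 𝒢.Dm g₁ g₂ 0 (𝒢.rT g₂ a) := by
  rw [lT_apply, rT_apply, ← e]
  have h1 := Dm_assoc (𝒢 := 𝒢) (g₁ := g₁) (g₂ := 𝒢.one (𝒢.s g₁)) (g₃ := g₂)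
    (𝒢.t_one _).symm (by rw [𝒢.s_one, e]) (u := 0) (v := a) (w := 0) (by simp [h]) (by simp [h'])
  rw [𝒢.mul_one] at h1
  rw [h1, e, 𝒢.one_mul]

theorem Dt_rT {g : G} {a : EG} (h : 𝒢.Ds (𝒢.one (𝒢.t g)) a = 0) :
    𝒢.Dt g (𝒢.rT g a) = 𝒢.Dt (𝒢.one (𝒢.t g)) a := by
  have := Dt_Dm (𝒢 := 𝒢) (g₁ := 𝒢.one (𝒢.t g)) (g₂ := g) (𝒢.s_one _) (v := a) (w := 0)
    (by rw [h, map_zero])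
  rwa [𝒢.one_mul, ← rT_apply] at this

/-- The conjugation action by `g⁻¹` is right translation by `g`, followed by left translation
by `g⁻¹`. -/
theorem Ad_inv {g : G} {a : EG} (h : 𝒢.Dt (𝒢.one (𝒢.t g)) a = 0)
    (h' : 𝒢.Ds (𝒢.one (𝒢.t g)) a = 0) : (𝒢.Ad (𝒢.inv g) a : EG) = 𝒢.lI g (𝒢.rT g a) := by
  rw [Ad_apply, lI_apply, rT_apply, 𝒢.inv_inv, 𝒢.s_inv]
  have h1 := Dm_assoc (𝒢 := 𝒢) (g₁ := 𝒢.inv g) (g₂ := 𝒢.one (𝒢.t g)) (g₃ := g)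
    (by rw [𝒢.s_inv, 𝒢.t_one]) (𝒢.s_one _) (u := 0) (v := a) (w := 0) (by simp [h]) (by simp [h'])
  have h2 := 𝒢.mul_one (𝒢.inv g)
  rw [𝒢.s_inv] at h2
  rwa [h2, 𝒢.one_mul] at h1

/-! ### Invariant vector fields -/

/-- The velocity at time zero of a smooth family of curves is a smooth field. -/
theorem smoothAlong_velocity {F : G × ℝ → G} {g : G}
    (hF : ContMDiffAt (𝓘(ℝ, EG).prod 𝓘(ℝ, ℝ)) 𝓘(ℝ, EG) ∞ F (g, 0)) :
    SmoothAlong 𝓘(ℝ, EG) (fun a => F (a, 0))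
      (fun a => mder (𝓘(ℝ, EG).prod 𝓘(ℝ, ℝ)) 𝓘(ℝ, EG) F (a, 0) (0, 1)) g := by
  have h1 : ContMDiffAt 𝓘(ℝ, EG) 𝓘(ℝ, EG).tangent ∞
      (fun a : G => (⟨a, (0 : EG)⟩ : TangentBundle 𝓘(ℝ, EG) G)) g :=
    SmoothAlong.zero (f := fun a : G => a) contMDiffAt_id
  have h2 : ContMDiffAt 𝓘(ℝ, EG) 𝓘(ℝ, ℝ).tangent ∞
      (fun _ : G => (⟨(0 : ℝ), (1 : ℝ)⟩ : TangentBundle 𝓘(ℝ, ℝ) ℝ)) g := contMDiffAt_const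
  have hV : ContMDiffAt 𝓘(ℝ, EG) (𝓘(ℝ, EG).prod 𝓘(ℝ, ℝ)).tangent ∞ (fun a : G =>
      (⟨(a, (0 : ℝ)), ((0 : EG), (1 : ℝ))⟩ : TangentBundle (𝓘(ℝ, EG).prod 𝓘(ℝ, ℝ)) (G × ℝ))) g :=
    ((contMDiff_equivTangentBundleProd_symm (I := 𝓘(ℝ, EG)) (I' := 𝓘(ℝ, ℝ)) (M := G)
      (M' := ℝ) (n := ∞)).contMDiffAt).comp g (h1.prodMk h2)
  exact smoothAlong_mder (b := fun a : G => (a, (0 : ℝ))) (V := fun _ => ((0 : EG), (1 : ℝ))) hF hV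

/-- The derivative in the direction of time of a family of curves that is parametrized through a
map `π` of the base. -/
theorem mder_time_comp {π : G → M} {c : M × ℝ → G} {a : G}
    (hπ : MDifferentiableAt 𝓘(ℝ, EG) 𝓘(ℝ, EM) π a)
    (hc : MDifferentiableAt (𝓘(ℝ, EM).prod 𝓘(ℝ, ℝ)) 𝓘(ℝ, EG) c (π a, 0)) :
    mder (𝓘(ℝ, EG).prod 𝓘(ℝ, ℝ)) 𝓘(ℝ, EG) (fun p : G × ℝ => p.1) (a, 0) (0, 1) = 0 ∧
    mder (𝓘(ℝ, EG).prod 𝓘(ℝ, ℝ)) 𝓘(ℝ, EG) (fun p : G × ℝ => c (π p.1, p.2)) (a, 0) (0, 1) =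
      mder (𝓘(ℝ, EM).prod 𝓘(ℝ, ℝ)) 𝓘(ℝ, EG) c (π a, 0) (0, 1) := by
  have hfst : MDifferentiableAt (𝓘(ℝ, EG).prod 𝓘(ℝ, ℝ)) 𝓘(ℝ, EG) (fun p : G × ℝ => p.1) (a, 0) :=
    mdifferentiableAt_fst
  have hsnd : MDifferentiableAt (𝓘(ℝ, EG).prod 𝓘(ℝ, ℝ)) 𝓘(ℝ, ℝ) (fun p : G × ℝ => p.2) (a, 0) :=
    mdifferentiableAt_snd
  have e1 : mder (𝓘(ℝ, EG).prod 𝓘(ℝ, ℝ)) 𝓘(ℝ, EG) (fun p : G × ℝ => p.1) (a, 0) (0, 1) = 0 :=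
    congrArg (fun L : EG × ℝ →L[ℝ] EG => L (0, 1)) (mfderiv_fst (I := 𝓘(ℝ, EG)) (I' := 𝓘(ℝ, ℝ)))
  have e2 : mder (𝓘(ℝ, EG).prod 𝓘(ℝ, ℝ)) 𝓘(ℝ, ℝ) (fun p : G × ℝ => p.2) (a, 0) (0, 1) = 1 :=
    congrArg (fun L : EG × ℝ →L[ℝ] ℝ => L (0, 1)) (mfderiv_snd (I := 𝓘(ℝ, EG)) (I' := 𝓘(ℝ, ℝ)))
  have hsd : MDifferentiableAt (𝓘(ℝ, EG).prod 𝓘(ℝ, ℝ)) 𝓘(ℝ, EM) (fun p : G × ℝ => π p.1)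
    (a, 0) := MDifferentiableAt.comp (a, (0 : ℝ)) hπ hfst
  refine ⟨e1, ?_⟩
  rw [mder_comp (I' := 𝓘(ℝ, EM).prod 𝓘(ℝ, ℝ)) (f := fun p : G × ℝ => (π p.1, p.2)) hc
    (hsd.prodMk hsnd), mder_prodMk hsd hsnd, mder_comp hπ hfst, e1, e2, map_zero]

theorem contMDiffAt_time_comp {π : G → M} {c : M × ℝ → G} {g : G}
    (hπ : ContMDiffAt 𝓘(ℝ, EG) 𝓘(ℝ, EM) ∞ π g)
    (hc : ContMDiffAt (𝓘(ℝ, EM).prod 𝓘(ℝ, ℝ)) 𝓘(ℝ, EG) ∞ c (π g, 0)) :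
    ContMDiffAt (𝓘(ℝ, EG).prod 𝓘(ℝ, ℝ)) 𝓘(ℝ, EG) ∞ (fun p : G × ℝ => c (π p.1, p.2)) (g, 0) ∧
    ContinuousAt (fun p : G × ℝ => (π p.1, p.2)) (g, 0) := by
  have hsc : ContMDiffAt (𝓘(ℝ, EG).prod 𝓘(ℝ, ℝ)) (𝓘(ℝ, EM).prod 𝓘(ℝ, ℝ)) ∞
      (fun p : G × ℝ => (π p.1, p.2)) (g, 0) :=
    (ContMDiffAt.comp (I' := 𝓘(ℝ, EG)) (g, (0 : ℝ)) hπ contMDiffAt_fst).prodMk contMDiffAt_snd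
  exact ⟨ContMDiffAt.comp (g, (0 : ℝ)) hc hsc, hsc.continuousAt⟩

/-- The left-invariant vector field of a smooth section is smooth: near `g`, it is the velocity of
a smooth family of curves obtained by multiplication with curves in the fibres of `t`. -/
theorem smoothAlong_lT {g : G} {ξ : M → EG} (hξ : SmoothAlong 𝓘(ℝ, EM) 𝒢.one ξ (𝒢.s g))
    (hv : ∀ᶠ x in 𝓝 (𝒢.s g), 𝒢.Dt (𝒢.one x) (ξ x) = 0) :
    SmoothAlong 𝓘(ℝ, EG) (fun a => a) (fun a => 𝒢.lT a (ξ (𝒢.s a))) g := by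
  obtain ⟨c, hc, hct, hcx⟩ := (𝒢.submersion_t.isSubmersionAt (𝒢.one (𝒢.s g))).exists_curves
    (σ := 𝒢.one) 𝒢.t_one hξ hv
  obtain ⟨hc', hsc⟩ := contMDiffAt_time_comp 𝒢.contMDiff_s.contMDiffAt hc
  have hcomp : ∀ᶠ p : G × ℝ in 𝓝 (g, 0), 𝒢.s p.1 = 𝒢.t (c (𝒢.s p.1, p.2)) := by
    filter_upwards [hsc.eventually hct] with p hp using hp.symm
  have hS := smoothAlong_velocity (𝒢.contMDiffAt_mul (I := 𝓘(ℝ, EG).prod 𝓘(ℝ, ℝ)) (N := G × ℝ)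
    contMDiffAt_fst hc' hcomp)
  have hs := 𝒢.contMDiff_s.continuous.continuousAt (x := g)
  have hslice : ContinuousAt (fun a : G => (a, (0 : ℝ))) g :=
    continuousAt_id.prodMk continuousAt_const
  refine hS.congr ?_ ?_
  · filter_upwards [hs.eventually hcx] with a ha
    simp only [ha.1, 𝒢.mul_one]
  · filter_upwards [hs.eventually hcx, hslice.eventually hc'.eventually_mdifferentiableAt,
      hslice.eventually hcomp.eventually_nhds,
      (hs.prodMk continuousAt_const).eventually hc.eventually_mdifferentiableAt] with a ha h1 h2 h3
    obtain ⟨e1, e2⟩ := mder_time_comp (𝒢.mdiff_s a) h3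
    rw [𝒢.mder_mul mdifferentiableAt_fst h1 h2, e1, e2, ha.2, ha.1, lT_apply]

/-- The right-invariant vector field of a smooth section of the kernel of `ds` is smooth. -/
theorem smoothAlong_rT {g : G} {ξ : M → EG} (hξ : SmoothAlong 𝓘(ℝ, EM) 𝒢.one ξ (𝒢.t g))
    (hv : ∀ᶠ x in 𝓝 (𝒢.t g), 𝒢.Ds (𝒢.one x) (ξ x) = 0) :
    SmoothAlong 𝓘(ℝ, EG) (fun a => a) (fun a => 𝒢.rT a (ξ (𝒢.t a))) g := by
  obtain ⟨c, hc, hct, hcx⟩ := (𝒢.submersion_s.isSubmersionAt (𝒢.one (𝒢.t g))).exists_curves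
    (σ := 𝒢.one) 𝒢.s_one hξ hv
  obtain ⟨hc', hsc⟩ := contMDiffAt_time_comp 𝒢.contMDiff_t.contMDiffAt hc
  have hcomp : ∀ᶠ p : G × ℝ in 𝓝 (g, 0), 𝒢.s (c (𝒢.t p.1, p.2)) = 𝒢.t p.1 := by
    filter_upwards [hsc.eventually hct] with p hp using hp
  have hS := smoothAlong_velocity (𝒢.contMDiffAt_mul (I := 𝓘(ℝ, EG).prod 𝓘(ℝ, ℝ)) (N := G × ℝ)
    hc' contMDiffAt_fst hcomp)
  have hs := 𝒢.contMDiff_t.continuous.continuousAt (x := g)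
  have hslice : ContinuousAt (fun a : G => (a, (0 : ℝ))) g :=
    continuousAt_id.prodMk continuousAt_const
  refine hS.congr ?_ ?_
  · filter_upwards [hs.eventually hcx] with a ha
    simp only [ha.1, 𝒢.one_mul]
  · filter_upwards [hs.eventually hcx, hslice.eventually hc'.eventually_mdifferentiableAt,
      hslice.eventually hcomp.eventually_nhds,
      (hs.prodMk continuousAt_const).eventually hc.eventually_mdifferentiableAt] with a ha h1 h2 h3
    obtain ⟨e1, e2⟩ := mder_time_comp (𝒢.mdiff_t a) h3
    rw [𝒢.mder_mul h1 mdifferentiableAt_fst h2, e1, e2, ha.2, ha.1, rT_apply]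

end TangentGroupoid

end LieGroupoid

/-! ### Ideals and connections in the model spaces -/

/-- The coefficients of a smooth field with respect to smooth fields forming a basis are smooth. -/
theorem smoothAlong_coeff {E : Type*} [NormedAddCommGroup E] [NormedSpace ℝ E]
    {H : Type*} [TopologicalSpace H] {I : ModelWithCorners ℝ E H}
    {N : Type*} [TopologicalSpace N] [ChartedSpace H N]
    {EG : Type*} [NormedAddCommGroup EG] [NormedSpace ℝ EG] [FiniteDimensional ℝ EG]
    {G : Type*} [TopologicalSpace G] [ChartedSpace EG G] [IsManifold 𝓘(ℝ, EG) ∞ G]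
    {ι : Type*} [Fintype ι] {f : N → G} {X : ι → N → EG} {w : N → EG} {u : N → ι → ℝ} {z : N}
    (hX : ∀ i, SmoothAlong I f (X i) z) (hw : SmoothAlong I f w z)
    (hli : LinearIndependent ℝ (fun i => X i z)) (hsp : Submodule.span ℝ (range fun i => X i z) = ⊤)
    (hu : ∀ᶠ y in 𝓝 z, w y = ∑ i, u y i • X i y) (i : ι) :
    ContMDiffAt I 𝓘(ℝ, ℝ) ∞ (fun y => u y i) z := by
  -- In the trivialization at `f z` the claim concerns functions with values in the model space.
  let T : N → EG →L[ℝ] EG := fun y =>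
    (trivializationAt EG (TangentSpace 𝓘(ℝ, EG)) (f z)).continuousLinearMapAt ℝ (f y)
  have hT : T z = ContinuousLinearMap.id ℝ EG := by
    have : IsManifold 𝓘(ℝ, EG) 1 G := .of_le (n := ∞) (by simp)
    have h1 := TangentBundle.continuousLinearMapAt_trivializationAt (I := 𝓘(ℝ, EG))
      (x₀ := f z) (x := f z) (by simp)
    exact h1.trans (mder_extChartAt_self' (f z))
  refine contMDiffAt_coeff (b := fun i y => T y (X i y)) (w := fun y => T y (w y))
    (fun i => (smoothAlong_iff.1 (hX i)).2) (smoothAlong_iff.1 hw).2 ?_ ?_ ?_ i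
  · simpa only [hT, ContinuousLinearMap.id_apply] using hli
  · simpa only [hT, ContinuousLinearMap.id_apply] using hsp
  · filter_upwards [hu] with y hy
    rw [hy, map_sum]
    simp only [map_smul]

namespace LieGroupoid

section Conn

variable {EG : Type*} [NormedAddCommGroup EG] [NormedSpace ℝ EG] [FiniteDimensional ℝ EG]
  {G : Type*} [TopologicalSpace G] [ChartedSpace EG G] [IsManifold 𝓘(ℝ, EG) ∞ G]
  {EM : Type*} [NormedAddCommGroup EM] [NormedSpace ℝ EM] [FiniteDimensional ℝ EM]
  {M : Type*} [TopologicalSpace M] [ChartedSpace EM M] [IsManifold 𝓘(ℝ, EM) ∞ M]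
  {𝒢 : LieGroupoid EG G EM M}

namespace BundleOfIdeals

variable (𝔨 : 𝒢.BundleOfIdeals)

/-- The fibre of the bundle of ideals, as a subspace of the model space. -/
def kf (x : M) : Submodule ℝ EG := 𝔨.fiber x

variable {𝔨}

theorem Dt_kf {x : M} {a : EG} (h : a ∈ 𝔨.kf x) : 𝒢.Dt (𝒢.one x) a = 0 := 𝔨.dt_eq_zero x a h

theorem Ds_kf {x : M} {a : EG} (h : a ∈ 𝔨.kf x) : 𝒢.Ds (𝒢.one x) a = 0 := 𝔨.ds_eq_zero x a h

/-- Invariance of the bundle of ideals under the conjugation by `g⁻¹`. -/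
theorem lI_rT_mem {g : G} {a : EG} (h : a ∈ 𝔨.kf (𝒢.t g)) : 𝒢.lI g (𝒢.rT g a) ∈ 𝔨.kf (𝒢.s g) := by
  rw [← Ad_inv (Dt_kf h) (Ds_kf h)]
  have h' : a ∈ 𝔨.kf (𝒢.s (𝒢.inv g)) := by rwa [𝒢.s_inv]
  have : (𝒢.Ad (𝒢.inv g) a : EG) ∈ 𝔨.kf (𝒢.t (𝒢.inv g)) := 𝔨.Ad_mem (𝒢.inv g) a h'
  rwa [𝒢.t_inv] at this

/-- Right translates of vectors in the bundle of ideals are vertical, that is, left translates. -/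
theorem lT_lI_rT {g : G} {a : EG} (h : a ∈ 𝔨.kf (𝒢.t g)) :
    𝒢.lT g (𝒢.lI g (𝒢.rT g a)) = 𝒢.rT g a :=
  lT_lI (by rw [Dt_rT (Ds_kf h), Dt_kf h])

end BundleOfIdeals

open BundleOfIdeals

variable {𝔨 : 𝒢.BundleOfIdeals}

namespace EhresmannConnection

variable (𝓔 : EhresmannConnection 𝔨)

/-- The horizontal projection in the model space. -/
def hr (g : G) : EG →ₗ[ℝ] EG := 𝓔.hor g

/-- The connection one-form in the model space. -/
def al (g : G) : EG →ₗ[ℝ] EG := 𝓔.alphaLin g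

/-- The horizontal subspace, in the model space. -/
def Ef (g : G) : Submodule ℝ EG := 𝓔.E g

variable {𝓔}

theorem hr_mem (g : G) (v : EG) : 𝓔.hr g v ∈ 𝓔.Ef g :=
  Submodule.projection_apply_mem (𝓔.isCompl g) v

theorem hr_of_mem {g : G} {v : EG} (h : v ∈ 𝓔.Ef g) : 𝓔.hr g v = v :=
  (Submodule.projection_eq_self_iff (𝓔.isCompl g) v).2 h

theorem hr_lT {g : G} {a : EG} (h : a ∈ 𝔨.kf (𝒢.s g)) : 𝓔.hr g (𝒢.lT g a) = 0 := by
  refine (Submodule.projection_apply_eq_zero_iff (𝓔.isCompl g)).2 ?_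
  exact Submodule.mem_map_of_mem h

theorem exists_sub_hr (g : G) (v : EG) : ∃ a ∈ 𝔨.kf (𝒢.s g), v = 𝓔.hr g v + 𝒢.lT g a := by
  have h : 𝓔.hr g (v - 𝓔.hr g v) = 0 := by
    rw [map_sub, hr_of_mem (hr_mem g v), sub_self]
  have h2 : v - 𝓔.hr g v ∈ 𝔨.K g := (Submodule.projection_apply_eq_zero_iff (𝓔.isCompl g)).1 h
  obtain ⟨a, ha, hav⟩ := h2
  refine ⟨a, ha, ?_⟩
  have : 𝒢.lT g a = v - 𝓔.hr g v := hav
  rw [this]; abel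

theorem al_apply (g : G) (v : EG) : 𝓔.al g v = 𝒢.lI g (v - 𝓔.hr g v) := rfl

theorem al_lT {g : G} {a : EG} (h : a ∈ 𝔨.kf (𝒢.s g)) : 𝓔.al g (𝒢.lT g a) = a := by
  rw [al_apply, hr_lT h, sub_zero, lI_lT (Dt_kf h)]

theorem al_of_mem {g : G} {v : EG} (h : v ∈ 𝓔.Ef g) : 𝓔.al g v = 0 := by
  rw [al_apply, hr_of_mem h, sub_self, map_zero]

theorem al_mem (g : G) (v : EG) : 𝓔.al g v ∈ 𝔨.kf (𝒢.s g) := by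
  obtain ⟨a, ha, hv⟩ := exists_sub_hr (𝓔 := 𝓔) g v
  rw [hv, map_add, al_of_mem (hr_mem g v), al_lT ha, zero_add]
  exact ha

theorem hr_add_lT_al (g : G) (v : EG) : 𝓔.hr g v + 𝒢.lT g (𝓔.al g v) = v := by
  obtain ⟨a, ha, hv⟩ := exists_sub_hr (𝓔 := 𝓔) g v
  have : 𝓔.al g v = a := by
    conv_lhs => rw [hv]
    rw [map_add, al_of_mem (hr_mem g v), al_lT ha, zero_add]
  rw [this]; exact hv.symm

theorem al_one {x : M} {a : EG} (h : a ∈ 𝔨.kf x) : 𝓔.al (𝒢.one x) a = a := by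
  have h1 : a ∈ 𝔨.kf (𝒢.s (𝒢.one x)) := by rwa [𝒢.s_one]
  have := al_lT (𝓔 := 𝓔) h1
  rwa [lT_one (Dt_kf h)] at this

theorem Ds_hr (g : G) (v : EG) : 𝒢.Ds g (𝓔.hr g v) = 𝒢.Ds g v := by
  conv_rhs => rw [← hr_add_lT_al (𝓔 := 𝓔) g v]
  rw [map_add, Ds_lT (Dt_kf (al_mem g v)), Ds_kf (al_mem g v), add_zero]

theorem Dt_hr (g : G) (v : EG) : 𝒢.Dt g (𝓔.hr g v) = 𝒢.Dt g v := by
  conv_rhs => rw [← hr_add_lT_al (𝓔 := 𝓔) g v]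
  rw [map_add, Dt_lT (Dt_kf (al_mem g v)), add_zero]

theorem al_hr (g : G) (v : EG) : 𝓔.al g (𝓔.hr g v) = 0 := al_of_mem (hr_mem g v)

theorem Dm_mem {g₁ g₂ : G} (e : 𝒢.s g₁ = 𝒢.t g₂) {v w : EG} (hv : v ∈ 𝓔.Ef g₁) (hw : w ∈ 𝓔.Ef g₂)
    (h : 𝒢.Ds g₁ v = 𝒢.Dt g₂ w) : 𝒢.Dm g₁ g₂ v w ∈ 𝓔.Ef (𝒢.mul g₁ g₂) :=
  𝓔.mul_mem g₁ g₂ e v hv w hw ((tcast_eq (EG := EM) e _).trans h)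

/-- Decomposition of a product in the tangent groupoid into its horizontal and its vertical
part. -/
theorem Dm_eq {g₁ g₂ : G} (e : 𝒢.s g₁ = 𝒢.t g₂) (v w : EG) :
    𝒢.Dm g₁ g₂ v w = 𝒢.Dm g₁ g₂ (𝓔.hr g₁ v) (𝓔.hr g₂ w) +
      𝒢.lT (𝒢.mul g₁ g₂) (𝒢.lI g₂ (𝒢.rT g₂ (𝓔.al g₁ v)) + 𝓔.al g₂ w) := by
  have hk : 𝓔.al g₁ v ∈ 𝔨.kf (𝒢.t g₂) := by rw [← e]; exact al_mem g₁ v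
  have h1 : 𝒢.Dm g₁ g₂ v w = 𝒢.Dm g₁ g₂ (𝓔.hr g₁ v) (𝓔.hr g₂ w) +
      (𝒢.Dm g₁ g₂ (𝒢.lT g₁ (𝓔.al g₁ v)) 0 + 𝒢.Dm g₁ g₂ 0 (𝒢.lT g₂ (𝓔.al g₂ w))) := by
    rw [← Dm_add, ← Dm_add, add_zero, zero_add, hr_add_lT_al, hr_add_lT_al]
  rw [h1, Dm_lT_zero e (Dt_kf (al_mem g₁ v)) (Ds_kf (al_mem g₁ v)), ← lT_lI_rT hk,
    Dm_zero_lT e (Dt_kf (lI_rT_mem hk)), Dm_zero_lT e (Dt_kf (al_mem g₂ w)), map_add, lT_lI_rT hk]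

/-- The horizontal projection is multiplicative. -/
theorem hr_Dm {g₁ g₂ : G} (e : 𝒢.s g₁ = 𝒢.t g₂) {v w : EG} (h : 𝒢.Ds g₁ v = 𝒢.Dt g₂ w) :
    𝓔.hr (𝒢.mul g₁ g₂) (𝒢.Dm g₁ g₂ v w) = 𝒢.Dm g₁ g₂ (𝓔.hr g₁ v) (𝓔.hr g₂ w) := by
  have hk : 𝓔.al g₁ v ∈ 𝔨.kf (𝒢.t g₂) := by rw [← e]; exact al_mem g₁ v
  have hs : 𝒢.lI g₂ (𝒢.rT g₂ (𝓔.al g₁ v)) + 𝓔.al g₂ w ∈ 𝔨.kf (𝒢.s (𝒢.mul g₁ g₂)) := by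
    rw [𝒢.s_mul _ _ e]
    exact Submodule.add_mem _ (lI_rT_mem hk) (al_mem g₂ w)
  rw [Dm_eq (𝓔 := 𝓔) e v w, map_add, hr_lT hs, add_zero]
  exact hr_of_mem (Dm_mem e (hr_mem _ _) (hr_mem _ _) (by rw [Ds_hr, Dt_hr, h]))

theorem al_rT {g : G} {a : EG} (h : a ∈ 𝔨.kf (𝒢.t g)) : 𝓔.al g (𝒢.rT g a) = 𝒢.lI g (𝒢.rT g a) := by
  conv_lhs => rw [← lT_lI_rT h]
  rw [al_lT (lI_rT_mem h)]

/-- The connection one-form is multiplicative. -/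
theorem al_Dm {g₁ g₂ : G} (e : 𝒢.s g₁ = 𝒢.t g₂) {v w : EG} (h : 𝒢.Ds g₁ v = 𝒢.Dt g₂ w) :
    𝓔.al (𝒢.mul g₁ g₂) (𝒢.Dm g₁ g₂ v w) = 𝓔.al g₂ w + 𝓔.al g₂ (𝒢.rT g₂ (𝓔.al g₁ v)) := by
  have hk : 𝓔.al g₁ v ∈ 𝔨.kf (𝒢.t g₂) := by rw [← e]; exact al_mem g₁ v
  have hs : 𝒢.lI g₂ (𝒢.rT g₂ (𝓔.al g₁ v)) + 𝓔.al g₂ w ∈ 𝔨.kf (𝒢.s (𝒢.mul g₁ g₂)) := by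
    rw [𝒢.s_mul _ _ e]
    exact Submodule.add_mem _ (lI_rT_mem hk) (al_mem g₂ w)
  rw [Dm_eq (𝓔 := 𝓔) e v w, map_add, al_lT hs,
    al_of_mem (Dm_mem e (hr_mem _ _) (hr_mem _ _) (by rw [Ds_hr, Dt_hr, h])), al_rT hk]
  abel

/-- Local frames of the horizontal distribution, in the model space. -/
theorem exists_frame_model (𝓔 : EhresmannConnection 𝔨) (g : G) :
    ∃ (r : ℕ) (Y : Fin r → G → EG), ∀ᶠ a in 𝓝 g,
      (∀ i, SmoothAlong 𝓘(ℝ, EG) (fun a => a) (Y i) a) ∧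
      LinearIndependent ℝ (fun i => Y i a) ∧ Submodule.span ℝ (range fun i => Y i a) = 𝓔.Ef a := by
  obtain ⟨r, Y, h1, h2⟩ := 𝓔.exists_frame g
  refine ⟨r, Y, ?_⟩
  filter_upwards [eventually_all.2 h1, h2] with x hx1 hx2
  exact ⟨hx1, hx2⟩

end EhresmannConnection

/-! ### Local frames of the bundle of ideals -/

/-- A smooth local frame of the bundle of ideals on a neighbourhood of `x₀`. The neighbourhood is
not recorded, and the values of the frame outside of it are arbitrary. -/
structure LocalFrame (𝔨 : 𝒢.BundleOfIdeals) (x₀ : M) where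
  r : ℕ
  e : Fin r → M → EG
  good : ∀ᶠ x in 𝓝 x₀, (∀ i, SmoothAlong 𝓘(ℝ, EM) 𝒢.one (e i) x) ∧
    LinearIndependent ℝ (fun i => e i x) ∧ Submodule.span ℝ (range fun i => e i x) = 𝔨.kf x

theorem nonempty_localFrame (𝔨 : 𝒢.BundleOfIdeals) (x₀ : M) : Nonempty (LocalFrame 𝔨 x₀) := by
  obtain ⟨r, e, h1, h2⟩ := 𝔨.exists_frame x₀
  refine ⟨⟨r, e, ?_⟩⟩
  filter_upwards [eventually_all.2 h1, h2] with x hx1 hx2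
  exact ⟨hx1, hx2⟩

namespace LocalFrame

variable {x₀ : M} (F : LocalFrame 𝔨 x₀)

/-- The points near which the frame is a smooth frame. They form an open set containing `x₀`. -/
def Good (x : M) : Prop := ∀ᶠ y in 𝓝 x, (∀ i, SmoothAlong 𝓘(ℝ, EM) 𝒢.one (F.e i) y) ∧
    LinearIndependent ℝ (fun i => F.e i y) ∧ Submodule.span ℝ (range fun i => F.e i y) = 𝔨.kf y

theorem good_self : F.Good x₀ := F.good

variable {F}

theorem Good.eventually {x : M} (h : F.Good x) : ∀ᶠ y in 𝓝 x, F.Good y := h.eventually_nhds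

theorem Good.along {g : G} (h : F.Good (𝒢.s g)) : ∀ᶠ a in 𝓝 g, F.Good (𝒢.s a) :=
  𝒢.contMDiff_s.continuous.continuousAt.eventually h.eventually

theorem Good.smooth {x : M} (h : F.Good x) (i : Fin F.r) :
    SmoothAlong 𝓘(ℝ, EM) 𝒢.one (F.e i) x := h.self_of_nhds.1 i

theorem Good.mem {x : M} (h : F.Good x) (i : Fin F.r) : F.e i x ∈ 𝔨.kf x := by
  rw [← h.self_of_nhds.2.2]
  exact Submodule.subset_span ⟨i, rfl⟩

variable (F)

open scoped Classical in
/-- The coefficients of a vector with respect to the frame at `x`: a chosen linear extension, to the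
whole model space, of the coefficients of vectors in the fibre. It is zero where the frame vectors
are linearly dependent. -/
def coef (x : M) : EG →ₗ[ℝ] (Fin F.r → ℝ) :=
  if h : LinearIndependent ℝ (fun i => F.e i x) then
    (LinearMap.exists_leftInverse_of_injective (Fintype.linearCombination ℝ (fun i => F.e i x))
      (LinearMap.ker_eq_bot.2 (linearIndependent_iff_injective_fintypeLinearCombination.1 h))).choose
  else 0

variable {F}

theorem Good.coef_sum {x : M} (h : F.Good x) (c : Fin F.r → ℝ) :
    F.coef x (∑ i, c i • F.e i x) = c := by
  have hli := h.self_of_nhds.2.1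
  unfold coef
  rw [dif_pos hli]
  have := (LinearMap.exists_leftInverse_of_injective
    (Fintype.linearCombination ℝ (fun i => F.e i x))
      (LinearMap.ker_eq_bot.2 (linearIndependent_iff_injective_fintypeLinearCombination.1 hli))).choose_spec
  have h2 := congrArg (fun L => L c) this
  simpa [Fintype.linearCombination_apply] using h2

theorem Good.sum_coef {x : M} (h : F.Good x) {a : EG} (ha : a ∈ 𝔨.kf x) :
    ∑ i, F.coef x a i • F.e i x = a := by
  rw [← h.self_of_nhds.2.2, Submodule.mem_span_range_iff_exists_fun] at ha
  obtain ⟨c, rfl⟩ := ha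
  rw [h.coef_sum]

theorem Good.ext {x : M} (h : F.Good x) {a b : EG} (ha : a ∈ 𝔨.kf x) (hb : b ∈ 𝔨.kf x)
    (hab : ∀ i, F.coef x a i = F.coef x b i) : a = b := by
  rw [← h.sum_coef ha, ← h.sum_coef hb]
  simp only [hab]

variable (𝓔 : EhresmannConnection 𝔨) (F)

/-- The components of the connection one-form with respect to the frame. -/
def form (i : Fin F.r) (g : G) : EG →ₗ[ℝ] ℝ :=
  LinearMap.proj i ∘ₗ F.coef (𝒢.s g) ∘ₗ 𝓔.al g

variable {F 𝓔}

theorem form_apply (i : Fin F.r) (g : G) (v : EG) :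
    F.form 𝓔 i g v = F.coef (𝒢.s g) (𝓔.al g v) i := rfl

open EhresmannConnection

theorem Good.sum_form {g : G} (h : F.Good (𝒢.s g)) (v : EG) :
    ∑ i, F.form 𝓔 i g v • F.e i (𝒢.s g) = 𝓔.al g v := h.sum_coef (al_mem g v)

theorem form_of_mem {g : G} {v : EG} (h : v ∈ 𝓔.Ef g) (i : Fin F.r) : F.form 𝓔 i g v = 0 := by
  rw [form_apply, al_of_mem h, map_zero]; rfl

theorem form_lT {g : G} {a : EG} (h : a ∈ 𝔨.kf (𝒢.s g)) (i : Fin F.r) :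
    F.form 𝓔 i g (𝒢.lT g a) = F.coef (𝒢.s g) a i := by
  rw [form_apply, al_lT h]

theorem Good.eventually_Dt {x : M} (h : F.Good x) (i : Fin F.r) :
    ∀ᶠ y in 𝓝 x, 𝒢.Dt (𝒢.one y) (F.e i y) = 0 := by
  filter_upwards [h.eventually] with y hy using Dt_kf (hy.mem i)

theorem Good.eventually_Ds {x : M} (h : F.Good x) (i : Fin F.r) :
    ∀ᶠ y in 𝓝 x, 𝒢.Ds (𝒢.one y) (F.e i y) = 0 := by
  filter_upwards [h.eventually] with y hy using Ds_kf (hy.mem i)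

theorem Good.smooth_lT {g : G} (h : F.Good (𝒢.s g)) (i : Fin F.r) :
    SmoothAlong 𝓘(ℝ, EG) (fun a => a) (fun a => 𝒢.lT a (F.e i (𝒢.s a))) g :=
  smoothAlong_lT (h.smooth i) (h.eventually_Dt i)

/-- The components of the connection one-form are smooth: they are coefficients with respect to the
smooth frame of `TG` formed by a frame of `E` and the left-invariant fields of a frame of `k`. -/
theorem Good.smoothOneForm {g : G} (h : F.Good (𝒢.s g)) (i : Fin F.r) :
    SmoothOneForm (F.form 𝓔 i) g := by
  intro X hX
  obtain ⟨r, Y, hYE⟩ := 𝓔.exists_frame_model g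
  have hE : ∀ᶠ a in 𝓝 g, ∃ c : Fin r → ℝ, ∑ j, c j • Y j a = 𝓔.hr a (X a) := by
    filter_upwards [hYE] with a ha
    have := hr_mem (𝓔 := 𝓔) a (X a)
    rwa [← ha.2.2, Submodule.mem_span_range_iff_exists_fun] at this
  let Z : Fin r ⊕ Fin F.r → G → EG :=
    Sum.elim Y (fun i a => 𝒢.lT a (F.e i (𝒢.s a)))
  -- The coefficients of the horizontal part; they matter only near `g`, where they exist.
  let c : G → Fin r → ℝ := fun a => Classical.epsilon fun c => ∑ j, c j • Y j a = 𝓔.hr a (X a)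
  let u : G → Fin r ⊕ Fin F.r → ℝ := fun a => Sum.elim (c a) (fun i => F.form 𝓔 i a (X a))
  have hZ : ∀ k, SmoothAlong 𝓘(ℝ, EG) (fun a => a) (Z k) g := by
    rintro (j | i)
    · exact hYE.self_of_nhds.1 j
    · exact h.smooth_lT i
  have hinj : ∀ {a b : EG}, a ∈ 𝔨.kf (𝒢.s g) → b ∈ 𝔨.kf (𝒢.s g) → 𝒢.lT g a = 𝒢.lT g b → a = b := by
    intro a b ha hb hab
    rw [← al_lT (𝓔 := 𝓔) ha, hab, al_lT hb]
  have hspan : Submodule.span ℝ (range fun i => 𝒢.lT g (F.e i (𝒢.s g))) =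
      (𝔨.kf (𝒢.s g)).map (𝒢.lT g) := by
    rw [← h.self_of_nhds.2.2, Submodule.map_span, ← range_comp]
    rfl
  have hcompl : IsCompl (𝓔.Ef g) ((𝔨.kf (𝒢.s g)).map (𝒢.lT g)) := 𝓔.isCompl g
  have hYg := hYE.self_of_nhds.2
  have hli : LinearIndependent ℝ (fun k => Z k g) := by
    rw [linearIndependent_sum]
    refine ⟨hYg.1, ?_, ?_⟩
    · refine LinearIndependent.map_injOn (v := fun i => F.e i (𝒢.s g)) h.self_of_nhds.2.1
        (𝒢.lT g) ?_
      rw [h.self_of_nhds.2.2]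
      intro a ha b hb hab
      exact hinj ha hb hab
    · have h1 : Submodule.span ℝ (range ((fun k => Z k g) ∘ Sum.inl)) = 𝓔.Ef g := hYg.2
      have h2 : Submodule.span ℝ (range ((fun k => Z k g) ∘ Sum.inr)) =
        (𝔨.kf (𝒢.s g)).map (𝒢.lT g) := hspan
      rw [h1, h2]
      exact hcompl.disjoint
  have hsp : Submodule.span ℝ (range fun k => Z k g) = ⊤ := by
    have : (range fun k => Z k g) = (range fun j => Y j g) ∪
        range fun i => 𝒢.lT g (F.e i (𝒢.s g)) := by
      ext v
      simp [Z]
    rw [this, Submodule.span_union, hYg.2, hspan]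
    exact hcompl.sup_eq_top
  have hu : ∀ᶠ a in 𝓝 g, X a = ∑ k, u a k • Z k a := by
    filter_upwards [hE, h.along] with a ha ha'
    have h1 := Classical.epsilon_spec ha
    rw [Fintype.sum_sum_type]
    have h2 : ∑ i, u a (Sum.inr i) • Z (Sum.inr i) a = 𝒢.lT a (𝓔.al a (X a)) := by
      rw [← ha'.sum_form, map_sum]
      simp only [map_smul]
      rfl
    have h3 : ∑ j, u a (Sum.inl j) • Z (Sum.inl j) a = 𝓔.hr a (X a) := h1
    rw [h2, h3, hr_add_lT_al]
  exact smoothAlong_coeff hZ hX hli hsp hu (Sum.inr i)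

end LocalFrame

end Conn

section Differential

variable {EG : Type*} [NormedAddCommGroup EG] [NormedSpace ℝ EG] [FiniteDimensional ℝ EG]
  {G : Type*} [TopologicalSpace G] [ChartedSpace EG G] [IsManifold 𝓘(ℝ, EG) ∞ G]
  {EM : Type*} [NormedAddCommGroup EM] [NormedSpace ℝ EM] [FiniteDimensional ℝ EM]
  {M : Type*} [TopologicalSpace M] [ChartedSpace EM M] [IsManifold 𝓘(ℝ, EM) ∞ M]
  {𝒢 : LieGroupoid EG G EM M} {𝔨 : 𝒢.BundleOfIdeals} {𝓔 : EhresmannConnection 𝔨}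

open BundleOfIdeals EhresmannConnection LocalFrame

/-! ### Extension of vectors to sections and fields -/

/-- A vector in the fibre extends to a local section. -/
theorem LocalFrame.Good.exists_section {x₀ : M} {F : LocalFrame 𝔨 x₀} {x : M} (h : F.Good x)
    {a : EG} (ha : a ∈ 𝔨.kf x) :
    ∃ ξ : M → EG, (∀ᶠ y in 𝓝 x, SmoothAlong 𝓘(ℝ, EM) 𝒢.one ξ y) ∧
      (∀ᶠ y in 𝓝 x, ξ y ∈ 𝔨.kf y) ∧ ξ x = a := by
  refine ⟨fun y => ∑ i, F.coef x a i • F.e i y, ?_, ?_, h.sum_coef ha⟩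
  · filter_upwards [h.eventually] with y hy
    exact SmoothAlong.sum _ 𝒢.smooth_one.contMDiffAt
      fun i => (hy.smooth i).smul contMDiffAt_const
  · filter_upwards [h.eventually] with y hy
    exact Submodule.sum_mem _ fun i _ => Submodule.smul_mem _ _ (hy.mem i)

/-- A horizontal vector extends to a smooth horizontal field. -/
theorem EhresmannConnection.exists_field (𝓔 : EhresmannConnection 𝔨) {g : G} {v : EG}
    (hv : v ∈ 𝓔.Ef g) :
    ∃ Y : G → EG, (∀ᶠ a in 𝓝 g, SmoothAlong 𝓘(ℝ, EG) (fun a => a) Y a) ∧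
      (∀ᶠ a in 𝓝 g, Y a ∈ 𝓔.Ef a) ∧ Y g = v := by
  obtain ⟨r, Y, hY⟩ := 𝓔.exists_frame_model g
  rw [← hY.self_of_nhds.2.2, Submodule.mem_span_range_iff_exists_fun] at hv
  obtain ⟨c, hc⟩ := hv
  refine ⟨fun a => ∑ i, c i • Y i a, ?_, ?_, hc⟩
  · filter_upwards [hY] with a ha
    exact SmoothAlong.sum _ contMDiffAt_id fun i => (ha.1 i).smul contMDiffAt_const
  · filter_upwards [hY] with a ha
    rw [← ha.2.2]
    exact Submodule.sum_mem _ fun i _ =>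
      Submodule.smul_mem _ _ (Submodule.subset_span ⟨i, rfl⟩)

/-- The horizontal part of a smooth field is smooth. -/
theorem EhresmannConnection.smoothAlong_hr (𝓔 : EhresmannConnection 𝔨) {g : G} {X : G → EG}
    (hX : SmoothAlong 𝓘(ℝ, EG) (fun a => a) X g) :
    SmoothAlong 𝓘(ℝ, EG) (fun a => a) (fun a => 𝓔.hr a (X a)) g := by
  obtain ⟨F⟩ := nonempty_localFrame 𝔨 (𝒢.s g)
  have hF := F.good_self
  have h := hX.sub (SmoothAlong.sum Finset.univ contMDiffAt_id fun i =>
    (hF.smooth_lT i).smul (hF.smoothOneForm (𝓔 := 𝓔) i X hX))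
  refine h.congr (Eventually.of_forall fun _ => rfl) ?_
  filter_upwards [hF.along] with a ha
  have h1 : ∑ i, F.form 𝓔 i a (X a) • 𝒢.lT a (F.e i (𝒢.s a)) = 𝒢.lT a (𝓔.al a (X a)) := by
    rw [← ha.sum_form, map_sum]
    simp only [map_smul]
  rw [h1, eq_sub_iff_add_eq, hr_add_lT_al]

/-! ### The exterior derivative of the connection form and the multiplication -/

/-- The exterior derivatives of the components of the connection form are multiplicative on
composable pairs with horizontal first entry. This follows from the multiplicativity of the
connection form by pulling back along a two-parameter family of composable pairs. In general there
would be further terms, with derivatives of the coefficients of the conjugation action, but they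
contain values of the connection form on the first entries as factors. -/
theorem extD_mul {x₁ x₂ : M} {F₁ : LocalFrame 𝔨 x₁} {F₂ : LocalFrame 𝔨 x₂} {g₁ g₂ : G}
    (e : 𝒢.s g₁ = 𝒢.t g₂) (h₁ : F₁.Good (𝒢.s g₁)) (h₂ : F₂.Good (𝒢.s g₂)) {v₀ v₁ w₀ w₁ : EG}
    (hv₀ : v₀ ∈ 𝓔.Ef g₁) (hv₁ : v₁ ∈ 𝓔.Ef g₁) (c₀ : 𝒢.Ds g₁ v₀ = 𝒢.Dt g₂ w₀)
    (c₁ : 𝒢.Ds g₁ v₁ = 𝒢.Dt g₂ w₁) (i : Fin F₂.r) :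
    extD (F₂.form 𝓔 i) (𝒢.mul g₁ g₂) (𝒢.Dm g₁ g₂ v₀ w₀) (𝒢.Dm g₁ g₂ v₁ w₁) =
      extD (F₂.form 𝓔 i) g₂ w₀ w₁ +
      ∑ k, F₂.form 𝓔 i g₂ (𝒢.rT g₂ (F₁.e k (𝒢.t g₂))) * extD (F₁.form 𝓔 k) g₁ v₀ v₁ := by
  let L : EG → EG → (ℝ × ℝ →L[ℝ] EG) := fun v w =>
    (ContinuousLinearMap.fst ℝ ℝ ℝ).smulRight v + (ContinuousLinearMap.snd ℝ ℝ ℝ).smulRight w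
  obtain ⟨γ₁, γ₂, s1, s2, z1, z2, hc, d1, d2⟩ := exists_composable_pair e (L v₀ v₁) (L w₀ w₁)
    (fun w => by simp [L, c₀, c₁])
  subst z1 z2
  have hmul := 𝒢.contMDiffAt_mul s1 s2 hc
  let A : Fin F₁.r → G → ℝ := fun k b => F₂.form 𝓔 i b (𝒢.rT b (F₁.e k (𝒢.t b)))
  have h1' : F₁.Good (𝒢.t (γ₂ 0)) := by rwa [← e]
  have hA : ∀ k, DifferentiableAt ℝ (fun y => A k (γ₂ y)) 0 := by
    intro k
    have hA1 : ContMDiffAt 𝓘(ℝ, EG) 𝓘(ℝ, ℝ) ∞ (A k) (γ₂ 0) :=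
      h₂.smoothOneForm i _ (smoothAlong_rT (h1'.smooth k) (h1'.eventually_Ds k))
    exact ((ContMDiffAt.comp (I' := 𝓘(ℝ, EG)) 0 hA1 s2).mdifferentiableAt
      (by simp)).differentiableAt
  -- The pull-back of the form along the product splits near the origin.
  have hsplit : ∀ V : ℝ × ℝ, ∀ᶠ y in 𝓝 (0 : ℝ × ℝ),
      F₂.form 𝓔 i (𝒢.mul (γ₁ y) (γ₂ y)) (mder 𝓘(ℝ, ℝ × ℝ) 𝓘(ℝ, EG)
        (fun y => 𝒢.mul (γ₁ y) (γ₂ y)) y V) =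
      F₂.form 𝓔 i (γ₂ y) (mder 𝓘(ℝ, ℝ × ℝ) 𝓘(ℝ, EG) γ₂ y V) +
      ∑ k, F₁.form 𝓔 k (γ₁ y) (mder 𝓘(ℝ, ℝ × ℝ) 𝓘(ℝ, EG) γ₁ y V) * A k (γ₂ y) := by
    intro V
    filter_upwards [hc.eventually_nhds, s1.eventually_mdifferentiableAt,
      s2.eventually_mdifferentiableAt, s1.continuousAt.eventually h₁.along] with y hy m1 m2 hg
    have hcomp : 𝒢.Ds (γ₁ y) (mder 𝓘(ℝ, ℝ × ℝ) 𝓘(ℝ, EG) γ₁ y V) =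
        𝒢.Dt (γ₂ y) (mder 𝓘(ℝ, ℝ × ℝ) 𝓘(ℝ, EG) γ₂ y V) := by
      unfold Ds Dt
      rw [← mder_comp (𝒢.mdiff_s _) m1, ← mder_comp (𝒢.mdiff_t _) m2, mder_congr hy]
    have hyy := hy.self_of_nhds
    rw [𝒢.mder_mul m1 m2 hy, form_apply, al_Dm hyy hcomp, 𝒢.s_mul _ _ hyy, map_add, Pi.add_apply,
      ← form_apply, ← form_apply, ← hg.sum_form, map_sum, map_sum]
    simp only [map_smul, smul_eq_mul]
    rw [hyy]
  have hU := fun V : ℝ × ℝ => differentiableAt_const (c := V) (x := (0 : ℝ × ℝ)) (𝕜 := ℝ)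
  have hf1 : ∀ k, SmoothOneForm (F₁.form 𝓔 k) (γ₁ 0) := fun k => h₁.smoothOneForm k
  have hf2 : SmoothOneForm (F₂.form 𝓔 i) (γ₂ 0) := h₂.smoothOneForm i
  have hf3 : SmoothOneForm (F₂.form 𝓔 i) (𝒢.mul (γ₁ 0) (γ₂ 0)) := by
    refine Good.smoothOneForm ?_ i
    rwa [𝒢.s_mul _ _ e]
  have hvert : ∀ V : ℝ × ℝ, ∀ k, F₁.form 𝓔 k (γ₁ 0) (mder 𝓘(ℝ, ℝ × ℝ) 𝓘(ℝ, EG) γ₁ 0 V) = 0 := by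
    intro V k
    refine form_of_mem ?_ k
    rw [d1]
    exact Submodule.add_mem _ (Submodule.smul_mem _ _ hv₀) (Submodule.smul_mem _ _ hv₁)
  have hder : ∀ U V : ℝ × ℝ, fderiv ℝ (fun y => F₂.form 𝓔 i (𝒢.mul (γ₁ y) (γ₂ y))
      (mder 𝓘(ℝ, ℝ × ℝ) 𝓘(ℝ, EG) (fun y => 𝒢.mul (γ₁ y) (γ₂ y)) y V)) 0 U =
      fderiv ℝ (fun y => F₂.form 𝓔 i (γ₂ y) (mder 𝓘(ℝ, ℝ × ℝ) 𝓘(ℝ, EG) γ₂ y V)) 0 U +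
      ∑ k, A k (γ₂ 0) * fderiv ℝ (fun y => F₁.form 𝓔 k (γ₁ y)
        (mder 𝓘(ℝ, ℝ × ℝ) 𝓘(ℝ, EG) γ₁ y V)) 0 U := by
    intro U V
    have e1 := (hasFDerivAt_pullback s2 hf2 (hU V)).1.hasFDerivAt
    have e2 := fun k => (hasFDerivAt_pullback s1 (hf1 k) (hU V)).1.hasFDerivAt.mul
      (hA k).hasFDerivAt
    have e3 := e1.add (HasFDerivAt.fun_sum (u := Finset.univ) fun k _ => e2 k)
    have e4 := (e3.congr_of_eventuallyEq (hsplit V)).fderiv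
    rw [e4]
    simp [hvert]
  have hp := extD_pullback_normed hmul hf3 (hU (1, 0)) (hU (0, 1))
  have hp1 := fun k => extD_pullback_normed s1 (hf1 k) (hU (1, 0)) (hU (0, 1))
  have hp2 := extD_pullback_normed s2 hf2 (hU (1, 0)) (hU (0, 1))
  have hbr : VectorField.lieBracket (E := ℝ × ℝ) ℝ (fun _ => (1, 0)) (fun _ => (0, 1)) 0 = 0 := by
    simp [VectorField.lieBracket]
  have hm := fun V => 𝒢.mder_mul (s1.mdifferentiableAt (by simp)) (s2.mdifferentiableAt (by simp))
    hc V
  rw [hder, hder, hbr, map_zero, map_zero, sub_zero, hm, hm, d1, d2, d1, d2] at hp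
  rw [hbr, map_zero, map_zero, sub_zero, d2, d2] at hp2
  simp only [hbr, map_zero, sub_zero, d1] at hp1
  have l1 : ∀ v w, L v w (1, 0) = v := fun v w => by simp [L]
  have l2 : ∀ v w, L v w (0, 1) = w := fun v w => by simp [L]
  simp only [l1, l2] at hp hp1 hp2
  rw [hp, hp2]
  simp only [hp1, mul_sub, Finset.sum_sub_distrib]
  ring

variable (𝓔) in
/-- On a horizontal and a left-translated vector, the exterior derivative of the connection form is
determined by its values at the units: a horizontal vector is its product with a unit vector, and a
left translate is the product of the zero vector with the vector that is translated. -/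
theorem extD_lT {x₀ : M} {F : LocalFrame 𝔨 x₀} {g : G} (h : F.Good (𝒢.s g)) {v a : EG}
    (hv : v ∈ 𝓔.Ef g) (ha : 𝒢.Dt (𝒢.one (𝒢.s g)) a = 0) (i : Fin F.r) :
    extD (F.form 𝓔 i) g v (𝒢.lT g a) =
      extD (F.form 𝓔 i) (𝒢.one (𝒢.s g)) (𝒢.Done (𝒢.s g) (𝒢.Ds g v)) a := by
  have h' : F.Good (𝒢.s (𝒢.one (𝒢.s g))) := by rwa [𝒢.s_one]
  have := extD_mul (𝓔 := 𝓔) (𝒢.t_one (𝒢.s g)).symm h h' hv (Submodule.zero_mem _)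
    (w₀ := 𝒢.Done (𝒢.s g) (𝒢.Ds g v)) (w₁ := a) (Dt_Done _ _).symm (by rw [map_zero, ha]) i
  rw [Dm_Done_right, 𝒢.mul_one, ← lT_apply] at this
  rw [this]
  have h0 : ∀ k, extD (F.form 𝓔 k) g v 0 = 0 := by
    intro k
    have := extD_smul_left (F.form 𝓔 k) g 0 0 v
    rw [extD_swap, zero_smul, zero_mul] at this
    simpa using this
  simp [h0]

variable (𝓔) in
/-- On two left-translated vectors, the exterior derivative of the connection form is determined by
its values at the units. -/
theorem extD_lT_lT {x₀ : M} {F : LocalFrame 𝔨 x₀} {g : G} (h : F.Good (𝒢.s g)) {a b : EG}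
    (ha : 𝒢.Dt (𝒢.one (𝒢.s g)) a = 0) (hb : 𝒢.Dt (𝒢.one (𝒢.s g)) b = 0) (i : Fin F.r) :
    extD (F.form 𝓔 i) g (𝒢.lT g a) (𝒢.lT g b) = extD (F.form 𝓔 i) (𝒢.one (𝒢.s g)) a b := by
  have h' : F.Good (𝒢.s (𝒢.one (𝒢.s g))) := by rwa [𝒢.s_one]
  have := extD_mul (𝓔 := 𝓔) (𝒢.t_one (𝒢.s g)).symm h h' (Submodule.zero_mem _)
    (Submodule.zero_mem _) (w₀ := a) (w₁ := b) (by rw [map_zero, ha]) (by rw [map_zero, hb]) i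
  rw [𝒢.mul_one, ← lT_apply, ← lT_apply] at this
  rw [this]
  have h0 : ∀ k, extD (F.form 𝓔 k) g 0 0 = 0 := by
    intro k
    have := extD_smul_left (F.form 𝓔 k) g 0 0 0
    simpa using this
  simp [h0]

/-! ### Brackets of sections of the bundle of ideals -/

/-- The exterior derivative of a one-form vanishing on the vertical distribution vanishes on pairs
of vertical vectors at a unit: both vectors are tangent to a surface obtained by multiplying a curve
with curves in the fibres of the target map, and the coordinate directions of this surface are
right and left translates of vertical vectors along the coordinate axes. -/
theorem extD_vertical {θ : G → EG →ₗ[ℝ] ℝ} {x : M} (hθ : SmoothOneForm θ (𝒢.one x))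
    (hker : ∀ g, ∀ a ∈ 𝔨.kf (𝒢.s g), θ g (𝒢.lT g a) = 0) {a b : EG} (ha : a ∈ 𝔨.kf x)
    (hb : b ∈ 𝔨.kf x) : extD θ (𝒢.one x) a b = 0 := by
  obtain ⟨F⟩ := nonempty_localFrame 𝔨 x
  obtain ⟨ξ, hξ, hξk, hξx⟩ := F.good_self.exists_section hb
  have hξt : ∀ᶠ y in 𝓝 x, 𝒢.Dt (𝒢.one y) (ξ y) = 0 := hξk.mono fun y hy => Dt_kf hy
  obtain ⟨c, hc, hct, hcx⟩ := (𝒢.submersion_t.isSubmersionAt (𝒢.one x)).exists_curves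
    (σ := 𝒢.one) 𝒢.t_one hξ.self_of_nhds hξt
  obtain ⟨γ, -, hγ, -, hγ0, -, -, hγd, -⟩ := exists_composable_pair
    (𝒢 := 𝒢) (g₁ := 𝒢.one x) (g₂ := 𝒢.one x) (by rw [𝒢.s_one, 𝒢.t_one]) (lineMap a)
    (0 : ℝ →L[ℝ] EG) (fun w => by simp [lineMap, Ds_kf ha])
  have hsγ0 : 𝒢.s (γ 0) = x := by rw [hγ0, 𝒢.s_one]
  have hfst : ContMDiffAt 𝓘(ℝ, ℝ × ℝ) 𝓘(ℝ, ℝ) ∞ (fun p : ℝ × ℝ => p.1) 0 :=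
    contDiff_fst.contMDiff.contMDiffAt
  have hsnd : ContMDiffAt 𝓘(ℝ, ℝ × ℝ) 𝓘(ℝ, ℝ) ∞ (fun p : ℝ × ℝ => p.2) 0 :=
    contDiff_snd.contMDiff.contMDiffAt
  let γ₁ : ℝ × ℝ → G := fun p => γ p.1
  let β : ℝ × ℝ → M := fun p => 𝒢.s (γ p.1)
  let γ₂ : ℝ × ℝ → G := fun p => c (β p, p.2)
  have s1 : ContMDiffAt 𝓘(ℝ, ℝ × ℝ) 𝓘(ℝ, EG) ∞ γ₁ 0 :=
    ContMDiffAt.comp (I' := 𝓘(ℝ, ℝ)) (0 : ℝ × ℝ) hγ hfst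
  have sβ : ContMDiffAt 𝓘(ℝ, ℝ × ℝ) 𝓘(ℝ, EM) ∞ β 0 :=
    ContMDiffAt.comp (I' := 𝓘(ℝ, EG)) (0 : ℝ × ℝ) 𝒢.contMDiff_s.contMDiffAt s1
  have hb0 : (β 0, (0 : ℝ × ℝ).2) = (x, (0 : ℝ)) := by simp [β, hsγ0]
  have s2 : ContMDiffAt 𝓘(ℝ, ℝ × ℝ) 𝓘(ℝ, EG) ∞ γ₂ 0 :=
    ContMDiffAt.comp_of_eq hc (sβ.prodMk hsnd) hb0
  have hbc : Tendsto (fun p : ℝ × ℝ => (β p, p.2)) (𝓝 0) (𝓝 (x, 0)) := by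
    have := (sβ.prodMk hsnd).continuousAt
    simpa only [ContinuousAt, hb0] using this
  have hcomp : ∀ᶠ p in 𝓝 (0 : ℝ × ℝ), 𝒢.s (γ₁ p) = 𝒢.t (γ₂ p) := by
    filter_upwards [hbc.eventually hct] with p hp using hp.symm
  have hmul := 𝒢.contMDiffAt_mul s1 s2 hcomp
  have hγ20 : γ₂ 0 = 𝒢.one x := by
    change c (β 0, (0 : ℝ × ℝ).2) = _
    rw [hb0, hcx.self_of_nhds.1]
  have hf0 : 𝒢.mul (γ₁ 0) (γ₂ 0) = 𝒢.one x := by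
    have h1 : γ₁ 0 = 𝒢.one x := hγ0
    have := 𝒢.one_mul (𝒢.one x)
    rw [𝒢.t_one] at this
    rw [h1, hγ20, this]
  -- The derivatives of the two factors, near the origin.
  have hder : ∀ᶠ p in 𝓝 (0 : ℝ × ℝ), ∀ V : ℝ × ℝ,
      mder 𝓘(ℝ, ℝ × ℝ) 𝓘(ℝ, EG) (fun p => 𝒢.mul (γ₁ p) (γ₂ p)) p V =
      𝒢.Dm (γ₁ p) (γ₂ p) (mder 𝓘(ℝ, ℝ) 𝓘(ℝ, EG) γ p.1 V.1)
        (mder (𝓘(ℝ, EM).prod 𝓘(ℝ, ℝ)) 𝓘(ℝ, EG) c (β p, p.2)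
          (𝒢.Ds (γ p.1) (mder 𝓘(ℝ, ℝ) 𝓘(ℝ, EG) γ p.1 V.1), V.2)) := by
    have hγm : ∀ᶠ p in 𝓝 (0 : ℝ × ℝ), MDifferentiableAt 𝓘(ℝ, ℝ) 𝓘(ℝ, EG) γ p.1 :=
      hfst.continuousAt.eventually hγ.eventually_mdifferentiableAt
    filter_upwards [hcomp.eventually_nhds, hγm, hbc.eventually hc.eventually_mdifferentiableAt,
      s1.eventually_mdifferentiableAt, sβ.eventually_mdifferentiableAt,
      s2.eventually_mdifferentiableAt] with p h1 h2 h3 h4 h5 h6 V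
    have hf : MDifferentiableAt 𝓘(ℝ, ℝ × ℝ) 𝓘(ℝ, ℝ) (fun p : ℝ × ℝ => p.1) p :=
      differentiableAt_fst.mdifferentiableAt
    have hs : MDifferentiableAt 𝓘(ℝ, ℝ × ℝ) 𝓘(ℝ, ℝ) (fun p : ℝ × ℝ => p.2) p :=
      differentiableAt_snd.mdifferentiableAt
    have e1 : mder 𝓘(ℝ, ℝ × ℝ) 𝓘(ℝ, ℝ) (fun p : ℝ × ℝ => p.1) p V = V.1 :=
      congrArg (fun L : ℝ × ℝ →L[ℝ] ℝ => L V)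
        (mder_of_hasMFDerivAt (hasFDerivAt_fst (𝕜 := ℝ) (p := p)).hasMFDerivAt)
    have e2 : mder 𝓘(ℝ, ℝ × ℝ) 𝓘(ℝ, ℝ) (fun p : ℝ × ℝ => p.2) p V = V.2 :=
      congrArg (fun L : ℝ × ℝ →L[ℝ] ℝ => L V)
        (mder_of_hasMFDerivAt (hasFDerivAt_snd (𝕜 := ℝ) (p := p)).hasMFDerivAt)
    have e3 : mder 𝓘(ℝ, ℝ × ℝ) 𝓘(ℝ, EG) γ₁ p V = mder 𝓘(ℝ, ℝ) 𝓘(ℝ, EG) γ p.1 V.1 := by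
      rw [← e1]
      exact mder_comp (I' := 𝓘(ℝ, ℝ)) h2 hf V
    have e4 : mder 𝓘(ℝ, ℝ × ℝ) 𝓘(ℝ, EM) β p V =
        𝒢.Ds (γ p.1) (mder 𝓘(ℝ, ℝ) 𝓘(ℝ, EG) γ p.1 V.1) := by
      rw [← e3]
      exact mder_comp (I' := 𝓘(ℝ, EG)) (𝒢.mdiff_s _) h4 V
    have e5 : mder 𝓘(ℝ, ℝ × ℝ) 𝓘(ℝ, EG) γ₂ p V =
        mder (𝓘(ℝ, EM).prod 𝓘(ℝ, ℝ)) 𝓘(ℝ, EG) c (β p, p.2)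
          (𝒢.Ds (γ p.1) (mder 𝓘(ℝ, ℝ) 𝓘(ℝ, EG) γ p.1 V.1), V.2) := by
      have := mder_comp (I' := 𝓘(ℝ, EM).prod 𝓘(ℝ, ℝ)) (f := fun p : ℝ × ℝ => (β p, p.2)) h3
        (h5.prodMk hs) V
      rw [mder_prodMk h5 hs, e4, e2] at this
      exact this
    rw [𝒢.mder_mul h4 h6 h1, e3, e5]
  have hγa : mder 𝓘(ℝ, ℝ) 𝓘(ℝ, EG) γ 0 1 = a := by rw [hγd]; simp [lineMap]
  let l₁ : ℝ → ℝ × ℝ := fun u => (u, 0)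
  let l₂ : ℝ → ℝ × ℝ := fun v => (0, v)
  have hl₁ : Tendsto l₁ (𝓝 0) (𝓝 0) :=
    (show Continuous l₁ by fun_prop).tendsto' _ _ rfl
  have hl₂ : Tendsto l₂ (𝓝 0) (𝓝 0) :=
    (show Continuous l₂ by fun_prop).tendsto' _ _ rfl
  -- Along the first axis the second coordinate direction is left-invariant.
  have hax1 : ∀ᶠ u in 𝓝 (0 : ℝ), θ (𝒢.mul (γ₁ (l₁ u)) (γ₂ (l₁ u)))
      (mder 𝓘(ℝ, ℝ × ℝ) 𝓘(ℝ, EG) (fun p => 𝒢.mul (γ₁ p) (γ₂ p)) (l₁ u) (0, 1)) = 0 := by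
    have hβ1 : Tendsto (fun u => β (l₁ u)) (𝓝 0) (𝓝 x) := by
      have := sβ.continuousAt.tendsto.comp hl₁
      have h0 : β 0 = x := hsγ0
      rwa [h0] at this
    filter_upwards [hl₁.eventually hder, hβ1.eventually hcx, hβ1.eventually hξk] with u h1 h2 h3
    have e1 : γ₂ (l₁ u) = 𝒢.one (𝒢.s (γ₁ (l₁ u))) := h2.1
    rw [h1]
    simp only [map_zero]
    have e2 : mder (𝓘(ℝ, EM).prod 𝓘(ℝ, ℝ)) 𝓘(ℝ, EG) c (β (l₁ u), (l₁ u).2) (0, 1) =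
      ξ (β (l₁ u)) := h2.2
    rw [e2, e1, 𝒢.mul_one, ← lT_apply]
    exact hker _ _ h3
  -- Along the second axis the first coordinate direction is right-invariant.
  have hax2 : ∀ᶠ v in 𝓝 (0 : ℝ), θ (𝒢.mul (γ₁ (l₂ v)) (γ₂ (l₂ v)))
      (mder 𝓘(ℝ, ℝ × ℝ) 𝓘(ℝ, EG) (fun p => 𝒢.mul (γ₁ p) (γ₂ p)) (l₂ v) (1, 0)) = 0 := by
    filter_upwards [hl₂.eventually hder, hl₂.eventually hcomp] with v h1 h2
    have e0 : γ₁ (l₂ v) = 𝒢.one x := hγ0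
    have e1 : 𝒢.t (γ₂ (l₂ v)) = x := by rw [← h2, e0, 𝒢.s_one]
    have e2 : mder 𝓘(ℝ, ℝ) 𝓘(ℝ, EG) γ (l₂ v).1 1 = a := hγa
    have e3 : 𝒢.Ds (γ (l₂ v).1) a = 0 := by
      have : γ (l₂ v).1 = 𝒢.one x := hγ0
      rw [this, Ds_kf ha]
    rw [h1]
    simp only [e2, e3]
    have e4 : mder (𝓘(ℝ, EM).prod 𝓘(ℝ, ℝ)) 𝓘(ℝ, EG) c (β (l₂ v), (l₂ v).2) (0, 0) = 0 :=
      map_zero _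
    have ha' : a ∈ 𝔨.kf (𝒢.t (γ₂ (l₂ v))) := by rwa [e1]
    have e5 : γ₁ (l₂ v) = 𝒢.one (𝒢.t (γ₂ (l₂ v))) := by rw [e1, e0]
    rw [e4, e5, 𝒢.one_mul, ← rT_apply, ← lT_lI_rT ha']
    exact hker _ _ (lI_rT_mem ha')
  have hU := fun V : ℝ × ℝ => differentiableAt_const (c := V) (x := (0 : ℝ × ℝ)) (𝕜 := ℝ)
  have hθ' : SmoothOneForm θ (𝒢.mul (γ₁ 0) (γ₂ 0)) := by rwa [hf0]
  have hp := extD_pullback_normed hmul hθ' (hU (1, 0)) (hU (0, 1))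
  have hbr : VectorField.lieBracket (E := ℝ × ℝ) ℝ (fun _ => (1, 0)) (fun _ => (0, 1)) 0 = 0 := by
    simp [VectorField.lieBracket]
  have hlin : ∀ (h : ℝ × ℝ → ℝ) (l : ℝ → ℝ × ℝ) (w : ℝ × ℝ), DifferentiableAt ℝ h 0 → l 0 = 0 →
      HasDerivAt l w 0 → (∀ᶠ u in 𝓝 (0 : ℝ), h (l u) = 0) → fderiv ℝ h 0 w = 0 := by
    intro h l w hh hl hlw hz
    have h1 := (hl ▸ hh.hasFDerivAt : HasFDerivAt h (fderiv ℝ h 0) (l 0)).comp_hasDerivAt 0 hlw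
    have h2 : HasDerivAt (h ∘ l) 0 0 := (hasDerivAt_const (0 : ℝ) (0 : ℝ)).congr_of_eventuallyEq hz
    exact h1.unique h2
  have hd1 := hlin _ l₁ (1, 0) (hasFDerivAt_pullback hmul hθ' (hU (0, 1))).1 rfl
    ((hasDerivAt_id 0).prodMk (hasDerivAt_const 0 0)) hax1
  have hd2 := hlin _ l₂ (0, 1) (hasFDerivAt_pullback hmul hθ' (hU (1, 0))).1 rfl
    ((hasDerivAt_const 0 0).prodMk (hasDerivAt_id 0)) hax2
  have e1 : mder 𝓘(ℝ, ℝ × ℝ) 𝓘(ℝ, EG) (fun p => 𝒢.mul (γ₁ p) (γ₂ p)) 0 (1, 0) = a := by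
    rw [hder.self_of_nhds]
    have h1 : mder 𝓘(ℝ, ℝ) 𝓘(ℝ, EG) γ (0 : ℝ × ℝ).1 1 = a := hγa
    have h2 : γ (0 : ℝ × ℝ).1 = 𝒢.one x := hγ0
    have h3 : mder (𝓘(ℝ, EM).prod 𝓘(ℝ, ℝ)) 𝓘(ℝ, EG) c (β 0, (0 : ℝ × ℝ).2) (0, 0) = 0 :=
      map_zero _
    have h4 := Dm_zero_one (𝒢 := 𝒢) (Ds_kf ha)
    have h5 : γ₁ 0 = 𝒢.one x := hγ0
    rw [𝒢.s_one] at h4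
    simp only [h1, h2, Ds_kf ha]
    rw [h3, h5, hγ20, h4]
  have e2 : mder 𝓘(ℝ, ℝ × ℝ) 𝓘(ℝ, EG) (fun p => 𝒢.mul (γ₁ p) (γ₂ p)) 0 (0, 1) = b := by
    rw [hder.self_of_nhds]
    have h3 : mder (𝓘(ℝ, EM).prod 𝓘(ℝ, ℝ)) 𝓘(ℝ, EG) c (β 0, (0 : ℝ × ℝ).2) (0, 1) = b := by
      rw [hb0, hcx.self_of_nhds.2, hξx]
    have h4 := Dm_one_zero (𝒢 := 𝒢) (Dt_kf hb)
    have h5 : γ₁ 0 = 𝒢.one x := hγ0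
    rw [𝒢.t_one] at h4
    simp only [map_zero]
    rw [h3, h5, hγ20, h4]
  rw [hd1, hd2, hbr, map_zero, map_zero, e1, e2, hf0] at hp
  simpa using hp

/-- The bracket of left-invariant fields of sections of the bundle of ideals is vertical at the
units. -/
theorem lieBr_leftInv_mem (𝓔 : EhresmannConnection 𝔨) {x : M} {ξ η : M → EG}
    (hξ : SmoothAlong 𝓘(ℝ, EM) 𝒢.one ξ x) (hξk : ∀ᶠ y in 𝓝 x, ξ y ∈ 𝔨.kf y)
    (hη : SmoothAlong 𝓘(ℝ, EM) 𝒢.one η x) (hηk : ∀ᶠ y in 𝓝 x, η y ∈ 𝔨.kf y) :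
    lieBr (fun g => 𝒢.lT g (ξ (𝒢.s g))) (fun g => 𝒢.lT g (η (𝒢.s g))) (𝒢.one x) ∈ 𝔨.kf x := by
  set W := lieBr (fun g => 𝒢.lT g (ξ (𝒢.s g))) (fun g => 𝒢.lT g (η (𝒢.s g))) (𝒢.one x) with hW
  have hs : ContinuousAt 𝒢.s (𝒢.one x) := 𝒢.contMDiff_s.continuous.continuousAt
  have hsx : ∀ {p : M → Prop}, (∀ᶠ y in 𝓝 x, p y) → ∀ᶠ g in 𝓝 (𝒢.one x), p (𝒢.s g) := by
    intro p hp
    rw [← 𝒢.s_one x] at hp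
    exact hs.eventually hp
  have hS : ∀ {ξ : M → EG}, SmoothAlong 𝓘(ℝ, EM) 𝒢.one ξ x → (∀ᶠ y in 𝓝 x, ξ y ∈ 𝔨.kf y) →
      SmoothAlong 𝓘(ℝ, EG) (fun a => a) (fun g => 𝒢.lT g (ξ (𝒢.s g))) (𝒢.one x) := by
    intro ξ h1 h2
    refine smoothAlong_lT (by rwa [𝒢.s_one]) ?_
    rw [𝒢.s_one]
    exact h2.mono fun y hy => Dt_kf hy
  -- A one-form composed with the horizontal projection vanishes on vertical vectors, so that by
  -- the Koszul formula and `extD_vertical` it vanishes on the bracket.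
  have hhr : 𝓔.hr (𝒢.one x) W = 0 := by
    refine (Module.finBasis ℝ EG).ext_elem fun i => ?_
    obtain ⟨θ, hθ, hθv⟩ := exists_smoothOneForm (𝒢.one x) ((Module.finBasis ℝ EG).coord i)
    let τ : G → EG →ₗ[ℝ] ℝ := fun g => θ g ∘ₗ 𝓔.hr g
    have hτ : SmoothOneForm τ (𝒢.one x) := fun X hX => hθ _ (𝓔.smoothAlong_hr hX)
    have hker : ∀ g, ∀ a ∈ 𝔨.kf (𝒢.s g), τ g (𝒢.lT g a) = 0 := by
      intro g a ha
      change θ g (𝓔.hr g (𝒢.lT g a)) = 0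
      rw [hr_lT ha, map_zero]
    have h1 := extD_apply hτ (hS hξ hξk) (hS hη hηk)
    have hz : ∀ {ξ : M → EG}, (∀ᶠ y in 𝓝 x, ξ y ∈ 𝔨.kf y) → ∀ v,
        mder 𝓘(ℝ, EG) 𝓘(ℝ, ℝ) (fun p => τ p (𝒢.lT p (ξ (𝒢.s p)))) (𝒢.one x) v = 0 := by
      intro ξ hξ v
      rw [mder_congr (f' := fun _ => 0)]
      · exact mder_const _ _ _
      · filter_upwards [hsx hξ] with p hp using hker p _ hp
    have hm : ∀ {ξ : M → EG}, (∀ᶠ y in 𝓝 x, ξ y ∈ 𝔨.kf y) →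
        𝒢.lT (𝒢.one x) (ξ (𝒢.s (𝒢.one x))) ∈ 𝔨.kf x := by
      intro ξ hξ
      rw [𝒢.s_one, lT_one (Dt_kf hξ.self_of_nhds)]
      exact hξ.self_of_nhds
    rw [hz hξk, hz hηk, extD_vertical hτ hker (hm hξk) (hm hηk), ← hW] at h1
    have h2 : θ (𝒢.one x) (𝓔.hr (𝒢.one x) W) = 0 := by
      change τ (𝒢.one x) W = 0
      linarith
    rw [hθv] at h2
    simpa using h2
  have h := hr_add_lT_al (𝓔 := 𝓔) (𝒢.one x) W
  have hm := al_mem (𝓔 := 𝓔) (𝒢.one x) W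
  rw [𝒢.s_one] at hm
  rw [hhr, zero_add, lT_one (Dt_kf hm)] at h
  rwa [h] at hm

end Differential

section Formulas

variable {EG : Type*} [NormedAddCommGroup EG] [NormedSpace ℝ EG] [FiniteDimensional ℝ EG]
  {G : Type*} [TopologicalSpace G] [ChartedSpace EG G] [IsManifold 𝓘(ℝ, EG) ∞ G]
  {EM : Type*} [NormedAddCommGroup EM] [NormedSpace ℝ EM] [FiniteDimensional ℝ EM]
  {M : Type*} [TopologicalSpace M] [ChartedSpace EM M] [IsManifold 𝓘(ℝ, EM) ∞ M]
  {𝒢 : LieGroupoid EG G EM M} {𝔨 : 𝒢.BundleOfIdeals} {𝓔 : EhresmannConnection 𝔨}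

open BundleOfIdeals EhresmannConnection LocalFrame

/-! ### The induced connections and the bracket in a local frame -/

variable {x₀ : M} {F : LocalFrame 𝔨 x₀}

/-- Properties of the points near `x` hold for the sources of the elements near the unit. -/
theorem eventually_s_one {x : M} {p : M → Prop} (hp : ∀ᶠ y in 𝓝 x, p y) :
    ∀ᶠ g in 𝓝 (𝒢.one x), p (𝒢.s g) := by
  rw [← 𝒢.s_one x] at hp
  exact 𝒢.contMDiff_s.continuous.continuousAt.eventually hp

theorem smoothAlong_lT_one {x : M} {ξ : M → EG} (hξ : SmoothAlong 𝓘(ℝ, EM) 𝒢.one ξ x)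
    (hξt : ∀ᶠ y in 𝓝 x, 𝒢.Dt (𝒢.one y) (ξ y) = 0) :
    SmoothAlong 𝓘(ℝ, EG) (fun a => a) (fun g => 𝒢.lT g (ξ (𝒢.s g))) (𝒢.one x) :=
  smoothAlong_lT (by rwa [𝒢.s_one]) (by rwa [𝒢.s_one])

theorem LocalFrame.Good.smoothOneForm_one (𝓔 : EhresmannConnection 𝔨) {x : M} (h : F.Good x)
    (i : Fin F.r) : SmoothOneForm (F.form 𝓔 i) (𝒢.one x) :=
  Good.smoothOneForm (by rwa [𝒢.s_one]) i

/-- The components of a smooth section are smooth: they are the restrictions to the units of the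
components of the connection form, evaluated on the left-invariant field of the section. -/
theorem LocalFrame.Good.contMDiffAt_coef (𝓔 : EhresmannConnection 𝔨) {x : M} (h : F.Good x)
    {ξ : M → EG} (hξ : SmoothAlong 𝓘(ℝ, EM) 𝒢.one ξ x) (hξk : ∀ᶠ y in 𝓝 x, ξ y ∈ 𝔨.kf y) (i : Fin F.r) :
    ContMDiffAt 𝓘(ℝ, EM) 𝓘(ℝ, ℝ) ∞ (fun y => F.coef y (ξ y) i) x := by
  have h1 := h.smoothOneForm_one 𝓔 i _ (smoothAlong_lT_one hξ (hξk.mono fun y hy => Dt_kf hy))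
  have h2 := ContMDiffAt.comp (I' := 𝓘(ℝ, EG)) x h1 𝒢.smooth_one.contMDiffAt
  refine h2.congr_of_eventuallyEq ?_
  filter_upwards [hξk] with y hy
  have hy' : ξ (𝒢.s (𝒢.one y)) ∈ 𝔨.kf (𝒢.s (𝒢.one y)) := by rwa [𝒢.s_one]
  change _ = F.form 𝓔 i (𝒢.one y) (𝒢.lT (𝒢.one y) (ξ (𝒢.s (𝒢.one y))))
  rw [form_lT hy', 𝒢.s_one]

/-- The derivative of the components of a left-invariant field. -/
theorem mder_form_leftInv {x : M} (h : F.Good x) {ξ : M → EG}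
    (hξ : SmoothAlong 𝓘(ℝ, EM) 𝒢.one ξ x) (hξk : ∀ᶠ y in 𝓝 x, ξ y ∈ 𝔨.kf y) (i : Fin F.r) (v : EG) :
    mder 𝓘(ℝ, EG) 𝓘(ℝ, ℝ) (fun g => F.form 𝓔 i g (𝒢.lT g (ξ (𝒢.s g)))) (𝒢.one x) v =
      mder 𝓘(ℝ, EM) 𝓘(ℝ, ℝ) (fun y => F.coef y (ξ y) i) x (𝒢.Ds (𝒢.one x) v) := by
  have hc := (h.contMDiffAt_coef 𝓔 hξ hξk i).mdifferentiableAt (by simp)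
  have h1 := mder_comp (g := fun y => F.coef y (ξ y) i) (by rwa [𝒢.s_one]) (𝒢.mdiff_s (𝒢.one x)) v
  rw [𝒢.s_one] at h1
  rw [mder_congr (f' := fun g => F.coef (𝒢.s g) (ξ (𝒢.s g)) i)]
  · exact h1
  · filter_upwards [eventually_s_one hξk] with g hg using form_lT hg i

theorem lT_one_section {x : M} {ξ : M → EG} (hξk : ∀ᶠ y in 𝓝 x, ξ y ∈ 𝔨.kf y) :
    𝒢.lT (𝒢.one x) (ξ (𝒢.s (𝒢.one x))) = ξ x := by
  rw [𝒢.s_one, lT_one (Dt_kf hξk.self_of_nhds)]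

/-- The vertical part of the bracket of a horizontal field with a left-invariant field. -/
theorem form_lieBr_leftInv {x : M} (h : F.Good x) {ξ : M → EG}
    (hξ : SmoothAlong 𝓘(ℝ, EM) 𝒢.one ξ x) (hξk : ∀ᶠ y in 𝓝 x, ξ y ∈ 𝔨.kf y) {Y : G → EG}
    (hY : SmoothAlong 𝓘(ℝ, EG) (fun a => a) Y (𝒢.one x)) (hYE : ∀ᶠ a in 𝓝 (𝒢.one x), Y a ∈ 𝓔.Ef a)
    (i : Fin F.r) :
    F.form 𝓔 i (𝒢.one x) (lieBr Y (fun g => 𝒢.lT g (ξ (𝒢.s g))) (𝒢.one x)) =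
      mder 𝓘(ℝ, EM) 𝓘(ℝ, ℝ) (fun y => F.coef y (ξ y) i) x (𝒢.Ds (𝒢.one x) (Y (𝒢.one x)))
      - extD (F.form 𝓔 i) (𝒢.one x) (Y (𝒢.one x)) (ξ x) := by
  have h1 := extD_apply (h.smoothOneForm_one 𝓔 i) hY
    (smoothAlong_lT_one hξ (hξk.mono fun y hy => Dt_kf hy))
  rw [mder_form_leftInv h hξ hξk, lT_one_section hξk, mder_congr (f' := fun _ => (0 : ℝ))
    (hYE.mono fun a ha => form_of_mem ha i), mder_const] at h1
  linarith

theorem form_one {x : M} {a : EG} (ha : a ∈ 𝔨.kf x) (i : Fin F.r) :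
    F.form 𝓔 i (𝒢.one x) a = F.coef x a i := by
  rw [form_apply, al_one ha, 𝒢.s_one]

theorem al_one_mem (𝓔 : EhresmannConnection 𝔨) (x : M) (v : EG) : 𝓔.al (𝒢.one x) v ∈ 𝔨.kf x := by
  have := al_mem (𝓔 := 𝓔) (𝒢.one x) v
  rwa [𝒢.s_one] at this

/-- The components of the covariant derivative: the connection coefficients are the values, at the
units, of the exterior derivative of the connection form. -/
theorem coef_nabla {x : M} (h : F.Good x) {ξ : M → EG}
    (hξ : SmoothAlong 𝓘(ℝ, EM) 𝒢.one ξ x) (hξk : ∀ᶠ y in 𝓝 x, ξ y ∈ 𝔨.kf y) (v : EM) :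
    (𝓔.nabla ξ x v : EG) ∈ 𝔨.kf x ∧ ∀ i, F.coef x (𝓔.nabla ξ x v) i =
      mder 𝓘(ℝ, EM) 𝓘(ℝ, ℝ) (fun y => F.coef y (ξ y) i) x v
      - extD (F.form 𝓔 i) (𝒢.one x) (𝒢.Done x v) (ξ x) := by
  have hex : ∃ Y, 𝓔.HorizontalNear Y (𝒢.one x) ∧ Y (𝒢.one x) = 𝒢.done x v := by
    obtain ⟨Y, h1, h2, h3⟩ := 𝓔.exists_field (g := 𝒢.one x) (v := 𝒢.Done x v) (𝓔.one_mem x v)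
    exact ⟨Y, ⟨h1, h2⟩, h3⟩
  -- The field chosen in the definition of the connection; the result does not depend on it.
  let Y : G → EG := hex.choose
  obtain ⟨⟨h1, h2⟩, h3⟩ := hex.choose_spec
  have h1' : SmoothAlong 𝓘(ℝ, EG) (fun a => a) Y (𝒢.one x) := h1.self_of_nhds
  have h2' : ∀ᶠ a in 𝓝 (𝒢.one x), Y a ∈ 𝓔.Ef a := h2
  have h3' : Y (𝒢.one x) = 𝒢.Done x v := h3
  have hn : (𝓔.nabla ξ x v : EG) =
      𝓔.al (𝒢.one x) (lieBr Y (fun g => 𝒢.lT g (ξ (𝒢.s g))) (𝒢.one x)) := by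
    unfold nabla
    rw [dif_pos hex]
    exact tcast_eq (EG := EG) (congrArg 𝒢.one (𝒢.s_one x)) _
  rw [hn]
  refine ⟨al_one_mem 𝓔 x _, fun i => ?_⟩
  have h4 := form_lieBr_leftInv h hξ hξk h1' h2' i
  rw [form_apply, 𝒢.s_one, h3', Ds_Done] at h4
  exact h4

/-- The components of the bracket on the fibres of the bundle of ideals: the structure constants are
the values, at the units, of minus the exterior derivative of the connection form. -/
theorem coef_bracket (𝓔 : EhresmannConnection 𝔨) {x : M} (h : F.Good x) {a b : EG}
    (ha : a ∈ 𝔨.kf x) (hb : b ∈ 𝔨.kf x) :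
    (𝔨.bracket x a b : EG) ∈ 𝔨.kf x ∧ ∀ i, F.coef x (𝔨.bracket x a b) i =
      - extD (F.form 𝓔 i) (𝒢.one x) a b := by
  have hex : (∃ ξ, 𝔨.IsLocalSection ξ x ∧ ξ x = a) ∧ (∃ η, 𝔨.IsLocalSection η x ∧ η x = b) := by
    obtain ⟨ξ, h1, h2, h3⟩ := h.exists_section ha
    obtain ⟨η, h4, h5, h6⟩ := h.exists_section hb
    exact ⟨⟨ξ, ⟨h1, h2⟩, h3⟩, ⟨η, ⟨h4, h5⟩, h6⟩⟩
  -- The sections chosen in the definition of the bracket; the result does not depend on them.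
  let ξ : M → EG := hex.1.choose
  let η : M → EG := hex.2.choose
  obtain ⟨⟨h1, h2⟩, h3⟩ := hex.1.choose_spec
  obtain ⟨⟨h4, h5⟩, h6⟩ := hex.2.choose_spec
  have h1' : SmoothAlong 𝓘(ℝ, EM) 𝒢.one ξ x := h1.self_of_nhds
  have h4' : SmoothAlong 𝓘(ℝ, EM) 𝒢.one η x := h4.self_of_nhds
  have h2' : ∀ᶠ y in 𝓝 x, ξ y ∈ 𝔨.kf y := h2
  have h5' : ∀ᶠ y in 𝓝 x, η y ∈ 𝔨.kf y := h5
  have h3' : ξ x = a := h3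
  have h6' : η x = b := h6
  have hn : (𝔨.bracket x a b : EG) =
      lieBr (fun g => 𝒢.lT g (ξ (𝒢.s g))) (fun g => 𝒢.lT g (η (𝒢.s g))) (𝒢.one x) := by
    unfold bracket
    rw [dif_pos hex]
    rfl
  have hm := lieBr_leftInv_mem 𝓔 h1' h2' h4' h5'
  rw [hn]
  refine ⟨hm, fun i => ?_⟩
  have h7 := extD_apply (h.smoothOneForm_one 𝓔 i)
    (smoothAlong_lT_one h1' (h2'.mono fun y hy => Dt_kf hy))
    (smoothAlong_lT_one h4' (h5'.mono fun y hy => Dt_kf hy))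
  rw [mder_form_leftInv h h1' h2', mder_form_leftInv h h4' h5', lT_one_section h2',
    lT_one_section h5', h3', h6', Ds_kf ha, Ds_kf hb, map_zero, map_zero, form_one hm] at h7
  linarith

/-- The components of the covariant derivative with respect to the pull-back connection. -/
theorem coef_nablaS {g : G} (h : F.Good (𝒢.s g)) {σ : G → EG}
    (hσk : ∀ᶠ a in 𝓝 g, σ a ∈ 𝔨.kf (𝒢.s a))
    (hσ : ∀ i, ContMDiffAt 𝓘(ℝ, EG) 𝓘(ℝ, ℝ) ∞ (fun a => F.coef (𝒢.s a) (σ a) i) g) (v : EG) :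
    (𝓔.nablaS σ g v : EG) ∈ 𝔨.kf (𝒢.s g) ∧ ∀ i, F.coef (𝒢.s g) (𝓔.nablaS σ g v) i =
      mder 𝓘(ℝ, EG) 𝓘(ℝ, ℝ) (fun a => F.coef (𝒢.s a) (σ a) i) g v
      - extD (F.form 𝓔 i) (𝒢.one (𝒢.s g)) (𝒢.Done (𝒢.s g) (𝒢.Ds g v)) (σ g) := by
  have hex : Nonempty (PullbackDecomposition 𝔨 σ g) := by
    refine ⟨⟨F.r, fun i a => F.coef (𝒢.s a) (σ a) i, F.e, hσ, fun i => ⟨?_, ?_⟩, ?_⟩⟩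
    · exact h.eventually.mono fun y hy => hy.smooth i
    · exact h.eventually.mono fun y hy => hy.mem i
    · filter_upwards [h.along, hσk] with a h1 h2 using (h1.sum_coef h2).symm
  -- The decomposition chosen in the definition of the pull-back connection; the result does not
  -- depend on it.
  let d := Classical.choice hex
  let e : Fin d.n → M → EG := d.e
  let σ' : G → EG := σ
  have hd1 : ∀ j, ContMDiffAt 𝓘(ℝ, EG) 𝓘(ℝ, ℝ) ∞ (d.f j) g := d.smooth_f
  have hd2 : ∀ j, SmoothAlong 𝓘(ℝ, EM) 𝒢.one (e j) (𝒢.s g) := fun j =>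
    (d.section_e j).1.self_of_nhds
  have hd3 : ∀ j, ∀ᶠ y in 𝓝 (𝒢.s g), e j y ∈ 𝔨.kf y := fun j => (d.section_e j).2
  have hd4 : ∀ᶠ a in 𝓝 g, σ a = ∑ j, d.f j a • e j (𝒢.s a) := d.eq
  let N : Fin d.n → EG := fun j => 𝓔.nabla (e j) (𝒢.s g) (𝒢.Ds g v)
  have hn : (𝓔.nablaS σ g v : EG) =
      ∑ j, (mder 𝓘(ℝ, EG) 𝓘(ℝ, ℝ) (d.f j) g v • e j (𝒢.s g) + d.f j g • N j) := by
    unfold nablaS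
    rw [dif_pos hex]
    rfl
  have hN := fun j => coef_nabla (𝓔 := 𝓔) h (hd2 j) (hd3 j) (𝒢.Ds g v)
  rw [hn]
  refine ⟨Submodule.sum_mem _ fun j _ => Submodule.add_mem _
    (Submodule.smul_mem _ _ (hd3 j).self_of_nhds) (Submodule.smul_mem _ _ (hN j).1), fun i => ?_⟩
  have hcm : ∀ j, MDifferentiableAt 𝓘(ℝ, EM) 𝓘(ℝ, ℝ) (fun y => F.coef y (e j y) i) (𝒢.s g) :=
    fun j => (h.contMDiffAt_coef 𝓔 (hd2 j) (hd3 j) i).mdifferentiableAt (by simp)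
  have hcs : ∀ j, MDifferentiableAt 𝓘(ℝ, EG) 𝓘(ℝ, ℝ)
      (fun a => F.coef (𝒢.s a) (e j (𝒢.s a)) i) g := fun j =>
    MDifferentiableAt.comp g (hcm j) (𝒢.mdiff_s g)
  have hfm : ∀ j, MDifferentiableAt 𝓘(ℝ, EG) 𝓘(ℝ, ℝ) (d.f j) g := fun j =>
    (hd1 j).mdifferentiableAt (by simp)
  have hc : mder 𝓘(ℝ, EG) 𝓘(ℝ, ℝ) (fun a => F.coef (𝒢.s a) (σ a) i) g v =
      ∑ j, (d.f j g * mder 𝓘(ℝ, EM) 𝓘(ℝ, ℝ) (fun y => F.coef y (e j y) i) (𝒢.s g) (𝒢.Ds g v) +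
        F.coef (𝒢.s g) (e j (𝒢.s g)) i * mder 𝓘(ℝ, EG) 𝓘(ℝ, ℝ) (d.f j) g v) := by
    rw [mder_congr (f' := fun a => ∑ j, d.f j a * F.coef (𝒢.s a) (e j (𝒢.s a)) i)]
    · have hp : ∀ j, MDifferentiableAt 𝓘(ℝ, EG) 𝓘(ℝ, ℝ)
          (fun a => d.f j a * F.coef (𝒢.s a) (e j (𝒢.s a)) i) g := fun j => (hfm j).mul (hcs j)
      rw [(mder_sum _ hp v).2]
      refine Finset.sum_congr rfl fun j _ => ?_
      rw [_root_.mder_mul (hfm j) (hcs j)]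
      congr 2
      exact mder_comp (g := fun y => F.coef y (e j y) i) (hcm j) (𝒢.mdiff_s g) v
    · filter_upwards [hd4] with a ha
      rw [ha, map_sum]
      simp
  have hext : extD (F.form 𝓔 i) (𝒢.one (𝒢.s g)) (𝒢.Done (𝒢.s g) (𝒢.Ds g v)) (σ g) =
      ∑ j, d.f j g *
        extD (F.form 𝓔 i) (𝒢.one (𝒢.s g)) (𝒢.Done (𝒢.s g) (𝒢.Ds g v)) (e j (𝒢.s g)) := by
    let L : EG →ₗ[ℝ] ℝ :=
      { toFun := fun w => extD (F.form 𝓔 i) (𝒢.one (𝒢.s g)) (𝒢.Done (𝒢.s g) (𝒢.Ds g v)) w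
        map_add' := fun w w' => by
          rw [extD_swap, extD_add_left, extD_swap _ _ w, extD_swap _ _ w']; ring
        map_smul' := fun c w => by
          rw [extD_swap, extD_smul_left, extD_swap _ _ w]; simp }
    have : L (σ' g) = ∑ j, d.f j g * L (e j (𝒢.s g)) := by
      rw [show σ' g = ∑ j, d.f j g • e j (𝒢.s g) from hd4.self_of_nhds, map_sum]
      simp
    exact this
  rw [hc, hext, map_sum, Finset.sum_apply, ← Finset.sum_sub_distrib]
  refine Finset.sum_congr rfl fun j _ => ?_
  have := (hN j).2 i
  rw [map_add, map_smul, map_smul, Pi.add_apply, Pi.smul_apply, Pi.smul_apply, this]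
  simp only [smul_eq_mul]
  ring

end Formulas

section Koszul

variable {EG : Type*} [NormedAddCommGroup EG] [NormedSpace ℝ EG]
  {G : Type*} [TopologicalSpace G] [ChartedSpace EG G] [IsManifold 𝓘(ℝ, EG) ∞ G]
  {EM : Type*} [NormedAddCommGroup EM] [NormedSpace ℝ EM]
  {M : Type*} [TopologicalSpace M] [ChartedSpace EM M]
  {𝒢 : LieGroupoid EG G EM M} {𝔨 : 𝒢.BundleOfIdeals} (𝓔 : EhresmannConnection 𝔨)

/-! ### The Koszul formula in low degrees -/

/-- Evaluation of a form, in the model space. -/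
def ev {n : ℕ} (θ : 𝒢.FormFamily n) (g : G) (v : Fin n → EG) : EG := θ g v

/-- The pull-back connection, in the model space. -/
def nabS (σ : G → EG) (g : G) (v : EG) : EG := 𝓔.nablaS σ g v

/-- The exterior derivative of forms, in the model space. -/
def dNab {n : ℕ} (θ : 𝒢.FormFamily n) (X : Fin (n + 1) → G → EG) (g : G) : EG := 𝓔.dNabla θ X g

/-- The Koszul formula for one-forms. -/
theorem dNabla_one (θ : 𝒢.FormFamily 1) (X : Fin 2 → G → EG) (g : G) :
    dNab 𝓔 θ X g = nabS 𝓔 (fun a => ev θ a ![X 1 a]) g (X 0 g)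
      - nabS 𝓔 (fun a => ev θ a ![X 0 a]) g (X 1 g) - ev θ g ![lieBr (X 0) (X 1) g] := by
  let N : Fin 2 → EG := fun i => nabS 𝓔 (fun a => ev θ a (i.removeNth fun l => X l a)) g (X i g)
  let B : Fin 1 → Fin 1 → EG := fun i j =>
    ev θ g (Matrix.vecCons (lieBr (X i.castSucc) (X j.succ) g)
        (j.removeNth (i.castSucc.removeNth fun l => X l g)))
  have h : dNab 𝓔 θ X g = ∑ i : Fin 2, (-1 : ℝ) ^ (i : ℕ) • N i +
    -∑ i : Fin 1, ∑ j ∈ Finset.Ici i, (-1 : ℝ) ^ (i + j : ℕ) • B i j := rfl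
  have h0 : ∀ a, (Fin.removeNth (0 : Fin 2) fun l => X l a) = ![X 1 a] := by
    intro a; funext j; fin_cases j; rfl
  have h1 : ∀ a, (Fin.removeNth (1 : Fin 2) fun l => X l a) = ![X 0 a] := by
    intro a; funext j; fin_cases j; rfl
  have hN0 : N 0 = nabS 𝓔 (fun a => ev θ a ![X 1 a]) g (X 0 g) :=
    congrArg (fun σ : G → EG => nabS 𝓔 σ g (X 0 g))
      (funext fun a => congrArg (ev θ a) (h0 a))
  have hN1 : N 1 = nabS 𝓔 (fun a => ev θ a ![X 0 a]) g (X 1 g) :=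
    congrArg (fun σ : G → EG => nabS 𝓔 σ g (X 1 g))
      (funext fun a => congrArg (ev θ a) (h1 a))
  have hB : B 0 0 = ev θ g ![lieBr (X 0) (X 1) g] := by
    refine congrArg (ev θ g) ?_
    funext j; fin_cases j; rfl
  have h3 : Finset.Ici (0 : Fin 1) = {0} := by decide
  rw [h, Fin.sum_univ_two, Fin.sum_univ_one, h3, Finset.sum_singleton, ← hN0, ← hN1, ← hB]
  simp only [Fin.val_zero, Fin.val_one, pow_zero, pow_one, one_smul, neg_smul, add_zero,
    sub_eq_add_neg]

/-- The Koszul formula for two-forms. -/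
theorem dNabla_two (θ : 𝒢.FormFamily 2) (X : Fin 3 → G → EG) (g : G) :
    dNab 𝓔 θ X g = nabS 𝓔 (fun a => ev θ a ![X 1 a, X 2 a]) g (X 0 g)
      - nabS 𝓔 (fun a => ev θ a ![X 0 a, X 2 a]) g (X 1 g)
      + nabS 𝓔 (fun a => ev θ a ![X 0 a, X 1 a]) g (X 2 g)
      - (ev θ g ![lieBr (X 0) (X 1) g, X 2 g] - ev θ g ![lieBr (X 0) (X 2) g, X 1 g]
        + ev θ g ![lieBr (X 1) (X 2) g, X 0 g]) := by
  let N : Fin 3 → EG := fun i => nabS 𝓔 (fun a => ev θ a (i.removeNth fun l => X l a)) g (X i g)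
  let B : Fin 2 → Fin 2 → EG := fun i j =>
    ev θ g (Matrix.vecCons (lieBr (X i.castSucc) (X j.succ) g)
        (j.removeNth (i.castSucc.removeNth fun l => X l g)))
  have h : dNab 𝓔 θ X g = ∑ i : Fin 3, (-1 : ℝ) ^ (i : ℕ) • N i +
    -∑ i : Fin 2, ∑ j ∈ Finset.Ici i, (-1 : ℝ) ^ (i + j : ℕ) • B i j := rfl
  have h0 : ∀ a, (Fin.removeNth (0 : Fin 3) fun l => X l a) = ![X 1 a, X 2 a] := by
    intro a; funext j; fin_cases j <;> rfl
  have h1 : ∀ a, (Fin.removeNth (1 : Fin 3) fun l => X l a) = ![X 0 a, X 2 a] := by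
    intro a; funext j; fin_cases j <;> rfl
  have h2 : ∀ a, (Fin.removeNth (2 : Fin 3) fun l => X l a) = ![X 0 a, X 1 a] := by
    intro a; funext j; fin_cases j <;> rfl
  have hN0 : N 0 = nabS 𝓔 (fun a => ev θ a ![X 1 a, X 2 a]) g (X 0 g) :=
    congrArg (fun σ : G → EG => nabS 𝓔 σ g (X 0 g))
      (funext fun a => congrArg (ev θ a) (h0 a))
  have hN1 : N 1 = nabS 𝓔 (fun a => ev θ a ![X 0 a, X 2 a]) g (X 1 g) :=
    congrArg (fun σ : G → EG => nabS 𝓔 σ g (X 1 g))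
      (funext fun a => congrArg (ev θ a) (h1 a))
  have hN2 : N 2 = nabS 𝓔 (fun a => ev θ a ![X 0 a, X 1 a]) g (X 2 g) :=
    congrArg (fun σ : G → EG => nabS 𝓔 σ g (X 2 g))
      (funext fun a => congrArg (ev θ a) (h2 a))
  have hB0 : B 0 0 = ev θ g ![lieBr (X 0) (X 1) g, X 2 g] := by
    refine congrArg (ev θ g) ?_
    funext j; fin_cases j <;> rfl
  have hB1 : B 0 1 = ev θ g ![lieBr (X 0) (X 2) g, X 1 g] := by
    refine congrArg (ev θ g) ?_
    funext j; fin_cases j <;> rfl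
  have hB2 : B 1 1 = ev θ g ![lieBr (X 1) (X 2) g, X 0 g] := by
    refine congrArg (ev θ g) ?_
    funext j; fin_cases j <;> rfl
  have h3 : Finset.Ici (0 : Fin 2) = {0, 1} := by decide
  have h4 : Finset.Ici (1 : Fin 2) = {1} := by decide
  have h01 : (0 : Fin 2) ∉ ({1} : Finset (Fin 2)) := by decide
  rw [h, Fin.sum_univ_three, Fin.sum_univ_two, h3, h4, Finset.sum_insert h01, Finset.sum_singleton,
    Finset.sum_singleton, ← hN0, ← hN1, ← hN2, ← hB0, ← hB1, ← hB2]
  simp only [Fin.val_zero, Fin.val_one, Fin.val_two, pow_zero, pow_one, one_smul, neg_smul,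
    add_zero, zero_add, sub_eq_add_neg, Nat.reduceAdd, even_two, Even.neg_pow, one_pow]

end Koszul

section Curvature

variable {EG : Type*} [NormedAddCommGroup EG] [NormedSpace ℝ EG] [FiniteDimensional ℝ EG]
  {G : Type*} [TopologicalSpace G] [ChartedSpace EG G] [IsManifold 𝓘(ℝ, EG) ∞ G]
  {EM : Type*} [NormedAddCommGroup EM] [NormedSpace ℝ EM] [FiniteDimensional ℝ EM]
  {M : Type*} [TopologicalSpace M] [ChartedSpace EM M] [IsManifold 𝓘(ℝ, EM) ∞ M]
  {𝒢 : LieGroupoid EG G EM M} {𝔨 : 𝒢.BundleOfIdeals} (𝓔 : EhresmannConnection 𝔨)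

open BundleOfIdeals EhresmannConnection LocalFrame

/-! ### The curvature -/

variable (𝔨) in
/-- A chosen local frame near `x`. -/
def frameAt (x : M) : LocalFrame 𝔨 x := (nonempty_localFrame 𝔨 x).some

/-- The curvature of the connection: the components of its value are the exterior derivatives of the
components of the connection form, evaluated on horizontal parts. The definition uses a frame
chosen near `s g`, but the value does not depend on it, see `coef_curv`. -/
def curv (g : G) (v w : EG) : EG :=
  ∑ i, extD ((frameAt 𝔨 (𝒢.s g)).form 𝓔 i) g (𝓔.hr g v) (𝓔.hr g w) •
    (frameAt 𝔨 (𝒢.s g)).e i (𝒢.s g)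

variable {𝓔} {x₀ : M} {F : LocalFrame 𝔨 x₀}

/-- On horizontal fields, only the bracket term of the Koszul formula survives. -/
theorem extD_horizontal {g : G} (h : F.Good (𝒢.s g)) {X Y : G → EG}
    (hX : SmoothAlong 𝓘(ℝ, EG) (fun a => a) X g) (hXE : ∀ᶠ a in 𝓝 g, X a ∈ 𝓔.Ef a)
    (hY : SmoothAlong 𝓘(ℝ, EG) (fun a => a) Y g) (hYE : ∀ᶠ a in 𝓝 g, Y a ∈ 𝓔.Ef a) (i : Fin F.r) :
    extD (F.form 𝓔 i) g (X g) (Y g) = - F.form 𝓔 i g (lieBr X Y g) := by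
  have h1 := extD_apply (h.smoothOneForm (𝓔 := 𝓔) i) hX hY
  rw [mder_congr (f' := fun _ => (0 : ℝ)) (hXE.mono fun a ha => form_of_mem ha i), mder_const,
    mder_congr (f' := fun _ => (0 : ℝ)) (hYE.mono fun a ha => form_of_mem ha i), mder_const] at h1
  linarith

variable (𝓔) in
theorem curv_mem (g : G) (v w : EG) : curv 𝓔 g v w ∈ 𝔨.kf (𝒢.s g) :=
  Submodule.sum_mem _ fun i _ => Submodule.smul_mem _ _ ((frameAt 𝔨 (𝒢.s g)).good_self.mem i)

/-- The curvature measures the vertical part of brackets of horizontal fields. -/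
theorem curv_eq {g : G} {X Y : G → EG}
    (hX : SmoothAlong 𝓘(ℝ, EG) (fun a => a) X g) (hXE : ∀ᶠ a in 𝓝 g, X a ∈ 𝓔.Ef a)
    (hY : SmoothAlong 𝓘(ℝ, EG) (fun a => a) Y g) (hYE : ∀ᶠ a in 𝓝 g, Y a ∈ 𝓔.Ef a) :
    curv 𝓔 g (X g) (Y g) = - 𝓔.al g (lieBr X Y g) := by
  have h := (frameAt 𝔨 (𝒢.s g)).good_self
  unfold curv
  rw [hr_of_mem hXE.self_of_nhds, hr_of_mem hYE.self_of_nhds, ← h.sum_form, ← Finset.sum_neg_distrib]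
  refine Finset.sum_congr rfl fun i _ => ?_
  rw [extD_horizontal h hX hXE hY hYE, neg_smul]

variable (𝓔) in
theorem curv_hr (g : G) (v w : EG) : curv 𝓔 g (𝓔.hr g v) (𝓔.hr g w) = curv 𝓔 g v w := by
  unfold curv
  rw [hr_of_mem (hr_mem g v), hr_of_mem (hr_mem g w)]

/-- The components of the curvature with respect to an arbitrary frame. -/
theorem coef_curv {g : G} (h : F.Good (𝒢.s g)) (v w : EG) (i : Fin F.r) :
    F.coef (𝒢.s g) (curv 𝓔 g v w) i = extD (F.form 𝓔 i) g (𝓔.hr g v) (𝓔.hr g w) := by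
  obtain ⟨X, hX, hXE, hXv⟩ := 𝓔.exists_field (hr_mem (𝓔 := 𝓔) g v)
  obtain ⟨Y, hY, hYE, hYw⟩ := 𝓔.exists_field (hr_mem (𝓔 := 𝓔) g w)
  have h1 := curv_eq hX.self_of_nhds hXE hY.self_of_nhds hYE
  have h2 := extD_horizontal h hX.self_of_nhds hXE hY.self_of_nhds hYE i
  rw [hXv, hYw] at h1 h2
  rw [← curv_hr, h1, h2, map_neg]
  rfl

variable (𝓔) in
theorem curv_swap (g : G) (v w : EG) : curv 𝓔 g v w = - curv 𝓔 g w v := by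
  unfold curv
  rw [← Finset.sum_neg_distrib]
  refine Finset.sum_congr rfl fun i _ => ?_
  rw [extD_swap, neg_smul]

variable (𝓔) in
theorem curv_add_left (g : G) (v v' w : EG) :
    curv 𝓔 g (v + v') w = curv 𝓔 g v w + curv 𝓔 g v' w := by
  unfold curv
  rw [← Finset.sum_add_distrib]
  refine Finset.sum_congr rfl fun i _ => ?_
  rw [map_add, extD_add_left, add_smul]

variable (𝓔) in
theorem curv_smul_left (g : G) (c : ℝ) (v w : EG) : curv 𝓔 g (c • v) w = c • curv 𝓔 g v w := by
  unfold curv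
  rw [Finset.smul_sum]
  refine Finset.sum_congr rfl fun i _ => ?_
  rw [map_smul, extD_smul_left, mul_smul]

variable (𝓔) in
theorem curv_add_right (g : G) (v w w' : EG) :
    curv 𝓔 g v (w + w') = curv 𝓔 g v w + curv 𝓔 g v w' := by
  rw [curv_swap, curv_add_left, curv_swap 𝓔 g v w, curv_swap 𝓔 g v w']
  abel

variable (𝓔) in
theorem curv_smul_right (g : G) (c : ℝ) (v w : EG) : curv 𝓔 g v (c • w) = c • curv 𝓔 g v w := by
  rw [curv_swap, curv_smul_left, curv_swap 𝓔 g v w, smul_neg]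

theorem curv_self (g : G) (v : EG) : curv 𝓔 g v v = 0 := by
  have h := curv_swap 𝓔 g v v
  have h2 : (2 : ℝ) • curv 𝓔 g v v = 0 := by
    rw [two_smul]
    nth_rewrite 1 [h]
    exact neg_add_cancel _
  exact (smul_eq_zero.1 h2).resolve_left two_ne_zero

variable (𝓔) in
/-- The curvature at `g` as an alternating form. -/
def curvAlt (g : G) : EG [⋀^Fin 2]→ₗ[ℝ] EG where
  toFun v := curv 𝓔 g (v 0) (v 1)
  map_update_add' m i x y := by
    fin_cases i
    · simpa using curv_add_left 𝓔 g x y (m 1)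
    · simpa using curv_add_right 𝓔 g (m 0) x y
  map_update_smul' m i c x := by
    fin_cases i
    · simpa using curv_smul_left 𝓔 g c x (m 1)
    · simpa using curv_smul_right 𝓔 g c (m 0) x
  map_eq_zero_of_eq' v i j hv hij := by
    have h01 : v 0 = v 1 := by
      fin_cases i <;> fin_cases j
      · exact absurd rfl hij
      · exact hv
      · exact hv.symm
      · exact absurd rfl hij
    change curv 𝓔 g (v 0) (v 1) = 0
    rw [h01, curv_self]

variable (𝓔) in
/-- The curvature as a family of alternating forms on the tangent spaces. -/
def curvForm : 𝒢.FormFamily 2 := fun g => (curvAlt 𝓔 g : EG [⋀^Fin 2]→ₗ[ℝ] EG)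

end Curvature

section CurvatureEquations

variable {EG : Type*} [NormedAddCommGroup EG] [NormedSpace ℝ EG] [FiniteDimensional ℝ EG]
  {G : Type*} [TopologicalSpace G] [ChartedSpace EG G] [IsManifold 𝓘(ℝ, EG) ∞ G]
  {EM : Type*} [NormedAddCommGroup EM] [NormedSpace ℝ EM] [FiniteDimensional ℝ EM]
  {M : Type*} [TopologicalSpace M] [ChartedSpace EM M] [IsManifold 𝓘(ℝ, EM) ∞ M]
  {𝒢 : LieGroupoid EG G EM M} {𝔨 : 𝒢.BundleOfIdeals} {𝓔 : EhresmannConnection 𝔨}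

open BundleOfIdeals EhresmannConnection LocalFrame

/-! ### The curvature is the covariant derivative of the connection form -/

variable {x₀ : M} {F : LocalFrame 𝔨 x₀}

theorem ev_alpha (g : G) (v : EG) : ev 𝓔.alpha g ![v] = 𝓔.al g v := rfl

theorem ev_curvForm (g : G) (v w : EG) : ev (curvForm 𝓔) g ![v, w] = curv 𝓔 g v w := rfl

/-- The covariant derivative, with respect to the pull-back connection, of the connection form
evaluated on a field. -/
theorem coef_nabS_al {g : G} (h : F.Good (𝒢.s g)) {X : G → EG}
    (hX : SmoothAlong 𝓘(ℝ, EG) (fun a => a) X g) (v : EG) :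
    nabS 𝓔 (fun a => 𝓔.al a (X a)) g v ∈ 𝔨.kf (𝒢.s g) ∧ ∀ i,
      F.coef (𝒢.s g) (nabS 𝓔 (fun a => 𝓔.al a (X a)) g v) i =
      mder 𝓘(ℝ, EG) 𝓘(ℝ, ℝ) (fun a => F.form 𝓔 i a (X a)) g v
      - extD (F.form 𝓔 i) (𝒢.one (𝒢.s g)) (𝒢.Done (𝒢.s g) (𝒢.Ds g v)) (𝓔.al g (X g)) :=
  coef_nablaS h (Eventually.of_forall fun a => al_mem a (X a))
    (fun i => h.smoothOneForm (𝓔 := 𝓔) i X hX) v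

/-- The components of `d^∇ α` differ from the exterior derivatives of the components of `α` by
connection coefficients. -/
theorem coef_dNab_alpha {g : G} (h : F.Good (𝒢.s g)) {X : Fin 2 → G → EG}
    (hX : ∀ i, SmoothAlong 𝓘(ℝ, EG) (fun a => a) (X i) g) :
    dNab 𝓔 𝓔.alpha X g ∈ 𝔨.kf (𝒢.s g) ∧ ∀ i, F.coef (𝒢.s g) (dNab 𝓔 𝓔.alpha X g) i =
      extD (F.form 𝓔 i) g (X 0 g) (X 1 g)
      - extD (F.form 𝓔 i) (𝒢.one (𝒢.s g)) (𝒢.Done (𝒢.s g) (𝒢.Ds g (X 0 g))) (𝓔.al g (X 1 g))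
      + extD (F.form 𝓔 i) (𝒢.one (𝒢.s g)) (𝒢.Done (𝒢.s g) (𝒢.Ds g (X 1 g))) (𝓔.al g (X 0 g)) := by
  obtain ⟨m1, c1⟩ := coef_nabS_al (𝓔 := 𝓔) h (hX 1) (X 0 g)
  obtain ⟨m0, c0⟩ := coef_nabS_al (𝓔 := 𝓔) h (hX 0) (X 1 g)
  rw [dNabla_one]
  simp only [ev_alpha]
  refine ⟨Submodule.sub_mem _ (Submodule.sub_mem _ m1 m0) (al_mem g _), fun i => ?_⟩
  rw [map_sub, map_sub, Pi.sub_apply, Pi.sub_apply, c1, c0, ← form_apply,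
    extD_apply (h.smoothOneForm (𝓔 := 𝓔) i) (hX 0) (hX 1)]
  ring

/-- The curvature is the horizontal part of `d^∇ α`: the terms with connection coefficients contain
`α` as a factor. -/
theorem curv_eq_dNab {g : G} {X : Fin 2 → G → EG}
    (hX : ∀ i, SmoothAlong 𝓘(ℝ, EG) (fun a => a) (X i) g) :
    curv 𝓔 g (X 0 g) (X 1 g) = dNab 𝓔 𝓔.alpha (fun i a => 𝓔.hr a (X i a)) g := by
  have h := (frameAt 𝔨 (𝒢.s g)).good_self
  obtain ⟨m, c⟩ := coef_dNab_alpha (𝓔 := 𝓔) h (X := fun i a => 𝓔.hr a (X i a))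
    fun i => 𝓔.smoothAlong_hr (hX i)
  refine h.ext (curv_mem 𝓔 _ _ _) m fun i => ?_
  have h0 : ∀ u : EG, extD ((frameAt 𝔨 (𝒢.s g)).form 𝓔 i) (𝒢.one (𝒢.s g)) u 0 = 0 := by
    intro u
    have := extD_smul_left ((frameAt 𝔨 (𝒢.s g)).form 𝓔 i) (𝒢.one (𝒢.s g)) 0 0 u
    rw [extD_swap, zero_smul, zero_mul] at this
    simpa using this
  rw [coef_curv h, c, al_hr, al_hr, h0, h0]
  ring

/-! ### The structure equation -/

theorem extD_add_right (θ : G → EG →ₗ[ℝ] ℝ) (g : G) (u w w' : EG) :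
    extD θ g u (w + w') = extD θ g u w + extD θ g u w' := by
  rw [extD_swap, extD_add_left, extD_swap θ g u w, extD_swap θ g u w']
  ring

/-- The exterior derivative of the components of the connection form, decomposed into horizontal
and vertical parts. The terms are a component of the curvature, connection coefficients, and
structure constants of the bracket. -/
theorem extD_expand {g : G} (h : F.Good (𝒢.s g)) (v w : EG) (i : Fin F.r) :
    extD (F.form 𝓔 i) g v w = extD (F.form 𝓔 i) g (𝓔.hr g v) (𝓔.hr g w)
      + extD (F.form 𝓔 i) (𝒢.one (𝒢.s g)) (𝒢.Done (𝒢.s g) (𝒢.Ds g v)) (𝓔.al g w)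
      - extD (F.form 𝓔 i) (𝒢.one (𝒢.s g)) (𝒢.Done (𝒢.s g) (𝒢.Ds g w)) (𝓔.al g v)
      + extD (F.form 𝓔 i) (𝒢.one (𝒢.s g)) (𝓔.al g v) (𝓔.al g w) := by
  conv_lhs => rw [← hr_add_lT_al (𝓔 := 𝓔) g v, ← hr_add_lT_al (𝓔 := 𝓔) g w]
  have hv := Dt_kf (al_mem (𝓔 := 𝓔) g v)
  have hw := Dt_kf (al_mem (𝓔 := 𝓔) g w)
  rw [extD_add_left, extD_add_right, extD_add_right, extD_lT 𝓔 h (hr_mem g v) hw,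
    extD_swap _ g (𝒢.lT g _) (𝓔.hr g w), extD_lT 𝓔 h (hr_mem g w) hv, extD_lT_lT 𝓔 h hv hw,
    Ds_hr, Ds_hr]
  ring

/-- The bracket on the fibres, in the model space. -/
def br (𝔨 : 𝒢.BundleOfIdeals) (x : M) (a b : EG) : EG := 𝔨.bracket x a b

theorem wedgeBracket_alpha (g : G) (v : Fin 2 → EG) :
    (𝔨.wedgeBracket 𝓔.alpha 𝓔.alpha g v : EG) =
      br 𝔨 (𝒢.s g) (𝓔.al g (v 0)) (𝓔.al g (v 1)) - br 𝔨 (𝒢.s g) (𝓔.al g (v 1)) (𝓔.al g (v 0)) := by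
  have h : (𝔨.wedgeBracket 𝓔.alpha 𝓔.alpha g v : EG) =
      ∑ σ : Equiv.Perm (Fin 2), (Equiv.Perm.sign σ : ℤ) •
        br 𝔨 (𝒢.s g) (𝓔.al g (v (σ 0))) (𝓔.al g (v (σ 1))) := rfl
  have hu : (Finset.univ : Finset (Equiv.Perm (Fin 2))) = {1, Equiv.swap 0 1} := by decide
  rw [h, hu, Finset.sum_pair (by decide)]
  simp [sub_eq_add_neg]
  rfl

/-- The connection coefficients in `extD_expand` are those by which `d^∇ α` differs from the
exterior derivatives of the components of `α`. What remains is the bracket, written antisymmetrized. -/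
theorem structure_equation {g : G} {X : Fin 2 → G → EG}
    (hX : ∀ i, SmoothAlong 𝓘(ℝ, EG) (fun a => a) (X i) g) :
    curv 𝓔 g (X 0 g) (X 1 g) = dNab 𝓔 𝓔.alpha X g + (1 / 2 : ℝ) •
      (br 𝔨 (𝒢.s g) (𝓔.al g (X 0 g)) (𝓔.al g (X 1 g))
        - br 𝔨 (𝒢.s g) (𝓔.al g (X 1 g)) (𝓔.al g (X 0 g))) := by
  have h := (frameAt 𝔨 (𝒢.s g)).good_self
  obtain ⟨m, c⟩ := coef_dNab_alpha (𝓔 := 𝓔) h hX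
  have b1 := coef_bracket 𝓔 h (al_mem (𝓔 := 𝓔) g (X 0 g)) (al_mem (𝓔 := 𝓔) g (X 1 g))
  have b2 := coef_bracket 𝓔 h (al_mem (𝓔 := 𝓔) g (X 1 g)) (al_mem (𝓔 := 𝓔) g (X 0 g))
  change br 𝔨 _ _ _ ∈ _ ∧ ∀ i, (frameAt 𝔨 (𝒢.s g)).coef (𝒢.s g) (br 𝔨 _ _ _) i = _ at b1 b2
  refine h.ext (curv_mem 𝓔 _ _ _) (Submodule.add_mem _ m
    (Submodule.smul_mem _ _ (Submodule.sub_mem _ b1.1 b2.1))) fun i => ?_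
  rw [map_add, map_smul, map_sub, Pi.add_apply, Pi.smul_apply, Pi.sub_apply, b1.2, b2.2, c,
    coef_curv h, extD_expand h (X 0 g) (X 1 g),
    extD_swap _ (𝒢.one (𝒢.s g)) (𝓔.al g (X 1 g)) (𝓔.al g (X 0 g)), smul_eq_mul]
  ring

/-! ### The curvature is a smooth multiplicative form -/

/-- The curvature is smooth because it is minus the vertical part of the bracket of the horizontal
parts of the fields. -/
theorem smoothAlong_curv {g : G} {X Y : G → EG}
    (hX : ∀ᶠ a in 𝓝 g, SmoothAlong 𝓘(ℝ, EG) (fun a => a) X a)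
    (hY : ∀ᶠ a in 𝓝 g, SmoothAlong 𝓘(ℝ, EG) (fun a => a) Y a) :
    SmoothAlong 𝓘(ℝ, EG) (fun a => 𝒢.one (𝒢.s a)) (fun a => curv 𝓔 a (X a) (Y a)) g := by
  have h := (frameAt 𝔨 (𝒢.s g)).good_self
  have hW := (𝓔.smoothAlong_hr hX.self_of_nhds).lieBr (𝓔.smoothAlong_hr hY.self_of_nhds)
  have hbase : ContMDiffAt 𝓘(ℝ, EG) 𝓘(ℝ, EG) ∞ (fun a => 𝒢.one (𝒢.s a)) g :=
    ContMDiffAt.comp (I' := 𝓘(ℝ, EM)) g 𝒢.smooth_one.contMDiffAt 𝒢.contMDiff_s.contMDiffAt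
  have hs := (SmoothAlong.sum Finset.univ hbase fun i =>
    ((h.smooth i).comp (I' := 𝓘(ℝ, EG)) (φ := 𝒢.s) 𝒢.contMDiff_s.contMDiffAt).smul
      (h.smoothOneForm (𝓔 := 𝓔) i _ hW)).neg
  refine hs.congr (Eventually.of_forall fun _ => rfl) ?_
  filter_upwards [hX.eventually_nhds, hY.eventually_nhds, h.along] with a h1 h2 h3
  rw [h3.sum_form, ← curv_eq (𝓔.smoothAlong_hr h1.self_of_nhds)
    (Eventually.of_forall fun b => hr_mem b (X b)) (𝓔.smoothAlong_hr h2.self_of_nhds)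
    (Eventually.of_forall fun b => hr_mem b (Y b)), curv_hr]

/-- The curvature is multiplicative, because the horizontal projection is. -/
theorem curv_Dm {g₁ g₂ : G} (e : 𝒢.s g₁ = 𝒢.t g₂) {v₀ v₁ w₀ w₁ : EG}
    (c₀ : 𝒢.Ds g₁ v₀ = 𝒢.Dt g₂ w₀) (c₁ : 𝒢.Ds g₁ v₁ = 𝒢.Dt g₂ w₁) :
    curv 𝓔 (𝒢.mul g₁ g₂) (𝒢.Dm g₁ g₂ v₀ w₀) (𝒢.Dm g₁ g₂ v₁ w₁) =
      𝒢.lI g₂ (𝒢.rT g₂ (curv 𝓔 g₁ v₀ v₁)) + curv 𝓔 g₂ w₀ w₁ := by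
  have h₁ := (frameAt 𝔨 (𝒢.s g₁)).good_self
  have h₂ := (frameAt 𝔨 (𝒢.s g₂)).good_self
  have h₂' : (frameAt 𝔨 (𝒢.s g₂)).Good (𝒢.s (𝒢.mul g₁ g₂)) := by rwa [𝒢.s_mul _ _ e]
  have hk : curv 𝓔 g₁ v₀ v₁ ∈ 𝔨.kf (𝒢.t g₂) := by rw [← e]; exact curv_mem 𝓔 _ _ _
  have hm : curv 𝓔 (𝒢.mul g₁ g₂) (𝒢.Dm g₁ g₂ v₀ w₀) (𝒢.Dm g₁ g₂ v₁ w₁) ∈ 𝔨.kf (𝒢.s g₂) := by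
    rw [← 𝒢.s_mul _ _ e]; exact curv_mem 𝓔 _ _ _
  refine h₂.ext hm (Submodule.add_mem _ (lI_rT_mem hk) (curv_mem 𝓔 _ _ _)) fun i => ?_
  have hc := coef_curv (𝓔 := 𝓔) h₂' (𝒢.Dm g₁ g₂ v₀ w₀) (𝒢.Dm g₁ g₂ v₁ w₁) i
  rw [𝒢.s_mul _ _ e, hr_Dm e c₀, hr_Dm e c₁, extD_mul e h₁ h₂ (hr_mem _ _) (hr_mem _ _)
    (by rw [Ds_hr, Dt_hr, c₀]) (by rw [Ds_hr, Dt_hr, c₁])] at hc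
  rw [hc, map_add, Pi.add_apply, coef_curv h₂, add_comm]
  congr 1
  have hs : curv 𝓔 g₁ v₀ v₁ = ∑ k, extD ((frameAt 𝔨 (𝒢.s g₁)).form 𝓔 k) g₁ (𝓔.hr g₁ v₀)
      (𝓔.hr g₁ v₁) • (frameAt 𝔨 (𝒢.s g₁)).e k (𝒢.t g₂) := by
    rw [← e]; rfl
  rw [← al_rT hk, ← form_apply, hs, map_sum, map_sum]
  refine Finset.sum_congr rfl fun k _ => ?_
  rw [map_smul, map_smul, smul_eq_mul, mul_comm]

theorem isMultiplicative_curvForm : 𝒢.IsMultiplicative (curvForm 𝓔) := by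
  intro g₁ g₂ e v w hc
  have hc' : ∀ i, 𝒢.Ds g₁ (v i) = 𝒢.Dt g₂ (w i) := fun i =>
    (tcast_eq (EG := EM) e _).symm.trans (hc i)
  have hk : curv 𝓔 g₁ (v 0) (v 1) ∈ 𝔨.kf (𝒢.t g₂) := by rw [← e]; exact curv_mem 𝓔 _ _ _
  have h1 := curv_Dm (𝓔 := 𝓔) e (hc' 0) (hc' 1)
  have h2 : (tcast (congrArg 𝒢.one (𝒢.t_inv g₂)) (𝒢.Ad (𝒢.inv g₂)
      (tcast (congrArg 𝒢.one (e.trans (𝒢.s_inv g₂).symm)) (curvForm 𝓔 g₁ v))) : EG) =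
      𝒢.lI g₂ (𝒢.rT g₂ (curv 𝓔 g₁ (v 0) (v 1))) := by
    refine (tcast_eq (EG := EG) (congrArg 𝒢.one (𝒢.t_inv g₂)) _).trans ?_
    rw [← Ad_inv (Dt_kf hk) (Ds_kf hk)]
    exact congrArg (fun z : EG => (𝒢.Ad (𝒢.inv g₂) z : EG)) (tcast_eq (EG := EG)
      (congrArg 𝒢.one (e.trans (𝒢.s_inv g₂).symm)) (curvForm 𝓔 g₁ v))
  have h3 : (tcast (congrArg 𝒢.one (𝒢.s_mul g₁ g₂ e)) (curvForm 𝓔 (𝒢.mul g₁ g₂)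
      (fun i => 𝒢.dmul g₁ g₂ (v i, w i))) : EG) =
      curv 𝓔 (𝒢.mul g₁ g₂) (𝒢.Dm g₁ g₂ (v 0) (w 0)) (𝒢.Dm g₁ g₂ (v 1) (w 1)) :=
    tcast_eq (EG := EG) (congrArg 𝒢.one (𝒢.s_mul g₁ g₂ e)) _
  have h4 : (curvForm 𝓔 g₂ w : EG) = curv 𝓔 g₂ (w 0) (w 1) := rfl
  have key : ∀ a b c a' b' c' : EG, a = a' → b = b' → c = c' → b' = a' + c' → a - b + c = 0 := by
    rintro a b c _ _ _ rfl rfl rfl rfl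
    abel
  exact key _ _ _ _ _ _ h2 h3 h4 h1

/-! ### The Bianchi identity -/

/-- The covariant derivative of the curvature, evaluated on horizontal fields. The derivatives of
the components of `Ω(Y, Z) = -α([Y, Z])` are computed from the Koszul formula for `dα(X, [Y, Z])`; by
`extD_expand`, the latter consists of the curvature and of the connection coefficients that make up
the covariant derivative. -/
theorem nabS_curv {g : G} {X Y Z : G → EG} (hX : SmoothAlong 𝓘(ℝ, EG) (fun a => a) X g)
    (hXE : ∀ᶠ a in 𝓝 g, X a ∈ 𝓔.Ef a)
    (hY : ∀ᶠ a in 𝓝 g, SmoothAlong 𝓘(ℝ, EG) (fun a => a) Y a) (hYE : ∀ᶠ a in 𝓝 g, Y a ∈ 𝓔.Ef a)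
    (hZ : ∀ᶠ a in 𝓝 g, SmoothAlong 𝓘(ℝ, EG) (fun a => a) Z a) (hZE : ∀ᶠ a in 𝓝 g, Z a ∈ 𝓔.Ef a) :
    nabS 𝓔 (fun a => curv 𝓔 a (Y a) (Z a)) g (X g) =
      - 𝓔.al g (lieBr X (lieBr Y Z) g) - curv 𝓔 g (X g) (lieBr Y Z g) := by
  have h := (frameAt 𝔨 (𝒢.s g)).good_self
  have hW := hY.self_of_nhds.lieBr hZ.self_of_nhds
  have hσ : ∀ᶠ a in 𝓝 g, curv 𝓔 a (Y a) (Z a) = - 𝓔.al a (lieBr Y Z a) := by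
    filter_upwards [hY, hZ, hYE.eventually_nhds, hZE.eventually_nhds] with a h1 h2 h3 h4
      using curv_eq h1 h3 h2 h4
  have hσc : ∀ i, ∀ᶠ a in 𝓝 g, (frameAt 𝔨 (𝒢.s g)).coef (𝒢.s a) (curv 𝓔 a (Y a) (Z a)) i =
      -(frameAt 𝔨 (𝒢.s g)).form 𝓔 i a (lieBr Y Z a) := by
    intro i
    filter_upwards [hσ] with a ha
    rw [ha, map_neg]; rfl
  have hθ := fun i => h.smoothOneForm (𝓔 := 𝓔) i
  obtain ⟨m, c⟩ := coef_nablaS (𝓔 := 𝓔) h (σ := fun a => curv 𝓔 a (Y a) (Z a))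
    (Eventually.of_forall fun a => curv_mem 𝓔 _ _ _)
    (fun i => ((hθ i _ hW).neg).congr_of_eventuallyEq (hσc i)) (X g)
  refine h.ext m (Submodule.sub_mem _ (Submodule.neg_mem _ (al_mem g _)) (curv_mem 𝓔 _ _ _))
    fun i => ?_
  have hneg : mder 𝓘(ℝ, EG) 𝓘(ℝ, ℝ) (fun a => (frameAt 𝔨 (𝒢.s g)).coef (𝒢.s a)
      (curv 𝓔 a (Y a) (Z a)) i) g (X g) =
      - mder 𝓘(ℝ, EG) 𝓘(ℝ, ℝ) (fun a => (frameAt 𝔨 (𝒢.s g)).form 𝓔 i a (lieBr Y Z a)) g (X g) := by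
    have hd := (hθ i _ hW).mdifferentiableAt (n := ∞) (by simp)
    rw [mder_congr (hσc i)]
    exact congrArg (fun L : EG →L[ℝ] ℝ => L (X g)) (mder_of_hasMFDerivAt hd.hasMFDerivAt.neg)
  have h1 := extD_apply (hθ i) hX hW
  have h2 := extD_expand (𝓔 := 𝓔) h (X g) (lieBr Y Z g) i
  have hXg := hXE.self_of_nhds
  rw [mder_congr (f' := fun _ => (0 : ℝ)) (hXE.mono fun a ha => form_of_mem ha i), mder_const] at h1
  have h0 : ∀ u : EG, extD ((frameAt 𝔨 (𝒢.s g)).form 𝓔 i) (𝒢.one (𝒢.s g)) 0 u = 0 := by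
    intro u
    have := extD_smul_left ((frameAt 𝔨 (𝒢.s g)).form 𝓔 i) (𝒢.one (𝒢.s g)) 0 0 u
    rwa [zero_smul, zero_mul] at this
  have hs : ∀ u u' : EG, extD ((frameAt 𝔨 (𝒢.s g)).form 𝓔 i) (𝒢.one (𝒢.s g)) u (-u') =
      - extD ((frameAt 𝔨 (𝒢.s g)).form 𝓔 i) (𝒢.one (𝒢.s g)) u u' := by
    intro u u'
    have := extD_smul_left ((frameAt 𝔨 (𝒢.s g)).form 𝓔 i) (𝒢.one (𝒢.s g)) (-1) u' u
    rw [neg_one_smul] at this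
    rw [extD_swap, this, extD_swap _ _ u u']
    ring
  rw [al_of_mem hXg, h0, extD_swap _ (𝒢.one (𝒢.s g)) _ (0 : EG), h0, ← coef_curv h] at h2
  have c := c i
  rw [hneg, hσ.self_of_nhds, hs] at c
  change (frameAt 𝔨 (𝒢.s g)).coef (𝒢.s g) (nabS 𝓔 _ g (X g)) i = _ at c
  rw [c, map_sub, map_neg, Pi.sub_apply, Pi.neg_apply, ← form_apply]
  linarith

/-- In the Koszul formula, the terms with curvatures cancel and those with iterated brackets add up
to zero by the Jacobi identity. -/
theorem dNab_curvForm {g : G} {X : Fin 3 → G → EG}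
    (hX : ∀ i, ∀ᶠ a in 𝓝 g, SmoothAlong 𝓘(ℝ, EG) (fun a => a) (X i) a)
    (hXE : ∀ i, ∀ᶠ a in 𝓝 g, X i a ∈ 𝓔.Ef a) : dNab 𝓔 (curvForm 𝓔) X g = 0 := by
  have hn := fun i j k : Fin 3 => nabS_curv (hX i).self_of_nhds (hXE i) (hX j) (hXE j) (hX k) (hXE k)
  rw [dNabla_two]
  simp only [ev_curvForm]
  rw [hn, hn, hn, curv_swap 𝓔 g (lieBr (X 0) (X 1) g), curv_swap 𝓔 g (lieBr (X 0) (X 2) g),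
    curv_swap 𝓔 g (lieBr (X 1) (X 2) g)]
  have hj := congrArg (𝓔.al g)
    (lieBr_jacobi (hX 0).self_of_nhds (hX 1).self_of_nhds (hX 2).self_of_nhds)
  rw [map_add, lieBr_swap (lieBr (X 0) (X 1)), map_neg] at hj
  rw [hj]
  abel

end CurvatureEquations

end LieGroupoid

/-- The derivative of a submersion is surjective. -/
theorem Manifold.IsSubmersionAt.mder_surjective {EG : Type*} [NormedAddCommGroup EG]
    [NormedSpace ℝ EG] {G : Type*} [TopologicalSpace G] [ChartedSpace EG G]
    [IsManifold 𝓘(ℝ, EG) ∞ G] {EM : Type*} [NormedAddCommGroup EM] [NormedSpace ℝ EM] {M : Type*}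
    [TopologicalSpace M] [ChartedSpace EM M] [IsManifold 𝓘(ℝ, EM) ∞ M] {π : G → M} {g : G}
    (h : Manifold.IsSubmersionAt 𝓘(ℝ, EG) 𝓘(ℝ, EM) ∞ π g) (w : EM) :
    ∃ v : EG, mder 𝓘(ℝ, EG) 𝓘(ℝ, EM) π g v = w := by
  obtain ⟨q, τ, hq, hτ, hid, hπτ⟩ := h.exists_split
  have hτg : τ (π g, q g) = g := hid.self_of_nhds
  refine ⟨mder (𝓘(ℝ, EM).prod 𝓘(ℝ, h.complement)) 𝓘(ℝ, EG) τ (π g, q g) (w, 0), ?_⟩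
  have h1 := mder_comp (I := 𝓘(ℝ, EM).prod 𝓘(ℝ, h.complement)) (g := π) (f := τ)
    (x := (π g, q g)) (by rw [hτg]; exact h.contMDiffAt.mdifferentiableAt (by simp))
    (hτ.mdifferentiableAt (by simp)) (w, 0)
  rw [hτg, mder_congr hπτ] at h1
  rw [← h1]
  exact congrArg (fun L : EM × h.complement →L[ℝ] EM => L (w, 0))
    (mfderiv_fst (I := 𝓘(ℝ, EM)) (I' := 𝓘(ℝ, h.complement)))

namespace LieGroupoid

section Morphisms

variable {EG : Type*} [NormedAddCommGroup EG] [NormedSpace ℝ EG]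
  {G : Type*} [TopologicalSpace G] [ChartedSpace EG G] [IsManifold 𝓘(ℝ, EG) ∞ G]
  {EH : Type*} [NormedAddCommGroup EH] [NormedSpace ℝ EH]
  {H : Type*} [TopologicalSpace H] [ChartedSpace EH H] [IsManifold 𝓘(ℝ, EH) ∞ H]
  {EM : Type*} [NormedAddCommGroup EM] [NormedSpace ℝ EM]
  {M : Type*} [TopologicalSpace M] [ChartedSpace EM M] [IsManifold 𝓘(ℝ, EM) ∞ M]
  {𝒢 : LieGroupoid EG G EM M} {ℋ : LieGroupoid EH H EM M} {Φ : G → H}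

/-! ### Morphisms of Lie groupoids -/

theorem IsMorphism.mdiff (hΦ : 𝒢.IsMorphism ℋ Φ) (g : G) :
    MDifferentiableAt 𝓘(ℝ, EG) 𝓘(ℝ, EH) Φ g := hΦ.smooth.mdifferentiable (by simp) g

theorem IsMorphism.Ds_mder (hΦ : 𝒢.IsMorphism ℋ Φ) (g : G) (v : EG) :
    ℋ.Ds (Φ g) (mder 𝓘(ℝ, EG) 𝓘(ℝ, EH) Φ g v) = 𝒢.Ds g v := by
  unfold Ds
  rw [← mder_comp (ℋ.mdiff_s _) (hΦ.mdiff g), mder_congr (Eventually.of_forall hΦ.map_s)]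

theorem IsMorphism.Dt_mder (hΦ : 𝒢.IsMorphism ℋ Φ) (g : G) (v : EG) :
    ℋ.Dt (Φ g) (mder 𝓘(ℝ, EG) 𝓘(ℝ, EH) Φ g v) = 𝒢.Dt g v := by
  unfold Dt
  rw [← mder_comp (ℋ.mdiff_t _) (hΦ.mdiff g), mder_congr (Eventually.of_forall hΦ.map_t)]

/-- The derivative of a morphism is a morphism of the tangent groupoids. -/
theorem IsMorphism.mder_Dm (hΦ : 𝒢.IsMorphism ℋ Φ) {g₁ g₂ : G} (e : 𝒢.s g₁ = 𝒢.t g₂) {v w : EG}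
    (h : 𝒢.Ds g₁ v = 𝒢.Dt g₂ w) :
    mder 𝓘(ℝ, EG) 𝓘(ℝ, EH) Φ (𝒢.mul g₁ g₂) (𝒢.Dm g₁ g₂ v w) =
      ℋ.Dm (Φ g₁) (Φ g₂) (mder 𝓘(ℝ, EG) 𝓘(ℝ, EH) Φ g₁ v) (mder 𝓘(ℝ, EG) 𝓘(ℝ, EH) Φ g₂ w) := by
  obtain ⟨γ₁, γ₂, m1, m2, z1, z2, hc, d1, d2⟩ := exists_composable_curves e h
  subst z1 z2
  have h1 := mder_comp (g := Φ) (hΦ.mdiff _) (𝒢.mdiff_mul m1 m2 hc) (1 : ℝ)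
  rw [𝒢.mder_mul m1 m2 hc, d1, d2] at h1
  rw [← h1, mder_congr (hc.mono fun y hy => hΦ.map_mul _ _ hy)]
  have k1 : MDifferentiableAt 𝓘(ℝ, ℝ) 𝓘(ℝ, EH) (fun y => Φ (γ₁ y)) 0 :=
    MDifferentiableAt.comp (I' := 𝓘(ℝ, EG)) 0 (hΦ.mdiff _) m1
  have k2 : MDifferentiableAt 𝓘(ℝ, ℝ) 𝓘(ℝ, EH) (fun y => Φ (γ₂ y)) 0 :=
    MDifferentiableAt.comp (I' := 𝓘(ℝ, EG)) 0 (hΦ.mdiff _) m2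
  rw [ℋ.mder_mul k1 k2 (hc.mono fun y hy => by rw [hΦ.map_s, hΦ.map_t, hy]),
    mder_comp (hΦ.mdiff _) m1, mder_comp (hΦ.mdiff _) m2, d1, d2]

theorem IsMorphism.mder_lT (hΦ : 𝒢.IsMorphism ℋ Φ) {g : G} {a : EG}
    (ha : 𝒢.Dt (𝒢.one (𝒢.s g)) a = 0) :
    mder 𝓘(ℝ, EG) 𝓘(ℝ, EH) Φ g (𝒢.lT g a) =
      ℋ.lT (Φ g) (mder 𝓘(ℝ, EG) 𝓘(ℝ, EH) Φ (𝒢.one (𝒢.s g)) a) := by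
  have h := hΦ.mder_Dm (𝒢.t_one (𝒢.s g)).symm (v := 0) (w := a) (by rw [map_zero, ha])
  rw [𝒢.mul_one, hΦ.map_one, map_zero, ← hΦ.map_s g] at h
  rw [lT_apply, lT_apply, ← hΦ.map_s g, h]

end Morphisms

section Applications

variable {EG : Type*} [NormedAddCommGroup EG] [NormedSpace ℝ EG] [FiniteDimensional ℝ EG]
  {G : Type*} [TopologicalSpace G] [ChartedSpace EG G] [IsManifold 𝓘(ℝ, EG) ∞ G]
  {EM : Type*} [NormedAddCommGroup EM] [NormedSpace ℝ EM] [FiniteDimensional ℝ EM]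
  {M : Type*} [TopologicalSpace M] [ChartedSpace EM M] [IsManifold 𝓘(ℝ, EM) ∞ M]
  {EH : Type*} [NormedAddCommGroup EH] [NormedSpace ℝ EH] [FiniteDimensional ℝ EH]
  {H : Type*} [TopologicalSpace H] [ChartedSpace EH H] [IsManifold 𝓘(ℝ, EH) ∞ H]
  {𝒢 : LieGroupoid EG G EM M} {𝔨 : 𝒢.BundleOfIdeals} {𝓔 : EhresmannConnection 𝔨}
  {ℋ : LieGroupoid EH H EM M} {Φ : G → H}

open BundleOfIdeals EhresmannConnection LocalFrame

/-! ### Horizontal lifts along a submersion -/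

/-- The connection is complementary to the kernel of a morphism inducing the bundle of ideals. -/
theorem eq_zero_of_mder_eq_zero (hΦ : 𝒢.IsMorphism ℋ Φ)
    (hk : ∀ x b, b ∈ 𝔨.kf x ↔ mder 𝓘(ℝ, EG) 𝓘(ℝ, EH) Φ (𝒢.one x) b = 0) {g : G} {v : EG}
    (hv : v ∈ 𝓔.Ef g) (h : mder 𝓘(ℝ, EG) 𝓘(ℝ, EH) Φ g v = 0) : v = 0 := by
  have ht : 𝒢.Dt g v = 0 := by rw [← hΦ.Dt_mder, h, map_zero]
  have h1 := hΦ.mder_Dm (g₁ := 𝒢.inv g) (g₂ := g) (𝒢.s_inv g) (v := 0) (w := v)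
    (by rw [map_zero, ht])
  rw [h, map_zero, Dm_zero, 𝒢.inv_mul, ← lI_apply] at h1
  rw [← hr_of_mem hv, ← lT_lI ht, hr_lT ((hk _ _).2 h1)]

/-- The horizontal projection changes vectors by elements of the kernel of the morphism. -/
theorem mder_hr (hΦ : 𝒢.IsMorphism ℋ Φ)
    (hk : ∀ x b, b ∈ 𝔨.kf x ↔ mder 𝓘(ℝ, EG) 𝓘(ℝ, EH) Φ (𝒢.one x) b = 0) (g : G) (v : EG) :
    mder 𝓘(ℝ, EG) 𝓘(ℝ, EH) Φ g (𝓔.hr g v) = mder 𝓘(ℝ, EG) 𝓘(ℝ, EH) Φ g v := by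
  have hm := al_mem (𝓔 := 𝓔) g v
  conv_rhs => rw [← hr_add_lT_al (𝓔 := 𝓔) g v]
  rw [map_add, hΦ.mder_lT (Dt_kf hm), (hk _ _).1 hm, map_zero, add_zero]

/-- Horizontal lifts of smooth fields are smooth: the images of a frame of the connection form a
basis of each tangent space of the target. -/
theorem smoothAlong_horizontal_lift (hΦ : 𝒢.IsMorphism ℋ Φ)
    (hsub : Manifold.IsSubmersion 𝓘(ℝ, EG) 𝓘(ℝ, EH) ∞ Φ)
    (hk : ∀ x b, b ∈ 𝔨.kf x ↔ mder 𝓘(ℝ, EG) 𝓘(ℝ, EH) Φ (𝒢.one x) b = 0) {g : G} {U : H → EH}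
    {U' : G → EG} (hU : SmoothAlong 𝓘(ℝ, EH) (fun a => a) U (Φ g))
    (hU' : ∀ᶠ a in 𝓝 g, U' a ∈ 𝓔.Ef a ∧ mder 𝓘(ℝ, EG) 𝓘(ℝ, EH) Φ a (U' a) = U (Φ a)) :
    SmoothAlong 𝓘(ℝ, EG) (fun a => a) U' g := by
  obtain ⟨r, Y, hY⟩ := 𝓔.exists_frame_model g
  have hE : ∀ᶠ a in 𝓝 g, ∃ c : Fin r → ℝ, ∑ j, c j • Y j a = U' a := by
    filter_upwards [hY, hU'] with a ha ha'
    have := ha'.1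
    rwa [← ha.2.2, Submodule.mem_span_range_iff_exists_fun] at this
  let c : G → Fin r → ℝ := fun a => Classical.epsilon fun c => ∑ j, c j • Y j a = U' a
  have hc : ∀ᶠ a in 𝓝 g, ∑ j, c a j • Y j a = U' a := hE.mono fun a ha => Classical.epsilon_spec ha
  have hYg := hY.self_of_nhds
  have hZ : ∀ j, SmoothAlong 𝓘(ℝ, EG) Φ (fun a => mder 𝓘(ℝ, EG) 𝓘(ℝ, EH) Φ a (Y j a)) g := fun j =>
    smoothAlong_mder (b := fun a => a) hΦ.smooth.contMDiffAt (hYg.1 j)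
  have hli : LinearIndependent ℝ (fun j => mder 𝓘(ℝ, EG) 𝓘(ℝ, EH) Φ g (Y j g)) := by
    refine LinearIndependent.map_injOn (v := fun j => Y j g) hYg.2.1
      (mder 𝓘(ℝ, EG) 𝓘(ℝ, EH) Φ g).toLinearMap ?_
    rw [hYg.2.2]
    intro a ha b hb hab
    have h1 : mder 𝓘(ℝ, EG) 𝓘(ℝ, EH) Φ g (a - b) = 0 := by
      rw [map_sub, sub_eq_zero]; exact hab
    exact sub_eq_zero.1 (eq_zero_of_mder_eq_zero hΦ hk (Submodule.sub_mem _ ha hb) h1)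
  have hsp : Submodule.span ℝ (range fun j => mder 𝓘(ℝ, EG) 𝓘(ℝ, EH) Φ g (Y j g)) = ⊤ := by
    rw [eq_top_iff]
    intro w _
    obtain ⟨v, rfl⟩ := (hsub.isSubmersionAt g).mder_surjective w
    rw [← mder_hr (𝓔 := 𝓔) hΦ hk]
    have := hr_mem (𝓔 := 𝓔) g v
    rw [← hYg.2.2, Submodule.mem_span_range_iff_exists_fun] at this
    obtain ⟨d, hd⟩ := this
    rw [← hd, map_sum]
    refine Submodule.sum_mem _ fun j _ => ?_
    rw [map_smul]
    exact Submodule.smul_mem _ _ (Submodule.subset_span ⟨j, rfl⟩)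
  have hw : SmoothAlong 𝓘(ℝ, EG) Φ (fun a => U (Φ a)) g :=
    hU.comp (I' := 𝓘(ℝ, EG)) (φ := Φ) hΦ.smooth.contMDiffAt
  have hu : ∀ᶠ a in 𝓝 g, U (Φ a) = ∑ j, c a j • mder 𝓘(ℝ, EG) 𝓘(ℝ, EH) Φ a (Y j a) := by
    filter_upwards [hc, hU'] with a h1 h2
    rw [← h2.2, ← h1, map_sum]
    simp only [map_smul]
  have hcs := smoothAlong_coeff hZ hw hli hsp hu
  refine (SmoothAlong.sum Finset.univ contMDiffAt_id fun j => (hYg.1 j).smul (hcs j)).congr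
    (Eventually.of_forall fun _ => rfl) ?_
  filter_upwards [hc] with a ha using ha.symm

/-- The horizontal lift of the bracket is the horizontal part of the bracket of the lifts, because
both are mapped to the bracket. -/
theorem curv_horizontal_lift (hΦ : 𝒢.IsMorphism ℋ Φ)
    (hsub : Manifold.IsSubmersion 𝓘(ℝ, EG) 𝓘(ℝ, EH) ∞ Φ)
    (hk : ∀ x b, b ∈ 𝔨.kf x ↔ mder 𝓘(ℝ, EG) 𝓘(ℝ, EH) Φ (𝒢.one x) b = 0) {g : G} {U V : H → EH}
    {U' V' : G → EG} {w : EG} (hU : SmoothAlong 𝓘(ℝ, EH) (fun a => a) U (Φ g))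
    (hV : SmoothAlong 𝓘(ℝ, EH) (fun a => a) V (Φ g))
    (hU' : ∀ᶠ a in 𝓝 g, U' a ∈ 𝓔.Ef a ∧ mder 𝓘(ℝ, EG) 𝓘(ℝ, EH) Φ a (U' a) = U (Φ a))
    (hV' : ∀ᶠ a in 𝓝 g, V' a ∈ 𝓔.Ef a ∧ mder 𝓘(ℝ, EG) 𝓘(ℝ, EH) Φ a (V' a) = V (Φ a))
    (hw : w ∈ 𝓔.Ef g) (hw' : mder 𝓘(ℝ, EG) 𝓘(ℝ, EH) Φ g w = lieBr U V (Φ g)) :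
    𝒢.lT g (curv 𝓔 g (U' g) (V' g)) = w - lieBr U' V' g := by
  have sU := smoothAlong_horizontal_lift hΦ hsub hk hU hU'
  have sV := smoothAlong_horizontal_lift hΦ hsub hk hV hV'
  have hb := mder_lieBr_of_related hΦ.smooth.contMDiffAt sU sV hU hV (hU'.mono fun a h => h.2)
    (hV'.mono fun a h => h.2)
  have hz := eq_zero_of_mder_eq_zero (𝓔 := 𝓔) hΦ hk
    (Submodule.sub_mem _ hw (hr_mem (𝓔 := 𝓔) g (lieBr U' V' g)))
    (by rw [map_sub, hw', mder_hr hΦ hk, hb, sub_self])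
  rw [curv_eq sU (hU'.mono fun a h => h.1) sV (hV'.mono fun a h => h.1), map_neg,
    sub_eq_zero.1 hz]
  conv_rhs => rw [← hr_add_lT_al (𝓔 := 𝓔) g (lieBr U' V' g), map_add, hr_of_mem (hr_mem _ _),
    hr_lT (al_mem _ _)]
  abel

/-! ### The connection induced from a bundle of Lie groups -/

/-- Pulled back along the morphism, the Koszul formula for the components of the connection form
gives the components of the image of the bracket, and the result is the formula `coef_nabla`. -/
theorem mder_lieBr_eq_nabla {ι : H → G} (hι : ℋ.IsMorphism 𝒢 ι) (hst : ∀ p, ℋ.s p = ℋ.t p)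
    (hk : ∀ x b, b ∈ 𝔨.kf x ↔ ∃ a, ℋ.Dt (ℋ.one x) a = 0 ∧
      mder 𝓘(ℝ, EH) 𝓘(ℝ, EG) ι (ℋ.one x) a = b)
    {x : M} {X : M → EM} {X' : H → EH} {ξ : M → EH}
    (hX : SmoothAlong 𝓘(ℝ, EM) (fun a => a) X x)
    (hX' : SmoothAlong 𝓘(ℝ, EH) (fun a => a) X' (ℋ.one x))
    (hXX' : ∀ᶠ p in 𝓝 (ℋ.one x), ℋ.Ds p (X' p) = X (ℋ.s p))
    (hE : ∀ᶠ p in 𝓝 (ℋ.one x), mder 𝓘(ℝ, EH) 𝓘(ℝ, EG) ι p (X' p) ∈ 𝓔.Ef (ι p))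
    (hξ : SmoothAlong 𝓘(ℝ, EM) ℋ.one ξ x) (hξt : ∀ᶠ y in 𝓝 x, ℋ.Dt (ℋ.one y) (ξ y) = 0) :
    mder 𝓘(ℝ, EH) 𝓘(ℝ, EG) ι (ℋ.one x) (lieBr X' (fun p => ℋ.lT p (ξ (ℋ.s p))) (ℋ.one x)) =
      𝓔.nabla (fun y => mder 𝓘(ℝ, EH) 𝓘(ℝ, EG) ι (ℋ.one y) (ξ y)) x (X x) := by
  have hDst : ∀ p, ℋ.Ds p = ℋ.Dt p := by
    intro p
    have : ℋ.s = ℋ.t := funext hst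
    unfold Ds Dt
    rw [this]
  let η : M → EG := fun y => mder 𝓘(ℝ, EH) 𝓘(ℝ, EG) ι (ℋ.one y) (ξ y)
  have hη : SmoothAlong 𝓘(ℝ, EM) 𝒢.one η x :=
    (smoothAlong_mder (b := ℋ.one) hι.smooth.contMDiffAt hξ).congr
      (Eventually.of_forall fun y => (hι.map_one y).symm) (Eventually.of_forall fun _ => rfl)
  have hηk : ∀ᶠ y in 𝓝 x, η y ∈ 𝔨.kf y := hξt.mono fun y hy => (hk _ _).2 ⟨_, hy, rfl⟩
  have hL := smoothAlong_lT_one hξ hξt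
  -- The bracket is vertical, because the left-invariant field is related to zero under the source.
  have hLs : ∀ᶠ p in 𝓝 (ℋ.one x), ℋ.Ds p (ℋ.lT p (ξ (ℋ.s p))) = (fun _ => (0 : EM)) (ℋ.s p) := by
    filter_upwards [eventually_s_one hξt] with p hp
    rw [Ds_lT hp, hDst, hp]
  have hbr := mder_lieBr_of_related ℋ.contMDiff_s.contMDiffAt hX' hL
    (X := X) (Y := fun _ => 0) (by rwa [ℋ.s_one]) (SmoothAlong.zero contMDiffAt_id) hXX' hLs
  rw [lieBr_zero_right] at hbr
  have hvert : ℋ.Dt (ℋ.one x) (lieBr X' (fun p => ℋ.lT p (ξ (ℋ.s p))) (ℋ.one x)) = 0 := by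
    rw [← hDst]; exact hbr
  have hm : mder 𝓘(ℝ, EH) 𝓘(ℝ, EG) ι (ℋ.one x)
      (lieBr X' (fun p => ℋ.lT p (ξ (ℋ.s p))) (ℋ.one x)) ∈ 𝔨.kf x := (hk _ _).2 ⟨_, hvert, rfl⟩
  have h := (frameAt 𝔨 x).good_self
  obtain ⟨nm, nc⟩ := coef_nabla (𝓔 := 𝓔) h hη hηk (X x)
  refine h.ext hm nm fun i => ?_
  have hone := hι.map_one x
  have hθ : SmoothOneForm ((frameAt 𝔨 x).form 𝓔 i) (ι (ℋ.one x)) := by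
    rw [hone]; exact h.smoothOneForm_one 𝓔 i
  have hp := extD_pullback hι.smooth.contMDiffAt hθ hX' hL
  have hform : ∀ᶠ p in 𝓝 (ℋ.one x), (frameAt 𝔨 x).form 𝓔 i (ι p)
      (mder 𝓘(ℝ, EH) 𝓘(ℝ, EG) ι p (ℋ.lT p (ξ (ℋ.s p)))) =
      (frameAt 𝔨 x).coef (ℋ.s p) (η (ℋ.s p)) i := by
    filter_upwards [eventually_s_one hξt, eventually_s_one hηk] with p h1 h2
    have h3 : η (ℋ.s p) ∈ 𝔨.kf (𝒢.s (ι p)) := by rwa [hι.map_s]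
    have h4 := form_lT (𝓔 := 𝓔) (F := frameAt 𝔨 x) h3 i
    rw [hι.map_s] at h4
    rw [hι.mder_lT h1]
    exact h4
  have hc := (h.contMDiffAt_coef 𝓔 hη hηk i).mdifferentiableAt (by simp)
  have h1 := mder_comp (g := fun y => (frameAt 𝔨 x).coef y (η y) i) (by rwa [ℋ.s_one])
    (ℋ.mdiff_s (ℋ.one x)) (X' (ℋ.one x))
  have hXx : ℋ.Ds (ℋ.one x) (X' (ℋ.one x)) = X x := by
    have := hXX'.self_of_nhds
    rwa [ℋ.s_one] at this
  have hv : ℋ.lT (ℋ.one x) (ξ (ℋ.s (ℋ.one x))) = ξ x := by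
    rw [ℋ.s_one, lT_one hξt.self_of_nhds]
  rw [mder_congr hform, h1, mder_congr (f' := fun _ => (0 : ℝ))
    (hE.mono fun p hp => form_of_mem hp i), mder_const, hv, hone] at hp
  change extD _ _ _ (η x) = mder _ _ _ _ (ℋ.Ds (ℋ.one x) _) - _ - _ at hp
  rw [hXx, ℋ.s_one] at hp
  have hEx := hE.self_of_nhds
  rw [hone] at hEx
  have hDsx : 𝒢.Ds (𝒢.one x) (mder 𝓘(ℝ, EH) 𝓘(ℝ, EG) ι (ℋ.one x) (X' (ℋ.one x))) = X x := by
    rw [← hone, hι.Ds_mder, hXx]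
  have hkey := extD_lT 𝓔 (F := frameAt 𝔨 x) (g := 𝒢.one x) (a := η x) (by rwa [𝒢.s_one]) hEx
    (by rw [𝒢.s_one]; exact Dt_kf hηk.self_of_nhds) i
  rw [lT_one (Dt_kf hηk.self_of_nhds), 𝒢.s_one, hDsx] at hkey
  rw [← form_one (𝓔 := 𝓔) hm, nc]
  change _ = mder _ _ (fun y => (frameAt 𝔨 x).coef y (η y) i) x (X x) - extD _ _ _ (η x)
  linarith

end Applications

end LieGroupoid

end

theorem mainTheorem6
    {EG : Type*} [NormedAddCommGroup EG] [NormedSpace ℝ EG] [FiniteDimensional ℝ EG]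
    {G : Type*} [TopologicalSpace G] [ChartedSpace EG G] [IsManifold 𝓘(ℝ, EG) ∞ G]
    {EM : Type*} [NormedAddCommGroup EM] [NormedSpace ℝ EM] [FiniteDimensional ℝ EM]
    {M : Type*} [TopologicalSpace M] [ChartedSpace EM M] [IsManifold 𝓘(ℝ, EM) ∞ M] [T2Space M]
    (𝒢 : LieGroupoid EG G EM M) (𝔨 : 𝒢.BundleOfIdeals)
    (𝓔 : LieGroupoid.EhresmannConnection 𝔨) :
    -- the connection on `k` is the one induced from any bundle of Lie groups that integrates `k`
    (∀ {EP : Type*} [NormedAddCommGroup EP] [NormedSpace ℝ EP] [FiniteDimensional ℝ EP]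
      {P : Type*} [TopologicalSpace P] [ChartedSpace EP P] [IsManifold 𝓘(ℝ, EP) ∞ P]
      (𝒬 : LieGroupoid EP P EM M) (_ : ∀ p, 𝒬.s p = 𝒬.t p)
      (ι : P → G) (hι : 𝒬.IsMorphism 𝒢 ι)
      (_ : ∀ x, ∀ a, 𝒬.dt (𝒬.one x) a = 0 →
        mfderiv 𝓘(ℝ, EP) 𝓘(ℝ, EG) ι (𝒬.one x) a = 0 → a = 0)
      (_ : ∀ x b, b ∈ 𝔨.fiber x ↔ ∃ a, 𝒬.dt (𝒬.one x) a = 0 ∧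
        tcast (hι.map_one x) (mfderiv 𝓘(ℝ, EP) 𝓘(ℝ, EG) ι (𝒬.one x) a) = b)
      (x : M) (X : ∀ y : M, TangentSpace 𝓘(ℝ, EM) y) (X' : ∀ p : P, TangentSpace 𝓘(ℝ, EP) p)
      (ξ : 𝒬.UnitSection),
      SmoothNear EM X x → SmoothNear EP X' (𝒬.one x) →
      (∀ᶠ p in 𝓝 (𝒬.one x), 𝒬.ds p (X' p) = X (𝒬.s p)) →
      (∀ᶠ p in 𝓝 (𝒬.one x), mfderiv 𝓘(ℝ, EP) 𝓘(ℝ, EG) ι p (X' p) ∈ 𝓔.E (ι p)) →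
      𝒬.SmoothSectionNear ξ x → (∀ᶠ y in 𝓝 x, 𝒬.dt (𝒬.one y) (ξ y) = 0) →
      tcast (hι.map_one x) (mfderiv 𝓘(ℝ, EP) 𝓘(ℝ, EG) ι (𝒬.one x)
          (VectorField.mlieBracket 𝓘(ℝ, EP) X' (𝒬.leftInv ξ) (𝒬.one x)))
        = 𝓔.nabla (fun y => tcast (hι.map_one y)
            (mfderiv 𝓘(ℝ, EP) 𝓘(ℝ, EG) ι (𝒬.one y) (ξ y))) x (X x)) ∧
    ∃ Ω : 𝒢.FormFamily 2,
      -- `Ω = D α` is a smooth `k`-valued 2-form, and it is multiplicative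
      𝓔.IsD 𝓔.alpha Ω ∧ 𝔨.IsForm Ω ∧ 𝒢.IsMultiplicative Ω ∧
      -- on horizontal fields it measures the failure of involutivity
      (∀ (g : G) (X Y : ∀ g : G, TangentSpace 𝓘(ℝ, EG) g),
        𝓔.HorizontalNear X g → 𝓔.HorizontalNear Y g →
        𝒢.dLunit g (Ω g ![X g, Y g])
          = 𝓔.hor g (VectorField.mlieBracket 𝓘(ℝ, EG) X Y g)
            - VectorField.mlieBracket 𝓘(ℝ, EG) X Y g) ∧
      -- the case of a Lie groupoid submersion
      (∀ {EH : Type*} [NormedAddCommGroup EH] [NormedSpace ℝ EH] [FiniteDimensional ℝ EH]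
        {H : Type*} [TopologicalSpace H] [ChartedSpace EH H] [IsManifold 𝓘(ℝ, EH) ∞ H]
        (ℋ : LieGroupoid EH H EM M) (Φ : G → H), 𝒢.IsMorphism ℋ Φ →
        Function.Surjective Φ → Manifold.IsSubmersion 𝓘(ℝ, EG) 𝓘(ℝ, EH) ∞ Φ →
        (∀ x b, b ∈ 𝔨.fiber x ↔ mfderiv 𝓘(ℝ, EG) 𝓘(ℝ, EH) Φ (𝒢.one x) b = 0) →
        ∀ (g : G) (U V : ∀ h : H, TangentSpace 𝓘(ℝ, EH) h)
          (U' V' W' : ∀ g : G, TangentSpace 𝓘(ℝ, EG) g),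
          SmoothNear EH U (Φ g) → SmoothNear EH V (Φ g) →
          (∀ᶠ a in 𝓝 g, U' a ∈ 𝓔.E a ∧ mfderiv 𝓘(ℝ, EG) 𝓘(ℝ, EH) Φ a (U' a) = U (Φ a)) →
          (∀ᶠ a in 𝓝 g, V' a ∈ 𝓔.E a ∧ mfderiv 𝓘(ℝ, EG) 𝓘(ℝ, EH) Φ a (V' a) = V (Φ a)) →
          (∀ᶠ a in 𝓝 g, W' a ∈ 𝓔.E a ∧ mfderiv 𝓘(ℝ, EG) 𝓘(ℝ, EH) Φ a (W' a)
            = VectorField.mlieBracket 𝓘(ℝ, EH) U V (Φ a)) →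
          𝒢.dLunit g (Ω g ![U' g, V' g])
            = W' g - VectorField.mlieBracket 𝓘(ℝ, EG) U' V' g) ∧
      -- structure equation
      (∀ (g : G) (X : Fin 2 → ∀ g : G, TangentSpace 𝓘(ℝ, EG) g), (∀ i, SmoothNear EG (X i) g) →
        Ω g (fun i => X i g) = 𝓔.dNabla 𝓔.alpha X g
          + (1 / 2 : ℝ) • 𝔨.wedgeBracket 𝓔.alpha 𝓔.alpha g (fun i => X i g)) ∧
      -- Bianchi identity
      𝓔.IsD Ω 0 := by
  refine ⟨?_, LieGroupoid.curvForm 𝓔, ?_, ⟨?_, ?_⟩, LieGroupoid.isMultiplicative_curvForm,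
    ?_, ?_, ?_, ?_⟩
  · intro EP _ _ _ P _ _ _ 𝒬 hst ι hι _ hk x X X' ξ hX hX' hXX' hE hξ hξt
    refine (tcast_eq (EG := EG) (hι.map_one x) _).trans ?_
    have hcast : (fun y => tcast (hι.map_one y) (mfderiv 𝓘(ℝ, EP) 𝓘(ℝ, EG) ι (𝒬.one y) (ξ y)) :
        𝒢.UnitSection) = fun y => mder 𝓘(ℝ, EP) 𝓘(ℝ, EG) ι (𝒬.one y) (ξ y) :=
      funext fun y => tcast_eq (EG := EG) (hι.map_one y) _
    rw [hcast]
    have hk' : ∀ x b, b ∈ 𝔨.kf x ↔ ∃ a, 𝒬.Dt (𝒬.one x) a = 0 ∧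
        mder 𝓘(ℝ, EP) 𝓘(ℝ, EG) ι (𝒬.one x) a = b := by
      intro x b
      refine (hk x b).trans (exists_congr fun a => and_congr_right fun _ => ?_)
      exact Eq.congr_left (tcast_eq (EG := EG) (hι.map_one x) _)
    exact LieGroupoid.mder_lieBr_eq_nabla hι hst hk' hX.self_of_nhds hX'.self_of_nhds hXX' hE
      hξ.self_of_nhds hξt
  · intro g X hX
    let X' : Fin 2 → G → EG := X
    have h := LieGroupoid.curv_eq_dNab (𝓔 := 𝓔) (X := X') fun i => (hX i).self_of_nhds
    exact h
  · intro g v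
    let v' : Fin 2 → EG := v
    exact LieGroupoid.curv_mem 𝓔 g (v' 0) (v' 1)
  · exact fun g X hX => LieGroupoid.smoothAlong_curv (hX 0) (hX 1)
  · intro g X Y hX hY
    let X' : G → EG := X
    let Y' : G → EG := Y
    have h : 𝒢.lT g (LieGroupoid.curv 𝓔 g (X' g) (Y' g)) =
        𝓔.hr g (lieBr X' Y' g) - lieBr X' Y' g := by
      rw [LieGroupoid.curv_eq hX.1.self_of_nhds hX.2 hY.1.self_of_nhds hY.2, map_neg]
      conv_rhs => enter [2]; rw [← LieGroupoid.EhresmannConnection.hr_add_lT_al (𝓔 := 𝓔) g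
        (lieBr X' Y' g)]
      abel
    exact h
  · intro EH _ _ _ H _ _ _ ℋ Φ hΦ _ hsub hk g U V U' V' W' hU hV hU' hV' hW'
    exact LieGroupoid.curv_horizontal_lift hΦ hsub hk hU.self_of_nhds hV.self_of_nhds hU' hV'
      hW'.self_of_nhds.1 hW'.self_of_nhds.2
  · intro g X hX
    let X' : Fin 2 → G → EG := X
    have h := LieGroupoid.structure_equation (𝓔 := 𝓔) (X := X') fun i => (hX i).self_of_nhds
    have hw := LieGroupoid.wedgeBracket_alpha (𝓔 := 𝓔) g fun i => X' i g
    have key : ∀ a b c d : EG, a = b + (1 / 2 : ℝ) • c → d = c → a = b + (1 / 2 : ℝ) • d := by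
      rintro a b c d h rfl
      exact h
    exact key _ _ _ _ h hw
  · intro g X hX
    let X' : Fin 3 → G → EG := fun i a => 𝓔.hor a (X i a)
    have h := LieGroupoid.dNab_curvForm (𝓔 := 𝓔) (X := X')
      (fun i => (hX i).mono fun a ha => 𝓔.smoothAlong_hr ha)
      fun i => Eventually.of_forall fun a => LieGroupoid.EhresmannConnection.hr_mem a _
    exact h.symm
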